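/- Let $C=[-\frac12,\frac12]^4\subset\mathbb{R}^4$. A *Jordan path* is an embedded closed loop $\Gamma\subset\partial C$ of edges of $C$ which contains at least one edge in each coordinate direction; it is described by an initial vertex of $C$ and the sequence of the directions $1,\dots,4$ of its successive edges. An *initial surface* bounded by $\Gamma$ is a compact embedded topological surface $\Sigma_0\subset C$ with boundary $\Gamma$ and with $\Sigma_0\setminus\Gamma\subset(-\frac12,\frac12)^4$. Let $S$ be the group generated by the Schwarz reflections (half-turns) about the lines through the edges of $\Gamma$, and let $\Sigma=\bigcup_{s\in S}s(\Sigma_0)$ be the complete surface obtained from $\Sigma_0$ by successive Schwarz reflection across boundary edges. It is called *embedded* if it has no self-intersections, that is, if the abstract surface obtained from the patches $s(\Sigma_0)$, $s\in S$, by gluing each patch along each of its boundary edges to its reflection across this edge is mapped to $\mathbb{R}^4$ by a topological embedding. Let $\Lambda(\Sigma)=\{v\in\mathbb{Z}^4 : \Sigma+v=\Sigma\}$. **Theorem.** Every Jordan path in $\mathbb{R}^4$ bounds an initial surface, even one homeomorphic to a disk. Let $\Sigma_0$ be an initial surface bounded by a Jordan path $\Gamma$. Then $\Sigma$ is embedded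 if and only if $\Gamma$ agrees, up to a symmetry of $C$, with one of the following five Jordan paths, which are pairwise different up to symmetry: - with $8$ edges, $\Gamma_3=1231\,4234$, $\Gamma_4=1231\,4324$, $\Gamma_6=1232\,1434$; - with $10$ edges, $\Gamma_7=123\,1413\,214$; - with $12$ edges, $\Gamma_8=123\,214\,123\,214$. If $\Sigma$ is embedded and $\Sigma_0$ is orientable, then the surface $\Sigma$ and its quotient $\Sigma/(\Lambda(\Sigma)\cap(2\mathbb{Z})^4)$ are orientable. If moreover $\Sigma_0$ is homeomorphic to a disk, then $\Sigma/(\Lambda(\Sigma)\cap(2\mathbb{Z})^4)$ is a closed connected orientable surface, whose genus is $9$ if $\Gamma$ agrees up to symmetry with $\Gamma_3$, $\Gamma_4$ or $\Gamma_6$, genus $13$ for $\Gamma_7$, and genus $17$ for $\Gamma_8$. -/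

import Mathlib

noncomputable section

namespace CubeSurface

/-- Euclidean `n`-space. -/
abbrev E (n : ℕ) : Type := EuclideanSpace ℝ (Fin n)

/-! ### The cube and its edge loops -/

/-- The closed unit cube `[-1/2, 1/2]^n`. -/
def cube (n : ℕ) : Set (E n) := {x | ∀ i, -(1 / 2) ≤ x i ∧ x i ≤ 1 / 2}

/-- The open unit cube `(-1/2, 1/2)^n`. -/
def openCube (n : ℕ) : Set (E n) := {x | ∀ i, -(1 / 2) < x i ∧ x i < 1 / 2}

/-- The `2 ^ n` vertices of the cube. -/
def cubeVertices (n : ℕ) : Set (E n) := {x | ∀ i, x i = -(1 / 2) ∨ x i = 1 / 2}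

/-- `a` and `b` are the endpoints of an edge of the cube. -/
def IsCubeEdge {n : ℕ} (a b : E n) : Prop :=
  a ∈ cubeVertices n ∧ b ∈ cubeVertices n ∧ ∃ β, a β ≠ b β ∧ ∀ α, α ≠ β → a α = b α

/-- The `i`-th vertex of the edge path that starts at the vertex `p` and whose successive edges
point in the directions listed in `γ`: an edge in direction `β` changes the sign of the
`β`-coordinate. -/
def wordVertex {n : ℕ} (p : E n) (γ : List (Fin n)) (i : ℕ) : E n :=
  WithLp.toLp 2 fun β => (-1) ^ (γ.take i).count β * p β

/-- The union of the edges of the path with initial vertex `p` and directions `γ`. -/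
def wordPath {n : ℕ} (p : E n) (γ : List (Fin n)) : Set (E n) :=
  ⋃ i ∈ Set.Iio γ.length, segment ℝ (wordVertex p γ i) (wordVertex p γ (i + 1))

/-- A Jordan path: an embedded closed loop of edges of the cube (it returns to its initial vertex
and visits no vertex twice) with at least one edge in each coordinate direction. -/
def IsJordanPath {n : ℕ} (Γ : Set (E n)) : Prop :=
  ∃ (p : E n) (γ : List (Fin n)), p ∈ cubeVertices n ∧ 3 ≤ γ.length ∧ (∀ β, β ∈ γ) ∧
    wordVertex p γ γ.length = p ∧ Set.InjOn (wordVertex p γ) (Set.Iio γ.length) ∧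
    Γ = wordPath p γ

/-- Two sets agree up to a symmetry of the cube. -/
def CubeSymmetric {n : ℕ} (Γ Γ' : Set (E n)) : Prop :=
  ∃ g : E n ≃ᵢ E n, g '' cube n = cube n ∧ g '' Γ = Γ'

/-! ### Initial surfaces -/

/-- `X`, with the subspace topology, is a topological surface with boundary `B`: each point has a
neighbourhood which is homeomorphic to an open subset of the closed half plane, in such a way that
the points of `B` correspond to the points on the boundary line. -/
def IsSurfaceWithBoundary {n : ℕ} (X B : Set (E n)) : Prop :=
  ∀ x : X, ∃ e : OpenPartialHomeomorph X (EuclideanHalfSpace 2),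
    x ∈ e.source ∧ ∀ y ∈ e.source, (y : E n) ∈ B ↔ (e y).val 0 = 0

/-- `S₀` is an initial surface with boundary `Γ`: a compact embedded surface in the cube whose
boundary is the Jordan path `Γ` and whose interior lies in the open cube. -/
structure IsInitialSurface {n : ℕ} (Γ S₀ : Set (E n)) : Prop where
  jordan : IsJordanPath Γ
  compact : IsCompact S₀
  subset_cube : S₀ ⊆ cube n
  boundary_subset : Γ ⊆ S₀
  surface : IsSurfaceWithBoundary S₀ Γ
  interior_subset : S₀ \ Γ ⊆ openCube n

/-- `S₀` is an initial surface with boundary `Γ` which is homeomorphic to the closed disk. -/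
def IsInitialDisk {n : ℕ} (Γ S₀ : Set (E n)) : Prop :=
  IsInitialSurface Γ S₀ ∧
    ∃ h : S₀ ≃ₜ Metric.closedBall (0 : ℂ) 1, ∀ x : S₀, (x : E n) ∈ Γ ↔ ‖(h x : ℂ)‖ = 1

/-! ### Schwarz reflection and the extended surface -/

/-- Schwarz reflection: the half-turn about the line through `a` and `b`. -/
def schwarzReflection {n : ℕ} (a b : E n) : E n ≃ᵃⁱ[ℝ] E n :=
  EuclideanGeometry.reflection (affineSpan ℝ {a, b})

/-- The group generated by the Schwarz reflections across the edges of `Γ`. -/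
def reflectionGroup {n : ℕ} (Γ : Set (E n)) : Subgroup (E n ≃ᵃⁱ[ℝ] E n) :=
  Subgroup.closure {s | ∃ a b, IsCubeEdge a b ∧ segment ℝ a b ⊆ Γ ∧ s = schwarzReflection a b}

/-- The complete surface `Σ ⊆ ℝⁿ`, the union of all surface patches. The reflection of the patch
`s S₀` across its boundary edge `s e` is the patch `s r S₀`, where `r` is the reflection across the
edge `e` of `Γ`; so the patches obtained by successive reflection are the sets `s S₀` with `s` in
the reflection group. -/
def completeSurface {n : ℕ} (Γ S₀ : Set (E n)) : Set (E n) :=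
  ⋃ s ∈ reflectionGroup Γ, (s : E n → E n) '' S₀

/-- The gluing of the patches: the patch `s S₀` is glued to its reflection across the boundary edge
`s e` along this edge, for each edge `e` of `Γ`. -/
inductive Glue {n : ℕ} (Γ S₀ : Set (E n)) :
    reflectionGroup Γ × S₀ → reflectionGroup Γ × S₀ → Prop
  | mk (s t : reflectionGroup Γ) (x : S₀) (a b : E n) (hab : IsCubeEdge a b)
      (hΓ : segment ℝ a b ⊆ Γ) (hx : (x : E n) ∈ segment ℝ a b)
      (ht : (t : E n ≃ᵃⁱ[ℝ] E n) = s * schwarzReflection a b) : Glue Γ S₀ (s, x) (t, x)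

instance {n : ℕ} (Γ : Set (E n)) : TopologicalSpace (reflectionGroup Γ) := ⊥

/-- The complete surface as an abstract surface: the disjoint union of the patches, glued along
their edges, with the quotient topology (the reflection group is discrete). -/
abbrev AbstractSurface {n : ℕ} (Γ S₀ : Set (E n)) : Type := Quot (Glue Γ S₀)

theorem schwarzReflection_apply_of_mem {n : ℕ} {a b x : E n} (hx : x ∈ segment ℝ a b) :
    schwarzReflection a b x = x := by
  unfold schwarzReflection
  rw [EuclideanGeometry.reflection_eq_self_iff]
  have h := convexHull_subset_affineSpan (𝕜 := ℝ) ({a, b} : Set (E n))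
  rw [convexHull_pair] at h
  exact h hx

/-- The map of the abstract surface to `ℝⁿ` that places each patch; its range is `Σ`. -/
def position {n : ℕ} (Γ S₀ : Set (E n)) : AbstractSurface Γ S₀ → E n :=
  Quot.lift (fun q => (q.1 : E n ≃ᵃⁱ[ℝ] E n) (q.2 : E n)) <| by
    rintro _ _ ⟨s, t, x, a, b, hab, hΓ, hx, ht⟩
    simp only [ht, AffineIsometryEquiv.coe_mul, Function.comp_apply,
      schwarzReflection_apply_of_mem hx]

/-- The complete surface is embedded: it is placed in `ℝⁿ` without self-intersections, by a
topological embedding. -/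
def GeneratesEmbedded {n : ℕ} (Γ S₀ : Set (E n)) : Prop :=
  Topology.IsEmbedding (position Γ S₀)

/-! ### Lattices and quotients -/

/-- The vectors `(k ℤ)^n` in `ℝⁿ`. -/
def multiples (n : ℕ) (k : ℤ) : AddSubgroup (E n) where
  carrier := {v | ∀ i, ∃ z : ℤ, v i = k * z}
  zero_mem' i := ⟨0, by simp⟩
  add_mem' {u v} hu hv i := by
    obtain ⟨y, hy⟩ := hu i
    obtain ⟨z, hz⟩ := hv i
    exact ⟨y + z, by simp [hy, hz, mul_add]⟩
  neg_mem' {u} hu i := by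
    obtain ⟨y, hy⟩ := hu i
    exact ⟨-y, by simp [hy]⟩

open scoped Pointwise in
/-- The lattice `Λ(X)`: the integer vectors `v` for which translation by `v` maps `X` to itself. -/
def lattice {n : ℕ} (X : Set (E n)) : AddSubgroup (E n) :=
  AddAction.stabilizer (E n) X ⊓ multiples n 1

/-- The quotient of `X ⊆ ℝⁿ` by the translations in `L`. -/
abbrev TranslationQuotient {n : ℕ} (X : Set (E n)) (L : AddSubgroup (E n)) : Type :=
  Quotient ((QuotientAddGroup.leftRel L).comap (Subtype.val : X → E n))

/-! ### Orientability and genus -/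

/-- The homeomorphism `f` between open subsets of the plane preserves the orientation at `x`: its
local degree at `x` is `1`, that is, for some circle about `x`, which together with its inside lies
in the domain of `f`, the loop `z ↦ f (x + r z) - f x`, `|z| = 1`, is homotopic in the punctured
plane to the loop `z ↦ z`. -/
def PreservesOrientationAt (f : OpenPartialHomeomorph ℂ ℂ) (x : ℂ) : Prop :=
  ∃ r : ℝ, 0 < r ∧ Metric.closedBall x r ⊆ f.source ∧
    ∃ H : C(unitInterval × Circle, ℂ), (∀ q, H q ≠ 0) ∧
      ∀ z : Circle, H (0, z) = f (x + r * z) - f x ∧ H (1, z) = z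

/-- `X` is an orientable surface (without boundary): a second countable Hausdorff space with an
atlas of charts in the plane all of whose transition maps preserve the orientation. -/
def IsOrientableSurface (X : Type) [TopologicalSpace X] : Prop :=
  T2Space X ∧ SecondCountableTopology X ∧
    ∃ A : Set (OpenPartialHomeomorph X ℂ), (∀ x, ∃ e ∈ A, x ∈ e.source) ∧
      ∀ e ∈ A, ∀ e' ∈ A, ∀ x ∈ e.source ∩ e'.source,
        PreservesOrientationAt (e.symm.trans e') (e x)

/-- `X` is a closed connected orientable surface of genus `g`: its Euler characteristic
`V - E + F`, computed from a finite cell decomposition, is `2 - 2 g`. -/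
def IsClosedSurfaceOfGenus (X : Type) [TopologicalSpace X] (g : ℕ) : Prop :=
  IsOrientableSurface X ∧ CompactSpace X ∧ ConnectedSpace X ∧
    ∃ c : Topology.CWComplex (Set.univ : Set X),
      (∀ k, Finite (c.cell k)) ∧ (∀ k, 2 < k → IsEmpty (c.cell k)) ∧
      (Nat.card (c.cell 0) : ℤ) - Nat.card (c.cell 1) + Nat.card (c.cell 2) = 2 - 2 * g

/-! ### The five Jordan paths in dimension four -/

/-- The direction sequences `12314234`, `12314324`, `12321434`, `1231413214`, `123214123214`
(directions are numbered from zero here). -/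
def fiveWords : Fin 5 → List (Fin 4) :=
  ![[0, 1, 2, 0, 3, 1, 2, 3],
    [0, 1, 2, 0, 3, 2, 1, 3],
    [0, 1, 2, 1, 0, 3, 2, 3],
    [0, 1, 2, 0, 3, 0, 2, 1, 0, 3],
    [0, 1, 2, 1, 0, 3, 0, 1, 2, 1, 0, 3]]

/-- The five Jordan paths, starting at the vertex `(1/2, 1/2, 1/2, 1/2)`. -/
def fivePaths (k : Fin 5) : Set (E 4) :=
  wordPath (WithLp.toLp 2 fun _ => 1 / 2) (fiveWords k)

end CubeSurface

end

/-! In each coordinate a generator of the reflection group is the identity or one of `x ↦ 1 - x`, `x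
↦ -1 - x`. Hence every element maps the cube to a unit cube with an integer centre `m`, the signs of
its linear part are the parities of `m`, and `m` determines the element (`IsCell`). If a point of
the cube is mapped into the cube, it is fixed (`IsCell.fixed`). So two patches can meet only in
images of the same point of the initial surface, and only at a point of the path. Embeddedness
therefore depends on the path alone: it says that the stabilizer of each vertex of the path is no
larger than the Klein four-group generated by the half-turns about the two edges there
(`VertexCondition`, `IsInitialSurface.generatesEmbedded_iff`). Stabilizers at inner points of edges
are then also as expected, and local finiteness of the patches gives a closed map.

The vertex condition is decided by computation. Two corners with different directions whose vertices
agree in the directions of the first one violate it (`not_vertexCondition_of_isBad`). A depth first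
search over words, normalized by renaming directions, shows that every other Jordan word is
symmetric to one of the five paths, except `12341234`, which has its own obstruction
(`JordanWord.classified`). For the five paths the condition follows from homomorphisms to `ℤ/2` that
count the two kinds of reflections in each coordinate (`vertexCondition_of_goodCheck`). A count of
near pairs of vertices tells the five paths apart.

For orientability, two patches at an edge and four at a corner are unfolded from a half plane or a
quadrant to a plane chart by sign changes. A half-turn in dimension four has determinant `-1`, just
like the fold across an edge, so giving each patch the orientation prescribed by the determinant is
consistent (`IsPatchSystem.isOrientableSurface`). Even translations have trivial signs, so the same
argument applies to the quotient, which consists of sixteen patches indexed by sign vectors.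
Counting its vertices, edges and faces gives the genus. The disk bounded by a given path is the cone
over it from the centre of the cube. -/

noncomputable section

namespace CubeSurface

open Set Filter Topology

/-! ### Winding numbers, local degrees and signs of transition maps -/

section

/-! ### Winding numbers of loops in the punctured plane -/

/-- The `2π`-periodic function `γ` without zeros has winding number `d` about the origin. -/
def Winds (γ : ℝ → ℂ) (d : ℤ) : Prop :=
  ∃ φ : ℝ → ℂ, Continuous φ ∧ (∀ θ, Complex.exp (φ θ) = γ θ) ∧
    ∀ θ, φ (θ + 2 * Real.pi) = φ θ + d * (2 * Real.pi * Complex.I)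

/-- The exponential map is a covering of the punctured plane, so a continuous logarithm on a
connected space is determined by its value at one point. -/
theorem eq_of_exp_comp_eq {A : Type*} [TopologicalSpace A] [PreconnectedSpace A] {f g : A → ℂ}
    (hf : Continuous f) (hg : Continuous g) (h : ∀ a, Complex.exp (f a) = Complex.exp (g a)) (a : A)
    (ha : f a = g a) : f = g :=
  Complex.isCoveringMap_exp.eq_of_comp_eq hf hg (funext fun x => Subtype.ext (h x)) a ha

theorem exists_log {A : Type*} [TopologicalSpace A] [SimplyConnectedSpace A]
    [LocallyPathConnectedSpace A] {f : A → ℂ} (hf : Continuous f) (h : ∀ a, f a ≠ 0) :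
    ∃ F : A → ℂ, Continuous F ∧ ∀ a, Complex.exp (F a) = f a := by
  obtain ⟨a₀⟩ : Nonempty A := inferInstance
  obtain ⟨F, ⟨-, hF⟩, -⟩ := Complex.isCoveringMapOn_exp.existsUnique_continuousMap_lifts
    (f := ⟨f, hf⟩) (a₀ := a₀) (e₀ := Complex.log (f a₀)) (Complex.exp_log (h a₀)) h
  exact ⟨F, F.continuous, fun a => congrFun hF a⟩

theorem two_pi_I_ne : (2 * Real.pi * Complex.I : ℂ) ≠ 0 := Complex.two_pi_I_ne_zero

/-- Two loops which are homotopic in the punctured plane have the same winding number. -/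
theorem exists_winds_of_homotopy {H : ℝ → ℝ → ℂ}
    (hc : ContinuousOn (Function.uncurry H) (Icc 0 1 ×ˢ univ))
    (h0 : ∀ s ∈ Icc (0 : ℝ) 1, ∀ θ, H s θ ≠ 0)
    (hp : ∀ s ∈ Icc (0 : ℝ) 1, ∀ θ, H s (θ + 2 * Real.pi) = H s θ) :
    ∃ d, ∀ s ∈ Icc (0 : ℝ) 1, Winds (H s) d := by
  -- Clamping the parameter extends the homotopy to all of `ℝ × ℝ`, which is simply connected, so
  -- one logarithm serves all loops at once.
  let p : ℝ → ℝ := fun s => projIcc (0 : ℝ) 1 zero_le_one s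
  have hpc : Continuous p := continuous_subtype_val.comp continuous_projIcc
  have hpm : ∀ s, p s ∈ Icc (0 : ℝ) 1 := fun s => (projIcc (0 : ℝ) 1 zero_le_one s).2
  have hps : ∀ s ∈ Icc (0 : ℝ) 1, p s = s := fun s hs => by
    simp [p, projIcc_of_mem zero_le_one hs]
  have hK : Continuous fun q : ℝ × ℝ => H (p q.1) q.2 := by
    have : Continuous fun q : ℝ × ℝ => (p q.1, q.2) := by fun_prop
    exact hc.comp_continuous this fun q => ⟨hpm _, mem_univ _⟩
  obtain ⟨F, hF, hFe⟩ := exists_log hK fun q => h0 _ (hpm _) _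
  obtain ⟨d, hd⟩ : ∃ d : ℤ, F (0, 0 + 2 * Real.pi) = F (0, 0) + d * (2 * Real.pi * Complex.I) := by
    rw [← Complex.exp_eq_exp_iff_exists_int, hFe, hFe]
    exact hp _ (hpm _) _
  -- Both sides are logarithms of the same function, so the increment over a period found at one
  -- point is the increment everywhere.
  have key : (fun q : ℝ × ℝ => F (q.1, q.2 + 2 * Real.pi)) =
      fun q => F q + d * (2 * Real.pi * Complex.I) := by
    refine eq_of_exp_comp_eq (by fun_prop) (by fun_prop) (fun q => ?_) (0, 0) hd
    rw [hFe, Complex.exp_add, Complex.exp_int_mul_two_pi_mul_I, mul_one, hFe]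
    exact hp _ (hpm _) _
  refine ⟨d, fun s hs => ⟨fun θ => F (s, θ), by fun_prop, fun θ => ?_, fun θ => congrFun key (s, θ)⟩⟩
  rw [hFe]
  simp only [hps s hs]

/-- Two logarithms of `γ` differ by a constant, which cancels in the increment over a period. -/
theorem Winds.unique {γ : ℝ → ℂ} {d e : ℤ} (h : Winds γ d) (h' : Winds γ e) : d = e := by
  obtain ⟨φ, hφ, hφe, hφp⟩ := h
  obtain ⟨ψ, hψ, hψe, hψp⟩ := h'
  obtain ⟨k, hk⟩ : ∃ k : ℤ, φ 0 = ψ 0 + k * (2 * Real.pi * Complex.I) := by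
    rw [← Complex.exp_eq_exp_iff_exists_int, hφe, hψe]
  have key : φ = fun θ => ψ θ + k * (2 * Real.pi * Complex.I) := by
    refine eq_of_exp_comp_eq hφ (by fun_prop) (fun q => ?_) 0 hk
    rw [hφe, Complex.exp_add, Complex.exp_int_mul_two_pi_mul_I, mul_one, hψe]
  have h1 := hφp 0
  rw [key] at h1
  simp only [hψp 0] at h1
  have h2 : (e - d : ℂ) * (2 * Real.pi * Complex.I) = 0 := by linear_combination h1
  have h3 : (e : ℂ) - d = 0 := (mul_eq_zero.1 h2).resolve_right two_pi_I_ne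
  exact_mod_cast (sub_eq_zero.1 h3).symm

theorem Winds.of_homotopy {H : ℝ → ℝ → ℂ} {d : ℤ}
    (hc : ContinuousOn (Function.uncurry H) (Icc 0 1 ×ˢ univ))
    (h0 : ∀ s ∈ Icc (0 : ℝ) 1, ∀ θ, H s θ ≠ 0)
    (hp : ∀ s ∈ Icc (0 : ℝ) 1, ∀ θ, H s (θ + 2 * Real.pi) = H s θ) {s t : ℝ}
    (hs : s ∈ Icc (0 : ℝ) 1) (ht : t ∈ Icc (0 : ℝ) 1) (h : Winds (H s) d) : Winds (H t) d := by
  obtain ⟨e, he⟩ := exists_winds_of_homotopy hc h0 hp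
  rw [h.unique (he s hs)]
  exact he t ht

/-- The loop `θ ↦ f (x + r e^{iθ}) - f x`. -/
def loopAt (f : ℂ → ℂ) (x : ℂ) (r : ℝ) (θ : ℝ) : ℂ := f (x + r * Complex.exp (θ * Complex.I)) - f x

theorem exp_periodic (θ : ℝ) :
    Complex.exp ((θ + 2 * Real.pi : ℝ) * Complex.I) = Complex.exp (θ * Complex.I) := by
  push_cast
  rw [add_mul, Complex.exp_add, Complex.exp_two_pi_mul_I, mul_one]

theorem loopAt_periodic (f : ℂ → ℂ) (x : ℂ) (r θ : ℝ) :
    loopAt f x r (θ + 2 * Real.pi) = loopAt f x r θ := by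
  simp only [loopAt, exp_periodic]

theorem circle_mem_closedBall (x : ℂ) {r : ℝ} (hr : 0 ≤ r) (θ : ℝ) :
    x + r * Complex.exp (θ * Complex.I) ∈ Metric.closedBall x r := by
  simp [abs_of_nonneg hr]

theorem circle_ne (x : ℂ) {r : ℝ} (hr : 0 < r) (θ : ℝ) :
    x + r * Complex.exp (θ * Complex.I) ≠ x := by
  simp [hr.ne', Complex.exp_ne_zero]

/-- The winding number of the image of a circle about its centre does not depend on the circle. -/
theorem exists_winds_loopAt {f : ℂ → ℂ} {S : Set ℂ} (hf : ContinuousOn f S) (hi : InjOn f S)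
    {x : ℝ → ℂ} {r : ℝ → ℝ} (hx : Continuous x) (hr : Continuous r)
    (hpos : ∀ s ∈ Icc (0 : ℝ) 1, 0 < r s)
    (hS : ∀ s ∈ Icc (0 : ℝ) 1, Metric.closedBall (x s) (r s) ⊆ S) :
    ∃ d, ∀ s ∈ Icc (0 : ℝ) 1, Winds (loopAt f (x s) (r s)) d := by
  refine exists_winds_of_homotopy (H := fun s => loopAt f (x s) (r s)) ?_ ?_
    (fun s _ θ => loopAt_periodic ..)
  · refine ContinuousOn.sub (hf.comp (Continuous.continuousOn (by fun_prop)) ?_)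
      (hf.comp (Continuous.continuousOn (by fun_prop)) ?_)
    · rintro ⟨s, θ⟩ ⟨hs, -⟩
      exact hS s hs (circle_mem_closedBall _ (hpos s hs).le _)
    · rintro ⟨s, θ⟩ ⟨hs, -⟩
      exact hS s hs (Metric.mem_closedBall_self (hpos s hs).le)
  · intro s hs θ h
    exact circle_ne _ (hpos s hs) θ (hi (hS s hs (circle_mem_closedBall _ (hpos s hs).le _))
      (hS s hs (Metric.mem_closedBall_self (hpos s hs).le)) (sub_eq_zero.1 h))

/-! ### The local degree of a planar homeomorphism -/

/-- The local degree of `f` at `x` is `d`. -/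
def HasDeg (f : ℂ → ℂ) (x : ℂ) (d : ℤ) : Prop := ∀ᶠ r : ℝ in 𝓝[>] 0, Winds (loopAt f x r) d

theorem HasDeg.unique {f : ℂ → ℂ} {x : ℂ} {d e : ℤ} (h : HasDeg f x d) (h' : HasDeg f x e) :
    d = e := by
  obtain ⟨r, h1, h2⟩ := (h.and h').exists
  exact h1.unique h2

theorem HasDeg.congr {f g : ℂ → ℂ} {x : ℂ} {d : ℤ} (h : HasDeg f x d) (hfg : f =ᶠ[𝓝 x] g) :
    HasDeg g x d := by
  obtain ⟨R, hR, hfg⟩ := Metric.eventually_nhds_iff_ball.1 hfg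
  filter_upwards [h, Ioo_mem_nhdsGT hR] with r hr hrR
  convert hr using 1
  ext θ
  unfold loopAt
  rw [hfg x (Metric.mem_ball_self hR), hfg]
  exact Metric.closedBall_subset_ball hrR.2 (circle_mem_closedBall _ hrR.1.le _)

/-- Injectivity keeps the loop away from the origin while the radius changes linearly, so a single
circle inside `S` determines the degree. -/
theorem Winds.hasDeg {f : ℂ → ℂ} {S : Set ℂ} (hf : ContinuousOn f S) (hi : InjOn f S) {x : ℂ}
    {r : ℝ} (hr : 0 < r) (hS : Metric.closedBall x r ⊆ S) {d : ℤ} (h : Winds (loopAt f x r) d) :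
    HasDeg f x d := by
  filter_upwards [Ioo_mem_nhdsGT hr] with t ht
  obtain ⟨e, he⟩ := exists_winds_loopAt hf hi (x := fun _ => x) (r := fun s => r + s * (t - r))
    (by fun_prop) (by fun_prop) (fun s hs => by nlinarith [ht.1, hs.1, hs.2, ht.2])
    (fun s hs => (Metric.closedBall_subset_closedBall
      (by nlinarith [ht.1, hs.1, hs.2, ht.2])).trans hS)
  have h0 := he 0 (by simp)
  have h1 := he 1 (by simp)
  simp only [zero_mul, add_zero, one_mul, add_sub_cancel] at h0 h1
  rwa [h.unique h0]

theorem HasDeg.winds {f : ℂ → ℂ} {S : Set ℂ} (hf : ContinuousOn f S) (hi : InjOn f S) {x : ℂ}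
    {r : ℝ} (hr : 0 < r) (hS : Metric.closedBall x r ⊆ S) {d : ℤ} (h : HasDeg f x d) :
    Winds (loopAt f x r) d := by
  obtain ⟨e, he⟩ := exists_winds_loopAt hf hi (x := fun _ => x) (r := fun _ => r)
    (by fun_prop) (by fun_prop) (fun s hs => hr) (fun s hs => hS)
  have h0 := he 0 (by simp)
  rwa [h.unique (h0.hasDeg hf hi hr hS)]

/-- The local degree is locally constant: the circle of radius `R / 2` stays in `S` while its centre
moves from `x` to a nearby `y`, and this is a homotopy in the punctured plane. -/
theorem exists_hasDeg {f : ℂ → ℂ} {S : Set ℂ} (hf : ContinuousOn f S) (hi : InjOn f S) {x : ℂ}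
    (hS : S ∈ 𝓝 x) : ∃ d, ∀ᶠ y in 𝓝 x, HasDeg f y d := by
  obtain ⟨R, hR, hRS⟩ := Metric.mem_nhds_iff.1 hS
  have hb : Metric.closedBall x (R / 2) ⊆ S :=
    (Metric.closedBall_subset_ball (by linarith)).trans hRS
  obtain ⟨e, he⟩ := exists_winds_loopAt hf hi (x := fun _ => x) (r := fun _ => R / 2)
    (by fun_prop) (by fun_prop) (fun s hs => by linarith) (fun s hs => hb)
  refine ⟨e, ?_⟩
  filter_upwards [Metric.ball_mem_nhds x (half_pos hR)] with y hy
  have hsub : ∀ s ∈ Icc (0 : ℝ) 1, Metric.closedBall (x + s * (y - x)) (R / 2) ⊆ S := by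
    intro s hs
    refine (Metric.closedBall_subset_ball' ?_).trans hRS
    have h1 : dist (x + s * (y - x)) x = s * dist y x := by
      rw [dist_eq_norm, dist_eq_norm, add_sub_cancel_left, norm_mul, Complex.norm_real,
        Real.norm_of_nonneg hs.1]
    rw [h1]
    have := Metric.mem_ball.1 hy
    nlinarith [hs.1, hs.2, dist_nonneg (x := y) (y := x)]
  obtain ⟨e', he'⟩ := exists_winds_loopAt hf hi (x := fun s => x + s * (y - x)) (r := fun _ => R / 2)
    (by fun_prop) (by fun_prop) (fun s hs => by linarith) hsub
  have h0 := he' 0 (by simp)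
  have h1 := he' 1 (by simp)
  have h2 := hsub 1 (by simp)
  simp only [Complex.ofReal_zero, zero_mul, add_zero, Complex.ofReal_one, one_mul,
    add_sub_cancel] at h0 h1 h2
  rw [(he 0 (by simp)).unique h0]
  exact h1.hasDeg hf hi (half_pos hR) h2

theorem Winds.loop_comp_int {γ : ℝ → ℂ} {e : ℤ} (h : Winds γ e) (d : ℤ) :
    Winds (fun θ => γ (d * θ)) (e * d) := by
  obtain ⟨φ, hφ, hφe, hφp⟩ := h
  have hn : ∀ (n : ℕ) (θ : ℝ),
      φ (θ + n * (2 * Real.pi)) = φ θ + n * (e * (2 * Real.pi * Complex.I)) := by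
    intro n
    induction n with
    | zero => simp
    | succ n ih =>
      intro θ
      have : θ + (n + 1 : ℕ) * (2 * Real.pi) = (θ + n * (2 * Real.pi)) + 2 * Real.pi := by
        push_cast; ring
      rw [this, hφp, ih]
      push_cast; ring
  have hz : ∀ (n : ℤ) (θ : ℝ),
      φ (θ + n * (2 * Real.pi)) = φ θ + n * (e * (2 * Real.pi * Complex.I)) := by
    intro n θ
    obtain ⟨m, rfl | rfl⟩ := n.eq_nat_or_neg
    · exact_mod_cast hn m θ
    · have := hn m (θ + (-m : ℤ) * (2 * Real.pi))
      push_cast at this ⊢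
      have h2 : θ + -(m : ℝ) * (2 * Real.pi) + m * (2 * Real.pi) = θ := by ring
      rw [h2] at this
      rw [this]; ring
  refine ⟨fun θ => φ (d * θ), by fun_prop, fun θ => hφe _, fun θ => ?_⟩
  beta_reduce
  rw [mul_add, hz]
  push_cast; ring

/-- Degrees multiply. With `φ` a logarithm of the loop of `f`, the straight homotopy from `φ θ` to
`log a + i d θ` deforms the inner loop to a round circle run through `d` times, and `g` maps that
circle to a loop of winding number `e * d`. -/
theorem HasDeg.comp {f g : ℂ → ℂ} {S T : Set ℂ} (hf : ContinuousOn f S) 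
    (hg : ContinuousOn g T) (hgi : InjOn g T) {x : ℂ} (hS : S ∈ 𝓝 x) (hT : T ∈ 𝓝 (f x)) {d e : ℤ}
    (h : HasDeg f x d) (h' : HasDeg g (f x) e) : HasDeg (g ∘ f) x (e * d) := by
  obtain ⟨R, hR, hRT⟩ := Metric.mem_nhds_iff.1 hT
  have hfx : ContinuousAt f x := hf.continuousAt hS
  obtain ⟨δ, hδ, hδS⟩ := Metric.mem_nhds_iff.1
    (inter_mem hS (hfx (Metric.ball_mem_nhds (f x) hR)))
  filter_upwards [h, Ioo_mem_nhdsGT hδ] with r hr hrδ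
  obtain ⟨φ, hφ, hφe, hφp⟩ := hr
  have hc : ∀ θ : ℝ, f (x + r * Complex.exp (θ * Complex.I)) = f x + Complex.exp (φ θ) := fun θ => by
    rw [hφe, loopAt]; ring
  have hnorm : ∀ θ, ‖Complex.exp (φ θ)‖ < R := fun θ => by
    have := (hδS (Metric.closedBall_subset_ball hrδ.2 (circle_mem_closedBall x hrδ.1.le θ))).2
    rw [mem_preimage, hc, Metric.mem_ball, dist_eq_norm, add_sub_cancel_left] at this
    exact this
  set a : ℝ := R / 2 with ha
  have ha0 : 0 < a := half_pos hR
  let H : ℝ → ℝ → ℂ := fun s θ =>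
    g (f x + Complex.exp ((1 - s) * φ θ + s * (Real.log a + d * θ * Complex.I))) - g (f x)
  -- The modulus stays below `R`, because the real part of the exponent is a convex combination of
  -- two numbers below `log R`. Interpolating logarithms also keeps the inner loop off the origin.
  have hb : ∀ s ∈ Icc (0 : ℝ) 1, ∀ θ : ℝ,
      f x + Complex.exp ((1 - s) * φ θ + s * (Real.log a + d * θ * Complex.I)) ∈ T := by
    intro s hs θ
    apply hRT
    rw [Metric.mem_ball, dist_eq_norm, add_sub_cancel_left, Complex.norm_exp,
      ← Real.lt_log_iff_exp_lt hR]
    have h1 := hnorm θ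
    rw [Complex.norm_exp, ← Real.lt_log_iff_exp_lt hR] at h1
    have h2 : Real.log a < Real.log R := Real.log_lt_log ha0 (by linarith)
    have h3 : ((1 - s : ℂ) * φ θ + s * (Real.log a + d * θ * Complex.I)).re =
        (1 - s) * (φ θ).re + s * Real.log a := by
      have : (1 - s : ℂ) = ((1 - s : ℝ) : ℂ) := by push_cast; ring
      rw [this, Complex.add_re, Complex.re_ofReal_mul, Complex.re_ofReal_mul]
      simp [Complex.mul_re, Complex.mul_im]
    rw [h3]
    rcases hs.1.eq_or_lt with h | h
    · rw [← h]; linarith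
    · nlinarith [hs.2]
  have key := Winds.of_homotopy (H := H) (d := e * d) (s := 1) (t := 0) ?_ ?_ ?_ (by simp) (by simp)
  · have h0 : H 0 = loopAt (g ∘ f) x r := by
      ext θ
      simp [H, loopAt, hc]
    rw [h0] at key
    apply key
    have h1 : H 1 = fun θ => loopAt g (f x) a (d * θ) := by
      ext θ
      simp only [H, loopAt]
      rw [Complex.ofReal_one, sub_self, zero_mul, zero_add, one_mul, Complex.exp_add,
        ← Complex.ofReal_exp, Real.exp_log ha0]
      push_cast
      rfl
    rw [h1]
    apply Winds.loop_comp_int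
    exact h'.winds hg hgi ha0 ((Metric.closedBall_subset_ball (by linarith)).trans hRT)
  · refine ContinuousOn.sub (hg.comp (Continuous.continuousOn (by fun_prop)) ?_)
      continuousOn_const
    rintro ⟨s, θ⟩ ⟨hs, -⟩
    exact hb s hs θ
  · intro s hs θ h
    have := hgi (hb s hs θ) (hRT (Metric.mem_ball_self hR)) (sub_eq_zero.1 h)
    simp [Complex.exp_ne_zero] at this
  · intro s hs θ
    simp only [H]
    congr 3
    rw [hφp, Complex.exp_eq_exp_iff_exists_int]
    refine ⟨d, ?_⟩
    push_cast; ring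

theorem hasDeg_id (x : ℂ) : HasDeg id x 1 := by
  filter_upwards [self_mem_nhdsWithin] with r hr
  have hr : 0 < r := hr
  refine ⟨fun θ => Real.log r + θ * Complex.I, by fun_prop, fun θ => ?_, fun θ => ?_⟩
  · rw [Complex.exp_add, ← Complex.ofReal_exp, Real.exp_log hr]
    simp [loopAt]
  · push_cast; ring

theorem hasDeg_conj (x : ℂ) : HasDeg (starRingEnd ℂ) x (-1) := by
  filter_upwards [self_mem_nhdsWithin] with r hr
  have hr : 0 < r := hr
  refine ⟨fun θ => Real.log r - θ * Complex.I, by fun_prop, fun θ => ?_, fun θ => ?_⟩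
  · rw [Complex.exp_sub, ← Complex.ofReal_exp, Real.exp_log hr, div_eq_mul_inv, ← Complex.exp_neg]
    simp [loopAt, ← Complex.exp_conj]
  · push_cast; ring

/-- The winding number in the sense of homotopy classes of maps of the circle. -/
theorem winds_one_iff {γ : Circle → ℂ} :
    Winds (fun θ => γ (Circle.exp θ)) 1 ↔ ∃ H : C(unitInterval × Circle, ℂ), (∀ q, H q ≠ 0) ∧
      ∀ z : Circle, H (0, z) = γ z ∧ H (1, z) = z := by
  constructor
  · rintro ⟨φ, hφ, hφe, hφp⟩
    -- The function `Complex.arg` jumps, but a jump by `2πn` changes the exponent by `2πin`, since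
    -- `φ` and `θ ↦ θ i` have the same increment over a period. Continuity is checked after pulling
    -- back along the quotient map `Circle.exp`.
    let F : unitInterval × Circle → ℂ := fun q =>
      Complex.exp ((1 - (q.1 : ℝ)) * φ (Complex.arg q.2) + (q.1 : ℝ) * (Complex.arg q.2 * Complex.I))
    have hq : IsOpenQuotientMap (Circle.exp : ℝ → Circle) :=
      ⟨fun z => ⟨Complex.arg z, Circle.exp_arg z⟩, Circle.exp.continuous,
        Circle.isCoveringMap_exp.isLocalHomeomorph.isOpenMap⟩
    have hper : ∀ (θ : ℝ) (n : ℤ),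
        φ (θ + n * (2 * Real.pi)) = φ θ + n * (2 * Real.pi * Complex.I) := by
      have hn : ∀ (n : ℕ) (θ : ℝ),
          φ (θ + n * (2 * Real.pi)) = φ θ + n * (2 * Real.pi * Complex.I) := by
        intro n
        induction n with
        | zero => simp
        | succ n ih =>
          intro θ
          have : θ + (n + 1 : ℕ) * (2 * Real.pi) = (θ + n * (2 * Real.pi)) + 2 * Real.pi := by
            push_cast; ring
          rw [this, hφp, ih]
          push_cast; ring
      intro θ n
      obtain ⟨m, rfl | rfl⟩ := n.eq_nat_or_neg
      · exact_mod_cast hn m θ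
      · have := hn m (θ + (-m : ℤ) * (2 * Real.pi))
        push_cast at this ⊢
        have h2 : θ + -(m : ℝ) * (2 * Real.pi) + m * (2 * Real.pi) = θ := by ring
        rw [h2] at this
        rw [this]; ring
    have hF : F ∘ Prod.map id Circle.exp = fun q : unitInterval × ℝ =>
        Complex.exp ((1 - (q.1 : ℝ)) * φ q.2 + (q.1 : ℝ) * (q.2 * Complex.I)) := by
      ext ⟨s, θ⟩
      simp only [F, Function.comp_apply, Prod.map_apply, id]
      obtain ⟨n, hn⟩ : ∃ n : ℤ, θ = Complex.arg (Circle.exp θ) + n * (2 * Real.pi) := by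
        have h1 : Circle.exp (Complex.arg (Circle.exp θ)) = Circle.exp θ := Circle.exp_arg _
        obtain ⟨m, hm⟩ := Circle.exp_eq_exp.1 h1
        exact ⟨-m, by rw [hm]; push_cast; ring⟩
      generalize Complex.arg (Circle.exp θ) = a at hn
      rw [hn, hper, Complex.exp_eq_exp_iff_exists_int]
      refine ⟨-n, ?_⟩
      push_cast; ring
    have hFc : Continuous F := by
      rw [(IsOpenQuotientMap.id.prodMap hq).isQuotientMap.continuous_iff, hF]
      fun_prop
    refine ⟨⟨F, hFc⟩, fun q => Complex.exp_ne_zero _, fun z => ⟨?_, ?_⟩⟩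
    · simp [F, hφe]
    · have := Circle.exp_arg z
      simp only [ContinuousMap.coe_mk, F]
      conv_rhs => rw [← this]
      rw [Circle.coe_exp]
      simp
  · rintro ⟨H, h0, hH⟩
    have key := Winds.of_homotopy (H := fun s θ => H (projIcc 0 1 zero_le_one s, Circle.exp θ))
      (d := 1) (s := 1) (t := 0) ?_ (fun s _ θ => h0 _) (fun s _ θ => ?_) (by simp) (by simp) ?_
    · simp only [projIcc_left] at key
      convert key using 2 with θ
      exact (hH _).1.symm
    · refine Continuous.continuousOn (H.continuous.comp (Continuous.prodMk ?_ ?_))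
      · exact continuous_projIcc.comp continuous_fst
      · exact Circle.exp.continuous.comp continuous_snd
    · simp only [Circle.exp_add_two_pi]
    · refine ⟨fun θ => θ * Complex.I, by fun_prop, fun θ => ?_, fun θ => ?_⟩
      · simp only [projIcc_right]
        exact ((hH (Circle.exp θ)).2.trans (Circle.coe_exp θ)).symm
      · push_cast; ring

/-- One circle, as in the definition, is as good as all small circles, because the winding number
does not depend on the radius. -/
theorem preservesOrientationAt_iff_hasDeg (f : OpenPartialHomeomorph ℂ ℂ) {x : ℂ}
    (hx : x ∈ f.source) : PreservesOrientationAt f x ↔ HasDeg f x 1 := by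
  have hw : ∀ r : ℝ,
      ((∃ H : C(unitInterval × Circle, ℂ), (∀ q, H q ≠ 0) ∧
      ∀ z : Circle, H (0, z) = f (x + r * z) - f x ∧ H (1, z) = z) ↔ Winds (loopAt f x r) 1) := by
    intro r
    rw [← winds_one_iff (γ := fun z => f (x + r * z) - f x)]
    simp only [Circle.coe_exp]
    rfl
  constructor
  · rintro ⟨r, hr, hS, h⟩
    exact ((hw r).1 h).hasDeg f.continuousOn f.injOn hr hS
  · intro h
    obtain ⟨R, hR, hRS⟩ := Metric.nhds_basis_closedBall.mem_iff.1 (f.open_source.mem_nhds hx)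
    exact ⟨R, hR, hRS, (hw R).2 (h.winds f.continuousOn f.injOn hR hRS)⟩

/-! ### The relative sign of two charts -/

variable {X : Type*} [TopologicalSpace X]

/-- The transition map from the chart `e` to the chart `e'` has local degree `d` at `x`. -/
def HasSign (e e' : OpenPartialHomeomorph X ℂ) (x : X) (d : ℤ) : Prop :=
  HasDeg (e' ∘ e.symm) (e x) d

variable {e e' e'' : OpenPartialHomeomorph X ℂ} {x : X} {d d' : ℤ}

theorem HasSign.unique (h : HasSign e e' x d) (h' : HasSign e e' x d') : d = d' := HasDeg.unique h h'

theorem preservesOrientationAt_iff_hasSign (hx : x ∈ e.source) (hx' : x ∈ e'.source) :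
    PreservesOrientationAt (e.symm.trans e') (e x) ↔ HasSign e e' x 1 := by
  rw [preservesOrientationAt_iff_hasDeg _ (by simp [hx, hx'])]
  rfl

theorem mem_transition_source (hx : x ∈ e.source) (hx' : x ∈ e'.source) :
    (e.symm.trans e').source ∈ 𝓝 (e x) :=
  (e.symm.trans e').open_source.mem_nhds (by simp [hx, hx'])

theorem HasSign.trans (hx : x ∈ e.source) (hx' : x ∈ e'.source) (hx'' : x ∈ e''.source)
    (h : HasSign e e' x d) (h' : HasSign e' e'' x d') : HasSign e e'' x (d' * d) := by
  have hex : (e' ∘ e.symm) (e x) = e' x := by simp [hx]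
  unfold HasSign at h'
  rw [← hex] at h'
  refine (HasDeg.comp (e.symm.trans e').continuousOn
    (e'.symm.trans e'').continuousOn (e'.symm.trans e'').injOn (mem_transition_source hx hx')
    ?_ h h').congr ?_
  · rw [show (e.symm.trans e') (e x) = e' x by simp [hx]]
    exact mem_transition_source hx' hx''
  · filter_upwards [mem_transition_source hx hx'] with y hy
    have : e.symm y ∈ e'.source := by simpa using hy.2
    simp [this]

theorem HasSign.refl (hx : x ∈ e.source) : HasSign e e x 1 := by
  refine (hasDeg_id _).congr ?_
  filter_upwards [e.open_target.mem_nhds (e.map_source hx)] with y hy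
  simp [hy]

theorem exists_hasSign_eventually (hx : x ∈ e.source) (hx' : x ∈ e'.source) :
    ∃ d, ∀ᶠ y in 𝓝 x, HasSign e e' y d := by
  obtain ⟨d, hd⟩ := exists_hasDeg (e.symm.trans e').continuousOn (e.symm.trans e').injOn
    (mem_transition_source hx hx')
  exact ⟨d, (e.continuousAt hx).eventually hd⟩

theorem HasSign.eventually (hx : x ∈ e.source) (hx' : x ∈ e'.source) (h : HasSign e e' x d) :
    ∀ᶠ y in 𝓝 x, HasSign e e' y d := by
  obtain ⟨c, hc⟩ := exists_hasSign_eventually hx hx'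
  rwa [h.unique hc.self_of_nhds]

/-- The transition maps in the two directions are inverse to each other, so their degrees are
integers with product `1`. -/
theorem exists_hasSign (hx : x ∈ e.source) (hx' : x ∈ e'.source) :
    HasSign e e' x 1 ∨ HasSign e e' x (-1) := by
  obtain ⟨d, hd⟩ := exists_hasSign_eventually hx hx'
  obtain ⟨c, hc⟩ := exists_hasSign_eventually hx' hx
  have hd := hd.self_of_nhds
  have h1 := (hd.trans hx hx' hx hc.self_of_nhds).unique (HasSign.refl hx)
  rcases Int.eq_one_or_neg_one_of_mul_eq_one' h1 with ⟨-, rfl⟩ | ⟨-, rfl⟩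
  · exact Or.inl hd
  · exact Or.inr hd

theorem HasSign.symm (hx : x ∈ e.source) (hx' : x ∈ e'.source) (h : HasSign e e' x d) :
    HasSign e' e x d := by
  obtain ⟨c, hc⟩ := exists_hasSign_eventually hx' hx
  have h1 := (h.trans hx hx' hx hc.self_of_nhds).unique (HasSign.refl hx)
  rcases Int.eq_one_or_neg_one_of_mul_eq_one' h1 with ⟨rfl, rfl⟩ | ⟨rfl, rfl⟩ <;>
    exact hc.self_of_nhds

/-- The complex conjugate of a chart. -/
def conjChart (e : OpenPartialHomeomorph X ℂ) : OpenPartialHomeomorph X ℂ :=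
  e.trans Complex.conjLIE.toHomeomorph.toOpenPartialHomeomorph

@[simp] theorem conjChart_source (e : OpenPartialHomeomorph X ℂ) :
    (conjChart e).source = e.source := by
  simp [conjChart]

theorem hasSign_conjChart (hx : x ∈ e.source) : HasSign e (conjChart e) x (-1) := by
  refine (hasDeg_conj _).congr ?_
  filter_upwards [e.open_target.mem_nhds (e.map_source hx)] with y hy
  simp [hy, conjChart]

/-- The sign depends only on the germ of the transition map, so it can be compared across different
spaces. -/
theorem HasSign.of_eventuallyEq {Y : Type*} [TopologicalSpace Y] {f f' : OpenPartialHomeomorph Y ℂ}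
    {y : Y} (h : HasSign e e' x d) (hxy : e x = f y)
    (hef : e' ∘ e.symm =ᶠ[𝓝 (e x)] f' ∘ f.symm) : HasSign f f' y d := by
  unfold HasSign
  rw [← hxy]
  exact HasDeg.congr h hef

end

/-! ### Orientability of spaces assembled from patches by folding -/

section

/-! ### Extending an orientation over a nowhere dense set -/

/-- A surface with an oriented atlas of a dense open subset is orientable, provided that it is
covered by charts each of which has a constant sign with respect to this atlas. -/
theorem isOrientableSurface_of_dense {X : Type} [TopologicalSpace X] [T2Space X]
    [SecondCountableTopology X] (B : Set (OpenPartialHomeomorph X ℂ))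
    (hd : Dense (⋃ e ∈ B, e.source))
    (hcov : ∀ x, ∃ Φ : OpenPartialHomeomorph X ℂ, x ∈ Φ.source ∧
      ∃ d : ℤ, ∀ e ∈ B, ∀ y ∈ e.source ∩ Φ.source, HasSign e Φ y d) : IsOrientableSurface X := by
  have hmeet : ∀ s : Set X, IsOpen s → s.Nonempty → ∃ e ∈ B, ∃ y ∈ s, y ∈ e.source := by
    intro s hs hne
    obtain ⟨y, hy, hyU⟩ := hd.inter_open_nonempty s hs hne
    simp only [mem_iUnion] at hyU
    obtain ⟨e, he, hye⟩ := hyU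
    exact ⟨e, he, y, hy, hye⟩
  -- The atlas consists of all charts that are positive with respect to `B`; a chart of constant
  -- sign enters it, possibly after complex conjugation.
  refine ⟨inferInstance, inferInstance,
    {Φ | ∀ e ∈ B, ∀ y ∈ e.source ∩ Φ.source, HasSign e Φ y 1}, fun x => ?_, ?_⟩
  · obtain ⟨Φ, hx, d, hd⟩ := hcov x
    obtain ⟨e, he, y, hy, hye⟩ := hmeet Φ.source Φ.open_source ⟨x, hx⟩
    have h1 := hd e he y ⟨hye, hy⟩
    rcases exists_hasSign hye hy with h | h
    · have h2 : d = 1 := h1.unique h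
      subst h2
      exact ⟨Φ, hd, hx⟩
    · have h2 : d = -1 := h1.unique h
      subst h2
      refine ⟨conjChart Φ, fun e he y hy => ?_, by simpa using hx⟩
      rw [conjChart_source] at hy
      have h3 := (hd e he y hy).trans hy.1 hy.2 (by simpa using hy.2) (hasSign_conjChart hy.2)
      rwa [show (-1 : ℤ) * -1 = 1 by norm_num] at h3
  · intro Φ hΦ Φ' hΦ' x hx
    rw [preservesOrientationAt_iff_hasSign hx.1 hx.2]
    -- The sign of a transition map is locally constant, so it may be computed at a nearby point of
    -- the dense set, by way of a chart in `B`.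
    obtain ⟨d, hd⟩ := exists_hasSign_eventually hx.1 hx.2
    obtain ⟨s, hs, hso, hxs⟩ := eventually_nhds_iff.1 hd
    obtain ⟨e, he, y, hy, hye⟩ := hmeet (s ∩ (Φ.source ∩ Φ'.source))
      (hso.inter (Φ.open_source.inter Φ'.open_source)) ⟨x, hxs, hx⟩
    have h1 := (hΦ e he y ⟨hye, hy.2.1⟩).symm hye hy.2.1
    have h2 := h1.trans hy.2.1 hye hy.2.2 (hΦ' e he y ⟨hye, hy.2.2⟩)
    have h3 := (hs y hy.1).unique h2
    rw [h3] at hd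
    exact hd.self_of_nhds

/-! ### Sign changes of the plane -/

/-- The map `x + iy ↦ a x + i b y` for signs `a` and `b`. -/
def signIso (a b : ℤˣ) : ℂ ≃ₜ ℂ where
  toFun z := ⟨(a : ℤ) * z.re, (b : ℤ) * z.im⟩
  invFun z := ⟨(a : ℤ) * z.re, (b : ℤ) * z.im⟩
  left_inv z := by
    apply Complex.ext <;> simp [← mul_assoc, ← Int.cast_mul, ← Units.val_mul]
  right_inv z := by
    apply Complex.ext <;> simp [← mul_assoc, ← Int.cast_mul, ← Units.val_mul]
  continuous_toFun := by
    have : Continuous fun z : ℂ =>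
      (((a : ℤ) * z.re : ℝ) : ℂ) + (((b : ℤ) * z.im : ℝ) : ℂ) * Complex.I := by fun_prop
    convert this using 2 with z
    apply Complex.ext <;> simp
  continuous_invFun := by
    have : Continuous fun z : ℂ =>
      (((a : ℤ) * z.re : ℝ) : ℂ) + (((b : ℤ) * z.im : ℝ) : ℂ) * Complex.I := by fun_prop
    convert this using 2 with z
    apply Complex.ext <;> simp

@[simp] theorem signIso_re (a b : ℤˣ) (z : ℂ) : (signIso a b z).re = (a : ℤ) * z.re := rfl

@[simp] theorem signIso_im (a b : ℤˣ) (z : ℂ) : (signIso a b z).im = (b : ℤ) * z.im := rfl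

theorem signIso_mul (a b c d : ℤˣ) (z : ℂ) :
    signIso (a * c) (b * d) z = signIso a b (signIso c d z) := by
  apply Complex.ext <;> simp [mul_assoc]

@[simp] theorem signIso_one (z : ℂ) : signIso 1 1 z = z := by
  apply Complex.ext <;> simp

theorem hasDeg_neg (x : ℂ) : HasDeg (fun z => -z) x 1 := by
  filter_upwards [self_mem_nhdsWithin] with r hr
  have hr : 0 < r := hr
  refine ⟨fun θ => Real.log r + θ * Complex.I + Real.pi * Complex.I, by fun_prop,
    fun θ => ?_, fun θ => ?_⟩
  · rw [Complex.exp_add, Complex.exp_pi_mul_I, Complex.exp_add, ← Complex.ofReal_exp,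
      Real.exp_log hr]
    simp [loopAt]
  · push_cast; ring

/-- Everything reduces to the identity, complex conjugation, and the point reflection, which merely
shifts the logarithm by `π i`. -/
theorem hasDeg_signIso (a b : ℤˣ) (x : ℂ) : HasDeg (signIso a b) x ((a : ℤ) * b) := by
  have hconj : HasDeg (signIso 1 (-1)) x (-1) := by
    convert hasDeg_conj x using 1
    ext z
    apply Complex.ext <;> simp
  rcases Int.units_eq_one_or a with rfl | rfl <;> rcases Int.units_eq_one_or b with rfl | rfl
  · convert hasDeg_id x using 1
    · ext z
      simp
    · norm_num
  · convert hconj using 1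
    norm_num
  · have h := HasDeg.comp (S := univ) (T := univ) (signIso 1 (-1)).continuous.continuousOn
      (g := fun z => -z) continuous_neg.continuousOn neg_injective.injOn univ_mem univ_mem hconj
      (hasDeg_neg _)
    convert h using 1
    · ext z
      apply Complex.ext <;> simp
    · norm_num
  · convert hasDeg_neg x using 1
    · ext z
      apply Complex.ext <;> simp
    · norm_num

variable {X Y : Type*} [TopologicalSpace X] [TopologicalSpace Y]

/-- A chart followed by a sign change of the plane. -/
def signChart (a b : ℤˣ) (e : OpenPartialHomeomorph Y ℂ) : OpenPartialHomeomorph Y ℂ :=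
  e.trans (signIso a b).toOpenPartialHomeomorph

@[simp] theorem signChart_source (a b : ℤˣ) (e : OpenPartialHomeomorph Y ℂ) :
    (signChart a b e).source = e.source := by
  simp [signChart]

@[simp] theorem signChart_apply (a b : ℤˣ) (e : OpenPartialHomeomorph Y ℂ) (y : Y) :
    signChart a b e y = signIso a b (e y) := rfl

theorem hasSign_signChart (a b : ℤˣ) {e : OpenPartialHomeomorph Y ℂ} {x : Y} (hx : x ∈ e.source) :
    HasSign e (signChart a b e) x ((a : ℤ) * b) := by
  refine (hasDeg_signIso a b _).congr ?_
  filter_upwards [e.open_target.mem_nhds (e.map_source hx)] with y hy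
  simp [hy]

/-- Transport of signs along a map which is the identity in the given charts. -/
theorem HasSign.map {f f' : OpenPartialHomeomorph Y ℂ} {F F' : OpenPartialHomeomorph X ℂ}
    {p : Y → X} {y : Y} {d : ℤ} (h : HasSign f f' y d) (hy : y ∈ f.source)
    (hs : ∀ᶠ u in 𝓝 y, p u ∈ F.source) (hF : ∀ᶠ u in 𝓝 y, F (p u) = f u)
    (hF' : ∀ᶠ u in 𝓝 y, F' (p u) = f' u) : HasSign F F' (p y) d := by
  refine h.of_eventuallyEq hF.self_of_nhds.symm ?_
  have hc : Tendsto f.symm (𝓝 (f y)) (𝓝 y) := by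
    have := f.continuousAt_symm (f.map_source hy)
    rwa [ContinuousAt, f.left_inv hy] at this
  filter_upwards [hc.eventually hs, hc.eventually hF, hc.eventually hF',
    f.open_target.mem_nhds (f.map_source hy)] with z h1 h2 h3 h4
  rw [f.right_inv h4] at h2
  have h5 : F.symm z = p (f.symm z) := by
    conv_lhs => rw [← h2]
    exact F.left_inv h1
  simp [h5, h3]

/-! ### Surfaces assembled from patches -/

variable {G : Type*} [Group G]

/-- The space `X` is the union of the patches `P g Y`, and the points of different patches agree
only if they are the same points `y` of `Y`, in patches which differ by an element of `K y`. -/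
structure IsPatchSystem (K : Y → Subgroup G) (P : G → Y → X) : Prop where
  continuous : ∀ g, Continuous (P g)
  surj : ∀ x, ∃ g y, P g y = x
  eq_iff : ∀ {g g' y y'}, P g y = P g' y' ↔ y = y' ∧ g⁻¹ * g' ∈ K y
  closed : ∀ F : G → Set Y, (∀ g, IsClosed (F g)) → IsClosed (⋃ g, P g '' F g)

/-- A chart `ψ` of `Y` with image in the fundamental domain `D` of a finite group of sign changes
of the plane, such that the images of the chart under these sign changes fit together. -/
structure FoldChart (K : Y → Subgroup G) where
  U : Set Y
  isOpen_U : IsOpen U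
  group : Subgroup G
  finite_group : Finite group
  le_group : ∀ u ∈ U, K u ≤ group
  D : Set ℂ
  isClosed_D : IsClosed D
  V : Set ℂ
  isOpen_V : IsOpen V
  ψ : Y → ℂ
  inv : ℂ → Y
  continuousOn_ψ : ContinuousOn ψ U
  continuousOn_inv : ContinuousOn inv (D ∩ V)
  mapsTo : ∀ u ∈ U, ψ u ∈ D ∩ V
  mapsTo_inv : ∀ z ∈ D ∩ V, inv z ∈ U
  left_inv : ∀ u ∈ U, inv (ψ u) = u
  right_inv : ∀ z ∈ D ∩ V, ψ (inv z) = z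
  a : G →* ℤˣ
  b : G →* ℤˣ
  exists_mem_D : ∀ z, ∃ k ∈ group, signIso (a k) (b k) z ∈ D
  mem_K : ∀ u ∈ U, ∀ k ∈ group, signIso (a k) (b k) (ψ u) ∈ D → k ∈ K u
  fixed : ∀ u ∈ U, ∀ k ∈ K u, signIso (a k) (b k) (ψ u) = ψ u

variable {K : Y → Subgroup G} {P : G → Y → X}

/-- The chart of `X` which is obtained from a chart of the patch `g` by folding. -/
theorem IsPatchSystem.exists_chart (hP : IsPatchSystem K P) (c : FoldChart K) (g : G) :
    ∃ Φ : OpenPartialHomeomorph X ℂ,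
      (∀ x, x ∈ Φ.source ↔ ∃ k ∈ c.group, ∃ u ∈ c.U, P (g * k) u = x) ∧
      ∀ k ∈ c.group, ∀ u ∈ c.U, Φ (P (g * k) u) = signIso (c.a k) (c.b k) (c.ψ u) := by
  classical
  let ρ : G → ℂ ≃ₜ ℂ := fun k => signIso (c.a k) (c.b k)
  have hρ : ∀ k k' z, ρ (k * k') z = ρ k (ρ k' z) := fun k k' z => by
    simp only [ρ, map_mul, signIso_mul]
  have hρ1 : ∀ z, ρ 1 z = z := fun z => by simp [ρ]
  have hρi : ∀ k z, ρ k (ρ k⁻¹ z) = z := fun k z => by rw [← hρ, mul_inv_cancel, hρ1]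
  have hρi' : ∀ k z, ρ k⁻¹ (ρ k z) = z := fun k z => by rw [← hρ, inv_mul_cancel, hρ1]
  let src : Set X := {x | ∃ k ∈ c.group, ∃ u ∈ c.U, P (g * k) u = x}
  let tgt : Set ℂ := {z | ∃ k ∈ c.group, ∃ d ∈ c.D ∩ c.V, ρ k d = z}
  -- Well defined: elements of `K u` act trivially on `c.ψ u`, so the value does not depend on the
  -- patch that represents the point.
  have hwd : ∀ k k' u u', u ∈ c.U → P (g * k) u = P (g * k') u' →
      ρ k (c.ψ u) = ρ k' (c.ψ u') := by
    intro k k' u u' hu h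
    obtain ⟨rfl, hk⟩ := hP.eq_iff.1 h
    have hk : k⁻¹ * k' ∈ K u := by simpa [mul_assoc] using hk
    have h1 : ρ (k⁻¹ * k') (c.ψ u) = c.ψ u := c.fixed u hu _ hk
    rw [hρ] at h1
    rw [← h1, hρi, h1]
  -- Injective: a sign change that brings a point of the chart back into `D` belongs to the
  -- stabilizer of this point by `mem_K`, and then it fixes the point.
  have hinj : ∀ k ∈ c.group, ∀ k' ∈ c.group, ∀ d ∈ c.D ∩ c.V, ∀ d' ∈ c.D, ρ k d = ρ k' d' →
      d = d' ∧ k'⁻¹ * k ∈ K (c.inv d) := by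
    intro k hk k' hk' d hd d' hd' h
    have h1 : ρ (k'⁻¹ * k) d = d' := by rw [hρ, h, hρi']
    have h2 : k'⁻¹ * k ∈ K (c.inv d) := by
      refine c.mem_K _ (c.mapsTo_inv d hd) _ (mul_mem (inv_mem hk') hk) ?_
      rw [c.right_inv d hd]
      change ρ (k'⁻¹ * k) d ∈ _
      rwa [h1]
    have h3 : ρ (k'⁻¹ * k) d = d := by
      have := c.fixed _ (c.mapsTo_inv d hd) _ h2
      rwa [c.right_inv d hd] at this
    exact ⟨h3.symm.trans h1, h2⟩
  let Φ : X → ℂ := fun x => if h : x ∈ src then ρ h.choose (c.ψ h.choose_spec.2.choose) else 0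
  have hΦ : ∀ k ∈ c.group, ∀ u ∈ c.U, Φ (P (g * k) u) = ρ k (c.ψ u) := by
    intro k hk u hu
    have h : P (g * k) u ∈ src := ⟨k, hk, u, hu, rfl⟩
    simp only [Φ, dif_pos h]
    exact hwd _ _ _ _ h.choose_spec.2.choose_spec.1 h.choose_spec.2.choose_spec.2
  let Ψ : ℂ → X := fun z => if h : z ∈ tgt then P (g * h.choose) (c.inv h.choose_spec.2.choose)
    else P 1 (c.inv 0)
  have hΨ : ∀ k ∈ c.group, ∀ d ∈ c.D ∩ c.V, Ψ (ρ k d) = P (g * k) (c.inv d) := by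
    intro k hk d hd
    have h : ρ k d ∈ tgt := ⟨k, hk, d, hd, rfl⟩
    simp only [Ψ, dif_pos h]
    have h1 := h.choose_spec.2.choose_spec
    obtain ⟨h2, h3⟩ := hinj _ h.choose_spec.1 _ hk _ h1.1 _ hd.1 h1.2
    symm
    rw [hP.eq_iff, h2]
    rw [h2] at h3
    exact ⟨rfl, by simpa [mul_assoc] using h3⟩
  have hmemU : ∀ h y, P h y ∈ src → y ∈ c.U ∧ ∃ k ∈ c.group, h = g * k := by
    rintro h y ⟨k, hk, u, hu, hx⟩
    obtain ⟨rfl, h1⟩ := hP.eq_iff.1 hx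
    refine ⟨hu, k * ((g * k)⁻¹ * h), mul_mem hk (c.le_group u hu h1), by group⟩
  have hmemV : ∀ k ∈ c.group, ∀ d ∈ c.D, ρ k d ∈ tgt → d ∈ c.V := by
    rintro k hk d hd ⟨k', hk', d', hd', h⟩
    obtain ⟨rfl, -⟩ := hinj k' hk' k hk d' hd' d hd h
    exact hd'.2
  -- Openness and continuity in both directions are all verified on closed sets. In the plane this
  -- uses that the group is finite, in `X` it is the field `IsPatchSystem.closed`.
  have hcl : ∀ C : G → Set ℂ, (∀ k, IsClosed (C k)) → (∀ k, C k ⊆ c.D) →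
      IsClosed {z | ∃ k ∈ c.group, ∃ d ∈ C k, ρ k d = z} := by
    intro C hC _
    have : {z | ∃ k ∈ c.group, ∃ d ∈ C k, ρ k d = z} = ⋃ k ∈ (c.group : Set G), ρ k '' C k := by
      ext z; simp
    rw [this]
    have hf : (c.group : Set G).Finite := @Set.toFinite _ _ c.finite_group
    exact hf.isClosed_biUnion
      fun k _ => (ρ k).isClosed_image.2 (hC k)
  have hcl' : ∀ C : G → Set Y, (∀ k, IsClosed (C k)) →
      IsClosed {x | ∃ k ∈ c.group, ∃ u ∈ C k, P (g * k) u = x} := by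
    intro C hC
    convert hP.closed (fun h => if g⁻¹ * h ∈ c.group then C (g⁻¹ * h) else ∅) (fun h => ?_) using 1
    · ext x
      simp only [mem_ofPred_eq, mem_iUnion, mem_image]
      constructor
      · rintro ⟨k, hk, u, hu, rfl⟩
        exact ⟨g * k, u, by simpa [hk] using hu, rfl⟩
      · rintro ⟨h, u, hu, rfl⟩
        split_ifs at hu with h1
        · exact ⟨_, h1, u, hu, by simp⟩
        · exact hu.elim
    · split_ifs
      · exact hC _
      · exact isClosed_empty
  let Φ' : OpenPartialHomeomorph X ℂ :=
    { toFun := Φ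
      invFun := Ψ
      source := src
      target := tgt
      map_source' := by
        rintro _ ⟨k, hk, u, hu, rfl⟩
        rw [hΦ k hk u hu]
        exact ⟨k, hk, _, c.mapsTo u hu, rfl⟩
      map_target' := by
        rintro _ ⟨k, hk, d, hd, rfl⟩
        rw [hΨ k hk d hd]
        exact ⟨k, hk, _, c.mapsTo_inv d hd, rfl⟩
      left_inv' := by
        rintro _ ⟨k, hk, u, hu, rfl⟩
        rw [hΦ k hk u hu, hΨ k hk _ (c.mapsTo u hu), c.left_inv u hu]
      right_inv' := by
        rintro _ ⟨k, hk, d, hd, rfl⟩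
        rw [hΨ k hk d hd, hΦ k hk _ (c.mapsTo_inv d hd), c.right_inv d hd]
      open_source := by
        rw [← isClosed_compl_iff]
        -- The complement of the source consists of the whole patches outside the coset of `g`, and
        -- of the part outside `c.U` of the patches in this coset.
        convert hP.closed (fun h => if g⁻¹ * h ∈ c.group then c.Uᶜ else univ) (fun h => ?_) using 1
        · ext x
          simp only [mem_compl_iff, mem_iUnion, mem_image]
          constructor
          · intro hx
            obtain ⟨h, y, rfl⟩ := hP.surj x
            refine ⟨h, y, ?_, rfl⟩
            split_ifs with h1
            · exact fun hy => hx ⟨_, h1, y, hy, by simp⟩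
            · trivial
          · rintro ⟨h, y, hy, rfl⟩ hx
            obtain ⟨h1, k, hk, rfl⟩ := hmemU _ _ hx
            simp [hk, h1] at hy
        · split_ifs
          · exact c.isOpen_U.isClosed_compl
          · exact isClosed_univ
      open_target := by
        rw [← isClosed_compl_iff]
        convert hcl (fun _ => c.D \ c.V) (fun _ => c.isClosed_D.sdiff c.isOpen_V)
          (fun _ => sdiff_subset) using 1
        ext z
        constructor
        · intro hz
          obtain ⟨k, hk, hd⟩ := c.exists_mem_D z
          refine ⟨k⁻¹, inv_mem hk, _, ⟨hd, fun hV => hz ?_⟩, hρi' k z⟩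
          exact ⟨k⁻¹, inv_mem hk, _, ⟨hd, hV⟩, hρi' k z⟩
        · rintro ⟨k, hk, d, hd, rfl⟩ hz
          exact hd.2 (hmemV k hk d hd.1 hz)
      continuousOn_toFun := by
        rw [continuousOn_iff_isClosed]
        intro Z hZ
        have h1 : ∀ k, ∃ C : Set Y, IsClosed C ∧
            (fun u => ρ k (c.ψ u)) ⁻¹' Z ∩ c.U = C ∩ c.U := fun k =>
          continuousOn_iff_isClosed.1 ((ρ k).continuous.comp_continuousOn c.continuousOn_ψ) Z hZ
        choose C hC hCU using h1
        refine ⟨_, hcl' C hC, ?_⟩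
        ext x
        constructor
        · rintro ⟨hx, k, hk, u, hu, rfl⟩
          rw [mem_preimage, hΦ k hk u hu] at hx
          have h2 : u ∈ C k ∩ c.U := by rw [← hCU]; exact ⟨hx, hu⟩
          exact ⟨⟨k, hk, u, h2.1, rfl⟩, k, hk, u, hu, rfl⟩
        · rintro ⟨⟨k, hk, u, hu, rfl⟩, hx⟩
          have hU := (hmemU _ _ hx).1
          have h2 : u ∈ (fun u => ρ k (c.ψ u)) ⁻¹' Z ∩ c.U := by rw [hCU]; exact ⟨hu, hU⟩
          exact ⟨by rw [mem_preimage, hΦ k hk u hU]; exact h2.1, hx⟩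
      continuousOn_invFun := by
        rw [continuousOn_iff_isClosed]
        intro Z hZ
        have h1 : ∀ k, ∃ C : Set ℂ, IsClosed C ∧
            (fun d => P (g * k) (c.inv d)) ⁻¹' Z ∩ (c.D ∩ c.V) = C ∩ (c.D ∩ c.V) := fun k =>
          continuousOn_iff_isClosed.1 ((hP.continuous _).comp_continuousOn c.continuousOn_inv) Z hZ
        choose C hC hCU using h1
        refine ⟨_, hcl (fun k => c.D ∩ C k) (fun k => c.isClosed_D.inter (hC k))
          (fun _ => inter_subset_left), ?_⟩
        ext z
        constructor
        · rintro ⟨hz, k, hk, d, hd, rfl⟩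
          rw [mem_preimage, hΨ k hk d hd] at hz
          have h2 : d ∈ C k ∩ (c.D ∩ c.V) := by rw [← hCU]; exact ⟨hz, hd⟩
          exact ⟨⟨k, hk, d, ⟨hd.1, h2.1⟩, rfl⟩, k, hk, d, hd, rfl⟩
        · rintro ⟨⟨k, hk, d, hd, rfl⟩, hz⟩
          have hV := hmemV k hk d hd.1 hz
          have h2 : d ∈ (fun d => P (g * k) (c.inv d)) ⁻¹' Z ∩ (c.D ∩ c.V) := by
            rw [hCU]; exact ⟨hd.2, hd.1, hV⟩
          exact ⟨by rw [mem_preimage, hΨ k hk d ⟨hd.1, hV⟩]; exact h2.1, hz⟩ }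
  exact ⟨Φ', fun x => Iff.rfl, hΦ⟩

/-- An open chart of the interior of a patch, as a fold chart without folding. -/
def FoldChart.ofChart (e : OpenPartialHomeomorph Y ℂ) (he : ∀ y ∈ e.source, K y = ⊥) :
    FoldChart K where
  U := e.source
  isOpen_U := e.open_source
  group := ⊥
  finite_group := inferInstance
  le_group u hu := (he u hu).le
  D := univ
  isClosed_D := isClosed_univ
  V := e.target
  isOpen_V := e.open_target
  ψ := e
  inv := e.symm
  continuousOn_ψ := e.continuousOn
  continuousOn_inv := by simpa using e.continuousOn_symm
  mapsTo u hu := ⟨trivial, e.map_source hu⟩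
  mapsTo_inv z hz := e.map_target hz.2
  left_inv u hu := e.left_inv hu
  right_inv z hz := e.right_inv hz.2
  a := 1
  b := 1
  exists_mem_D z := ⟨1, one_mem _, trivial⟩
  mem_K u hu k hk _ := by rw [he u hu]; exact hk
  fixed u hu k hk := by simp

/-- A space assembled from oriented patches is orientable if the orientations of the patches
alternate according to a character `χ` which agrees with the foldings. -/
theorem IsPatchSystem.isOrientableSurface {X : Type} [TopologicalSpace X] {P : G → Y → X}
    [T2Space X] [SecondCountableTopology X]
    (hP : IsPatchSystem K P) (χ : G →* ℤˣ) (A : Set (OpenPartialHomeomorph Y ℂ))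
    (hK : ∀ e ∈ A, ∀ y ∈ e.source, K y = ⊥)
    (hA : ∀ e ∈ A, ∀ e' ∈ A, ∀ y ∈ e.source ∩ e'.source, HasSign e e' y 1)
    (hdense : Dense (⋃ e ∈ A, e.source))
    (hfold : ∀ y, y ∉ ⋃ e ∈ A, e.source → ∃ (c : FoldChart K) (f : OpenPartialHomeomorph Y ℂ)
      (d : ℤ), y ∈ c.U ∧ (∀ k ∈ c.group, χ k = c.a k * c.b k) ∧ f.source ⊆ c.U ∧
        (∀ u ∈ f.source, f u = c.ψ u) ∧
        ∀ e ∈ A, ∀ u ∈ e.source ∩ c.U, u ∈ f.source ∧ HasSign e f u d) :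
    IsOrientableSurface X := by
  -- The chart of the patch `g` is `e`, followed by complex conjugation when `χ g = -1`.
  have hb : ∀ g (e : OpenPartialHomeomorph Y ℂ), e ∈ A → ∃ Φ : OpenPartialHomeomorph X ℂ,
      (∀ x, x ∈ Φ.source ↔ ∃ u ∈ e.source, P g u = x) ∧
      ∀ u ∈ e.source, Φ (P g u) = signChart 1 (χ g) e u := by
    intro g e he
    obtain ⟨Φ, h1, h2⟩ := hP.exists_chart (FoldChart.ofChart (signChart 1 (χ g) e)
      (by simpa using hK e he)) g
    refine ⟨Φ, fun x => ?_, fun u hu => ?_⟩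
    · simp [h1, FoldChart.ofChart]
    · have := h2 1 (one_mem _) u (by simpa [FoldChart.ofChart] using hu)
      simpa [FoldChart.ofChart] using this
  choose b hbs hbv using hb
  have hsrc : ∀ g e (he : e ∈ A), ∀ u ∈ e.source, P g u ∈ (b g e he).source := fun g e he u hu =>
    (hbs g e he _).2 ⟨u, hu, rfl⟩
  have hev : ∀ g e (he : e ∈ A), ∀ u ∈ e.source,
      (∀ᶠ v in 𝓝 u, P g v ∈ (b g e he).source) ∧
      ∀ᶠ v in 𝓝 u, b g e he (P g v) = signChart 1 (χ g) e v := by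
    intro g e he u hu
    have := e.open_source.mem_nhds hu
    exact ⟨by filter_upwards [this] with v hv using hsrc g e he v hv,
      by filter_upwards [this] with v hv using hbv g e he v hv⟩
  -- Over the charts in `A` the stabilizers are trivial, so such a point lies in one patch only.
  have hu : ∀ e ∈ A, ∀ u ∈ e.source, ∀ g g' u', P g u = P g' u' → u = u' ∧ g = g' := by
    intro e he u hu g g' u' h
    obtain ⟨h1, h2⟩ := hP.eq_iff.1 h
    rw [hK e he u hu, Subgroup.mem_bot] at h2
    exact ⟨h1, by rw [← inv_mul_eq_one, h2]⟩
  refine isOrientableSurface_of_dense {Φ | ∃ g e, ∃ he : e ∈ A, Φ = b g e he} ?_ ?_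
  · rw [dense_iff_inter_open]
    rintro s hs ⟨x, hx⟩
    obtain ⟨g, y, rfl⟩ := hP.surj x
    obtain ⟨y', hy', hyU⟩ := hdense.inter_open_nonempty _ (hs.preimage (hP.continuous g)) ⟨y, hx⟩
    simp only [mem_iUnion] at hyU
    obtain ⟨e, he, hye⟩ := hyU
    refine ⟨P g y', hy', ?_⟩
    simp only [mem_iUnion]
    exact ⟨b g e he, ⟨g, e, he, rfl⟩, hsrc g e he _ hye⟩
  · intro x
    obtain ⟨g, y, rfl⟩ := hP.surj x
    by_cases hy : y ∈ ⋃ e ∈ A, e.source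
    · simp only [mem_iUnion] at hy
      obtain ⟨e, he, hye⟩ := hy
      refine ⟨b g e he, hsrc g e he _ hye, 1, ?_⟩
      rintro _ ⟨g', e', he', rfl⟩ x ⟨hx', hx⟩
      obtain ⟨u, hue, rfl⟩ := (hbs g e he x).1 hx
      obtain ⟨u', hue', h⟩ := (hbs g' e' he' _).1 hx'
      obtain ⟨rfl, rfl⟩ := hu e' he' u' hue' _ _ _ h
      have h1 := (hasSign_signChart 1 (χ g') hue').symm hue' (by simpa using hue')
      have h2 := h1.trans (by simpa using hue') hue' hue (hA e' he' e he u' ⟨hue', hue⟩)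
      have h3 := h2.trans (by simpa using hue') hue (by simpa using hue)
        (hasSign_signChart 1 (χ g') hue)
      have h4 : HasSign (signChart 1 (χ g') e') (signChart 1 (χ g') e) u' 1 := by
        convert h3 using 1
        simp [← Units.val_mul]
      exact h4.map (by simpa using hue') (hev g' e' he' u' hue').1 (hev g' e' he' u' hue').2
        (hev g' e he u' hue).2
    · obtain ⟨c, f, d, hyc, hχ, hfU, hfψ, hd⟩ := hfold y hy
      obtain ⟨Φ, hΦs, hΦv⟩ := hP.exists_chart c g
      -- On the patch `g * k` the fold contributes `c.a k * c.b k = χ k` and the oriented chart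
      -- contributes `χ (g * k)`. The factors `χ k` cancel, so the sign is `χ g * d` for all `k`.
      refine ⟨Φ, (hΦs _).2 ⟨1, one_mem _, y, hyc, by simp⟩, χ g * d, ?_⟩
      rintro _ ⟨g', e, he, rfl⟩ x ⟨hx', hx⟩
      obtain ⟨u, hue, rfl⟩ := (hbs g' e he x).1 hx'
      obtain ⟨k, hk, u', huU, h⟩ := (hΦs _).1 hx
      obtain ⟨rfl, rfl⟩ := hu e he u hue _ _ _ h.symm
      obtain ⟨huf, hsg⟩ := hd e he u ⟨hue, huU⟩
      have h1 := (hasSign_signChart 1 (χ (g * k)) hue).symm hue (by simpa using hue)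
      have h2 := h1.trans (by simpa using hue) hue huf hsg
      have h3 := h2.trans (by simpa using hue) huf (by simpa using huf)
        (hasSign_signChart (c.a k) (c.b k) huf)
      have h4 : HasSign (signChart 1 (χ (g * k)) e) (signChart (c.a k) (c.b k) f) u (χ g * d) := by
        convert h3 using 1
        have h5 := hχ k hk
        have h6 : ((c.a k : ℤ) * (c.b k : ℤ)) * χ k = 1 := by
          rw [h5, ← Units.val_mul, ← Units.val_mul]; simp
        simp only [map_mul, Units.val_mul, Units.val_one, one_mul]
        linear_combination (-(χ g : ℤ) * d) * h6
      refine h4.map (by simpa using hue) (hev _ e he u hue).1 (hev _ e he u hue).2 ?_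
      filter_upwards [f.open_source.mem_nhds huf] with v hv
      rw [hΦv k hk v (hfU hv), signChart_apply, hfψ v hv]

end

/-! ### Combinatorics of the cube and of its edge loops -/

section

/-! ### Vertices and edges of the cube -/

variable {n : ℕ}

/-- The point `x` with the sign of its `β`-coordinate changed. -/
def flip (β : Fin n) (x : E n) : E n := WithLp.toLp 2 fun α => if α = β then -x α else x α

@[simp] theorem flip_apply_self (β : Fin n) (x : E n) : flip β x β = -x β := by simp [flip]

theorem flip_apply_of_ne {α β : Fin n} (h : α ≠ β) (x : E n) : flip β x α = x α := by
  simp [flip, h]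

@[simp] theorem flip_flip (β : Fin n) (x : E n) : flip β (flip β x) = x := by
  ext α
  by_cases h : α = β
  · subst h; simp
  · simp [flip_apply_of_ne h]

theorem flip_mem {x : E n} (hx : x ∈ cubeVertices n) (β : Fin n) : flip β x ∈ cubeVertices n := by
  intro α
  by_cases h : α = β
  · subst h
    rcases hx α with h | h <;> simp [h]
  · rw [flip_apply_of_ne h]; exact hx α

theorem vertex_ne_zero {x : E n} (hx : x ∈ cubeVertices n) (α : Fin n) : x α ≠ 0 := by
  rcases hx α with h | h <;> rw [h] <;> norm_num

theorem vertex_sq {x : E n} (hx : x ∈ cubeVertices n) (α : Fin n) : |x α| = 1 / 2 := by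
  rcases hx α with h | h <;> rw [h] <;> norm_num [abs_of_pos, abs_of_neg]

theorem vertex_eq_or {x y : E n} (hx : x ∈ cubeVertices n) (hy : y ∈ cubeVertices n) (α : Fin n) :
    x α = y α ∨ x α = -y α := by
  rcases hx α with h | h <;> rcases hy α with h' | h' <;> rw [h, h'] <;> norm_num

theorem isCubeEdge_iff {a b : E n} :
    IsCubeEdge a b ↔ a ∈ cubeVertices n ∧ ∃ β, b = flip β a := by
  constructor
  · rintro ⟨ha, hb, β, hne, h⟩
    refine ⟨ha, β, ?_⟩
    ext α
    by_cases hα : α = β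
    · subst hα
      rw [flip_apply_self]
      rcases vertex_eq_or hb ha α with h | h
      · exact absurd h.symm hne
      · exact h
    · rw [flip_apply_of_ne hα, h α hα]
  · rintro ⟨ha, β, rfl⟩
    refine ⟨ha, flip_mem ha β, β, ?_, fun α hα => (flip_apply_of_ne hα a).symm⟩
    rw [flip_apply_self]
    intro h
    exact vertex_ne_zero ha β (by linarith)

theorem isCubeEdge_flip {a : E n} (ha : a ∈ cubeVertices n) (β : Fin n) : IsCubeEdge a (flip β a) :=
  isCubeEdge_iff.2 ⟨ha, β, rfl⟩

theorem mem_segment_flip_iff {a x : E n} (ha : a ∈ cubeVertices n) (β : Fin n) :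
    x ∈ segment ℝ a (flip β a) ↔ (∀ α, α ≠ β → x α = a α) ∧ |x β| ≤ 1 / 2 := by
  have ha0 := vertex_ne_zero ha β
  constructor
  · rintro ⟨s, t, hs, ht, hst, rfl⟩
    refine ⟨fun α hα => ?_, ?_⟩
    · simp only [PiLp.add_apply, PiLp.smul_apply, smul_eq_mul, flip_apply_of_ne hα]
      rw [← add_mul, hst, one_mul]
    · simp only [PiLp.add_apply, PiLp.smul_apply, smul_eq_mul, flip_apply_self]
      rw [show s * a β + t * -a β = (s - t) * a β by ring, abs_mul, vertex_sq ha β]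
      have : |s - t| ≤ 1 := abs_le.2 ⟨by linarith, by linarith⟩
      linarith
  · rintro ⟨h1, h2⟩
    have h3 := abs_le.1 h2
    have haq : a β * a β = 1 / 4 := by
      rcases ha β with h | h <;> rw [h] <;> norm_num
    have h4 : |x β * (2 * a β)| ≤ 1 / 2 := by
      rw [abs_mul, abs_mul, vertex_sq ha β]
      norm_num
      exact h2
    have h5 := abs_le.1 h4
    refine ⟨1 / 2 + x β * (2 * a β), 1 / 2 - x β * (2 * a β), by linarith, by linarith,
      by ring, ?_⟩
    ext α
    by_cases hα : α = β
    · subst hα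
      simp only [PiLp.add_apply, PiLp.smul_apply, smul_eq_mul, flip_apply_self]
      linear_combination (4 * x α) * haq
    · simp only [PiLp.add_apply, PiLp.smul_apply, smul_eq_mul, flip_apply_of_ne hα, h1 α hα]
      ring

theorem vertex_mem_segment {a x : E n} (ha : a ∈ cubeVertices n) {β : Fin n}
    (hx : x ∈ cubeVertices n) (h : x ∈ segment ℝ a (flip β a)) : x = a ∨ x = flip β a := by
  have h1 := ((mem_segment_flip_iff ha β).1 h).1
  rcases vertex_eq_or hx ha β with h2 | h2
  · left
    ext α
    by_cases hα : α = β
    · rw [hα, h2]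
    · exact h1 α hα
  · right
    ext α
    by_cases hα : α = β
    · rw [hα, h2, flip_apply_self]
    · rw [h1 α hα, flip_apply_of_ne hα]

theorem segment_flip_symm (a : E n) (β : Fin n) :
    segment ℝ (flip β a) (flip β (flip β a)) = segment ℝ a (flip β a) := by
  rw [flip_flip, segment_symm]

/-- Two edges with a common point which is not a vertex agree. -/
theorem edge_eq_of_mem {a c x : E n} (ha : a ∈ cubeVertices n) (hc : c ∈ cubeVertices n)
    {β δ : Fin n} (hx : x ∈ segment ℝ a (flip β a)) (hx' : x ∈ segment ℝ c (flip δ c))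
    (hxv : x ∉ cubeVertices n) : β = δ ∧ (a = c ∨ a = flip β c) := by
  obtain ⟨h1, h2⟩ := (mem_segment_flip_iff ha β).1 hx
  obtain ⟨h3, h4⟩ := (mem_segment_flip_iff hc δ).1 hx'
  have hβ : x β ≠ -(1 / 2) ∧ x β ≠ 1 / 2 := by
    by_contra hcon
    rw [not_and_or, not_not, not_not] at hcon
    refine hxv fun α => ?_
    by_cases hα : α = β
    · rw [hα]; exact hcon
    · rw [h1 α hα]; exact ha α
  have hβδ : β = δ := by
    by_contra hne
    have := hc β
    rw [← h3 β hne] at this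
    exact this.elim hβ.1 hβ.2
  subst hβδ
  refine ⟨rfl, ?_⟩
  rcases vertex_eq_or ha hc β with h | h
  · left
    ext α
    by_cases hα : α = β
    · rw [hα, h]
    · rw [← h1 α hα, h3 α hα]
  · right
    ext α
    by_cases hα : α = β
    · rw [hα, h, flip_apply_self]
    · rw [← h1 α hα, h3 α hα, flip_apply_of_ne hα]

/-- The midpoint of an edge. -/
def edgeMid (a : E n) (β : Fin n) : E n := WithLp.toLp 2 fun α => if α = β then 0 else a α

theorem edgeMid_mem {a : E n} (ha : a ∈ cubeVertices n) (β : Fin n) :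
    edgeMid a β ∈ segment ℝ a (flip β a) :=
  (mem_segment_flip_iff ha β).2 ⟨fun α hα => by simp [edgeMid, hα], by simp [edgeMid]⟩

theorem edgeMid_not_vertex (a : E n) (β : Fin n) : edgeMid a β ∉ cubeVertices n := fun h =>
  vertex_ne_zero h β (by simp [edgeMid])

theorem cubeVertices_subset : cubeVertices n ⊆ cube n := fun x hx α => by
  rcases hx α with h | h <;> rw [h] <;> norm_num

theorem segment_subset_cube {a : E n} (ha : a ∈ cubeVertices n) (β : Fin n) :
    segment ℝ a (flip β a) ⊆ cube n := by
  intro x hx α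
  obtain ⟨h1, h2⟩ := (mem_segment_flip_iff ha β).1 hx
  by_cases hα : α = β
  · rw [hα]; exact abs_le.1 h2
  · rw [h1 α hα]; exact cubeVertices_subset ha α

/-! ### Schwarz reflections -/

/-- The foot of the perpendicular from `x` to the line keeps the coordinate along the edge and takes
the other coordinates from `a`; the half-turn doubles the step to this foot. -/
theorem schwarzReflection_flip_apply {a : E n} (ha : a ∈ cubeVertices n) (β : Fin n) (x : E n)
    (α : Fin n) :
    schwarzReflection a (flip β a) x α = if α = β then x α else 2 * a α - x α := by
  have ha0 := vertex_ne_zero ha β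
  let q : E n := WithLp.toLp 2 fun α => if α = β then x α else a α
  have hq : (EuclideanGeometry.orthogonalProjection (affineSpan ℝ {a, flip β a}) x : E n) = q := by
    rw [EuclideanGeometry.coe_orthogonalProjection_eq_iff_mem]
    constructor
    · have : q = AffineMap.lineMap a (flip β a) ((a β - x β) / (2 * a β)) := by
        ext α
        rw [AffineMap.lineMap_apply]
        by_cases hα : α = β
        · subst hα
          simp [q]
          field_simp
          ring
        · simp [q, hα, flip_apply_of_ne hα]
      rw [this]
      exact AffineMap.lineMap_mem_affineSpan_pair _ _ _
    · rw [direction_affineSpan, vectorSpan_pair, Submodule.mem_orthogonal_singleton_iff_inner_right]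
      simp only [vsub_eq_sub, PiLp.inner_apply, PiLp.sub_apply]
      refine Finset.sum_eq_zero fun α _ => ?_
      by_cases hα : α = β
      · simp [q, hα]
      · simp [flip_apply_of_ne hα]
  unfold schwarzReflection
  rw [EuclideanGeometry.reflection_apply', hq]
  by_cases hα : α = β
  · simp [q, hα]
  · simp [q, hα]; ring

/-! ### Words -/

theorem wordVertex_zero (p : E n) (γ : List (Fin n)) : wordVertex p γ 0 = p := by
  ext α; simp [wordVertex]

theorem wordVertex_succ (p : E n) (γ : List (Fin n)) {i : ℕ} (hi : i < γ.length) :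
    wordVertex p γ (i + 1) = flip γ[i] (wordVertex p γ i) := by
  ext α
  simp only [wordVertex, flip, List.take_add_one, List.count_append, hi, List.getElem?_eq_getElem,
    Option.toList_some]
  by_cases hα : α = γ[i]
  · simp [← hα, pow_succ]
  · have : γ[i] ≠ α := fun h => hα h.symm
    simp [hα, this]

theorem wordVertex_mem {p : E n} (hp : p ∈ cubeVertices n) (γ : List (Fin n)) (i : ℕ) :
    wordVertex p γ i ∈ cubeVertices n := by
  intro α
  simp only [wordVertex]
  rcases neg_one_pow_eq_or ℝ (List.count α (List.take i γ)) with h | h <;>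
    rcases hp α with h' | h' <;> rw [h, h'] <;> norm_num

/-- The word `γ` describes a Jordan path with initial vertex `p`. -/
structure JordanWord (p : E n) (γ : List (Fin n)) : Prop where
  vertex : p ∈ cubeVertices n
  length : 3 ≤ γ.length
  mem : ∀ β, β ∈ γ
  closed : wordVertex p γ γ.length = p
  inj : InjOn (wordVertex p γ) (Iio γ.length)

theorem isJordanPath_iff {Γ : Set (E n)} :
    IsJordanPath Γ ↔ ∃ p γ, JordanWord p γ ∧ Γ = wordPath p γ :=
  ⟨fun ⟨p, γ, h1, h2, h3, h4, h5, h6⟩ => ⟨p, γ, ⟨h1, h2, h3, h4, h5⟩, h6⟩,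
    fun ⟨p, γ, ⟨h1, h2, h3, h4, h5⟩, h6⟩ => ⟨p, γ, h1, h2, h3, h4, h5, h6⟩⟩

/-- The cyclic predecessor of `i`. -/
def prevIdx (L i : ℕ) : ℕ := if i = 0 then L - 1 else i - 1

theorem prevIdx_lt {L i : ℕ} (hi : i < L) : prevIdx L i < L := by
  unfold prevIdx; split_ifs <;> omega

namespace JordanWord

variable {p : E n} {γ : List (Fin n)}

theorem vertex_mem (h : JordanWord p γ) (i : ℕ) : wordVertex p γ i ∈ cubeVertices n :=
  wordVertex_mem h.vertex γ i

theorem segment_eq (_ : JordanWord p γ) {i : ℕ} (hi : i < γ.length) :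
    segment ℝ (wordVertex p γ i) (wordVertex p γ (i + 1)) =
      segment ℝ (wordVertex p γ i) (flip γ[i] (wordVertex p γ i)) := by
  rw [wordVertex_succ p γ hi]

theorem segment_subset (h : JordanWord p γ) {i : ℕ} (hi : i < γ.length) :
    segment ℝ (wordVertex p γ i) (flip γ[i] (wordVertex p γ i)) ⊆ wordPath p γ := by
  rw [← h.segment_eq hi]
  exact subset_biUnion_of_mem (u := fun i => segment ℝ (wordVertex p γ i) (wordVertex p γ (i + 1)))
    (show i ∈ Iio γ.length from hi)

theorem exists_of_mem (h : JordanWord p γ) {x : E n} (hx : x ∈ wordPath p γ) :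
    ∃ i, ∃ hi : i < γ.length, x ∈ segment ℝ (wordVertex p γ i) (flip γ[i] (wordVertex p γ i)) := by
  simp only [wordPath, mem_iUnion] at hx
  obtain ⟨i, hi, hx⟩ := hx
  exact ⟨i, hi, by rwa [← h.segment_eq hi]⟩

theorem vertex_mem_path (h : JordanWord p γ) {i : ℕ} (hi : i < γ.length) :
    wordVertex p γ i ∈ wordPath p γ := h.segment_subset hi (left_mem_segment _ _ _)

theorem flip_prev (h : JordanWord p γ) {i : ℕ} (hi : i < γ.length) :
    flip (γ[prevIdx γ.length i]'(prevIdx_lt hi)) (wordVertex p γ (prevIdx γ.length i)) =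
      wordVertex p γ i := by
  rw [← wordVertex_succ p γ (prevIdx_lt hi)]
  unfold prevIdx
  split_ifs with h0
  · have := h.length
    rw [show γ.length - 1 + 1 = γ.length by omega, h.closed, h0, wordVertex_zero]
  · rw [show i - 1 + 1 = i by omega]

theorem exists_idx (h : JordanWord p γ) {x : E n} (hx : x ∈ wordPath p γ)
    (hv : x ∈ cubeVertices n) : ∃ i, i < γ.length ∧ x = wordVertex p γ i := by
  obtain ⟨i, hi, hx⟩ := h.exists_of_mem hx
  rcases vertex_mem_segment (h.vertex_mem i) hv hx with h1 | h1
  · exact ⟨i, hi, h1⟩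
  · rw [← wordVertex_succ p γ hi] at h1
    by_cases hl : i + 1 < γ.length
    · exact ⟨i + 1, hl, h1⟩
    · refine ⟨0, by have := h.length; omega, ?_⟩
      rw [h1, show i + 1 = γ.length by omega, h.closed, wordVertex_zero]

/-- Each edge in a Jordan path is one of the edges of its word. -/
theorem exists_edge (h : JordanWord p γ) {a : E n} (ha : a ∈ cubeVertices n) {β : Fin n}
    (hs : segment ℝ a (flip β a) ⊆ wordPath p γ) :
    ∃ i, ∃ hi : i < γ.length, γ[i] = β ∧
      (a = wordVertex p γ i ∨ a = flip γ[i] (wordVertex p γ i)) := by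
  obtain ⟨i, hi, hx⟩ := h.exists_of_mem (hs (edgeMid_mem ha β))
  obtain ⟨h1, h2⟩ := edge_eq_of_mem ha (h.vertex_mem i) (edgeMid_mem ha β) hx
    (edgeMid_not_vertex a β)
  exact ⟨i, hi, h1.symm, by rwa [← h1]⟩

/-- Two equal directions in a row would run back along the same edge and revisit a vertex; length at
least three excludes the loop that runs to and fro. -/
theorem dir_prev_ne (h : JordanWord p γ) {i : ℕ} (hi : i < γ.length) :
    γ[prevIdx γ.length i]'(prevIdx_lt hi) ≠ γ[i] := by
  intro heq
  have h1 := h.flip_prev hi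
  have h2 := wordVertex_succ p γ hi
  rw [← h1, heq, flip_flip] at h2
  have hl := h.length
  have h3 : ∃ j, j < γ.length ∧ wordVertex p γ j = wordVertex p γ (i + 1) ∧
      (j = i + 1 ∨ j = 0 ∧ i + 1 = γ.length) := by
    by_cases hl' : i + 1 < γ.length
    · exact ⟨i + 1, hl', rfl, Or.inl rfl⟩
    · have : i + 1 = γ.length := by omega
      exact ⟨0, by omega, by rw [this, h.closed, wordVertex_zero], Or.inr ⟨rfl, this⟩⟩
  obtain ⟨j, hj, hj1, hj2⟩ := h3
  have h4 := h.inj (show j ∈ Iio γ.length from hj) (prevIdx_lt hi) (hj1.trans h2)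
  unfold prevIdx at h4
  split_ifs at h4 <;> omega

/-- The two edges of a Jordan path at one of its vertices. -/
theorem segment_subset_iff (h : JordanWord p γ) {i : ℕ} (hi : i < γ.length) (β : Fin n) :
    segment ℝ (wordVertex p γ i) (flip β (wordVertex p γ i)) ⊆ wordPath p γ ↔
      β = γ[i] ∨ β = γ[prevIdx γ.length i]'(prevIdx_lt hi) := by
  constructor
  · intro hs
    obtain ⟨j, hj, rfl, h1 | h1⟩ := h.exists_edge (h.vertex_mem i) hs
    · left
      have := h.inj (show i ∈ Iio γ.length from hi) hj h1
      subst this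
      rfl
    · right
      rw [← wordVertex_succ p γ hj] at h1
      have hl := h.length
      have : j = prevIdx γ.length i := by
        unfold prevIdx
        by_cases hl' : j + 1 < γ.length
        · have := h.inj (show i ∈ Iio γ.length from hi) hl' h1
          rw [if_neg (by omega)]
          omega
        · have hjl : j + 1 = γ.length := by omega
          rw [hjl, h.closed] at h1
          have := h.inj (show i ∈ Iio γ.length from hi) (show 0 ∈ Iio γ.length by
            simp only [mem_Iio]; omega) (h1.trans (wordVertex_zero p γ).symm)
          rw [if_pos this]
          omega
      subst this
      rfl
  · rintro (rfl | rfl)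
    · exact h.segment_subset hi
    · have h1 := h.segment_subset (prevIdx_lt hi)
      rw [← segment_flip_symm, h.flip_prev hi] at h1
      exact h1

end JordanWord

end

/-! ### The reflection group, its stabilizers and the vertex condition -/

section

variable {n : ℕ}

/-! ### The cells of the reflection group -/

/-- The isometry `s` maps the unit cube to the cube with centre `m`, by a translation in the
coordinates in which `m` is even, and by a reflection in the others. -/
def IsCell (s : E n ≃ᵃⁱ[ℝ] E n) (m : Fin n → ℤ) : Prop :=
  ∀ x α, s x α = ((m α).negOnePow : ℤ) * x α + m α

theorem negOnePow_mul_self (k : ℤ) : ((k.negOnePow : ℤ) : ℝ) * ((k.negOnePow : ℤ) : ℝ) = 1 := by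
  rcases Int.even_or_odd k with h | h
  · simp [Int.negOnePow_even _ h]
  · simp [Int.negOnePow_odd _ h]

theorem isCell_one : IsCell (1 : E n ≃ᵃⁱ[ℝ] E n) 0 := fun x α => by simp

/-- In each coordinate the maps are `x ↦ ±x + m` with the sign given by the parity of `m`. This form
survives composition because a sign does not change the parity of an integer. -/
theorem IsCell.mul {s t : E n ≃ᵃⁱ[ℝ] E n} {m k : Fin n → ℤ} (hs : IsCell s m) (ht : IsCell t k) :
    IsCell (s * t) fun α => ((m α).negOnePow : ℤ) * k α + m α := by
  intro x α
  have h : (((m α).negOnePow : ℤ) * k α + m α).negOnePow = (m α).negOnePow * (k α).negOnePow := by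
    rw [Int.negOnePow_add, mul_comm]
    congr 1
    rcases Int.even_or_odd (m α) with h | h
    · simp [Int.negOnePow_even _ h]
    · simp [Int.negOnePow_odd _ h]
  rw [AffineIsometryEquiv.coe_mul, Function.comp_apply, hs, ht, h]
  push_cast
  ring

theorem IsCell.inv {s : E n ≃ᵃⁱ[ℝ] E n} {m : Fin n → ℤ} (hs : IsCell s m) :
    IsCell s⁻¹ fun α => -((m α).negOnePow : ℤ) * m α := by
  intro x α
  have h : (-((m α).negOnePow : ℤ) * m α).negOnePow = (m α).negOnePow := by
    rcases Int.even_or_odd (m α) with h | h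
    · simp [Int.negOnePow_even _ h]
    · simp [Int.negOnePow_odd _ h]
  have h2 := hs (s⁻¹ x) α
  have h3 : s (s⁻¹ x) = x := s.apply_symm_apply x
  rw [h3] at h2
  rw [h, h2]
  push_cast
  linear_combination (-(s⁻¹ x) α) * negOnePow_mul_self (m α)

theorem IsCell.unique {s : E n ≃ᵃⁱ[ℝ] E n} {m k : Fin n → ℤ} (hs : IsCell s m) (ht : IsCell s k) :
    m = k := by
  ext α
  have h := (hs 0 α).symm.trans (ht 0 α)
  simpa using h

theorem IsCell.eq {s t : E n ≃ᵃⁱ[ℝ] E n} {m : Fin n → ℤ} (hs : IsCell s m) (ht : IsCell t m) :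
    s = t := by
  ext x α
  rw [hs, ht]

theorem IsCell.eq_one {s : E n ≃ᵃⁱ[ℝ] E n} (hs : IsCell s 0) : s = 1 := hs.eq isCell_one

theorem exists_int_of_vertex {a : E n} (ha : a ∈ cubeVertices n) (β : Fin n) :
    ∃ m : Fin n → ℤ, m β = 0 ∧ ∀ α, α ≠ β → (m α : ℝ) = 2 * a α ∧ Odd (m α) := by
  have : ∀ α, ∃ k : ℤ, (k : ℝ) = 2 * a α ∧ Odd k := by
    intro α
    rcases ha α with h | h
    · exact ⟨-1, by rw [h]; norm_num, by decide⟩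
    · exact ⟨1, by rw [h]; norm_num, by decide⟩
  choose k hk hk' using this
  exact ⟨fun α => if α = β then 0 else k α, by simp, fun α hα => by simp [hα, hk, hk']⟩

theorem isCell_schwarz {a : E n} (ha : a ∈ cubeVertices n) (β : Fin n) :
    ∃ m : Fin n → ℤ, IsCell (schwarzReflection a (flip β a)) m ∧ m β = 0 ∧
      ∀ α, α ≠ β → (m α : ℝ) = 2 * a α ∧ Odd (m α) := by
  obtain ⟨m, h1, h2⟩ := exists_int_of_vertex ha β
  refine ⟨m, fun x α => ?_, h1, h2⟩
  rw [schwarzReflection_flip_apply ha]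
  split_ifs with h
  · subst h; simp [h1]
  · rw [Int.negOnePow_odd _ (h2 α h).2, (h2 α h).1]
    simp only [Units.val_neg, Units.val_one, Int.cast_neg, Int.cast_one]
    ring

theorem exists_isCell {Γ : Set (E n)} {s : E n ≃ᵃⁱ[ℝ] E n} (hs : s ∈ reflectionGroup Γ) :
    ∃ m, IsCell s m := by
  refine Subgroup.closure_induction (p := fun s _ => ∃ m, IsCell s m) ?_ ⟨0, isCell_one⟩ ?_ ?_ hs
  · rintro _ ⟨a, b, hab, -, rfl⟩
    obtain ⟨ha, β, rfl⟩ := isCubeEdge_iff.1 hab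
    obtain ⟨m, hm, -⟩ := isCell_schwarz ha β
    exact ⟨m, hm⟩
  · rintro s t - - ⟨m, hm⟩ ⟨k, hk⟩
    exact ⟨_, hm.mul hk⟩
  · rintro s - ⟨m, hm⟩
    exact ⟨_, hm.inv⟩

theorem IsCell.apply_even {s : E n ≃ᵃⁱ[ℝ] E n} {m : Fin n → ℤ} (hs : IsCell s m) (x : E n)
    {α : Fin n} (h : Even (m α)) : s x α = x α + m α := by
  rw [hs, Int.negOnePow_even _ h]; simp

theorem IsCell.apply_odd {s : E n ≃ᵃⁱ[ℝ] E n} {m : Fin n → ℤ} (hs : IsCell s m) (x : E n)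
    {α : Fin n} (h : Odd (m α)) : s x α = -x α + m α := by
  rw [hs, Int.negOnePow_odd _ h]; simp

/-- A point of the cube can be mapped to the cube only if it is a fixed point. -/
theorem IsCell.fixed {s : E n ≃ᵃⁱ[ℝ] E n} {m : Fin n → ℤ} (hs : IsCell s m) {x : E n}
    (hx : x ∈ cube n) (hy : s x ∈ cube n) :
    s x = x ∧ ∀ α, m α = 0 ∨ Odd (m α) ∧ (m α : ℝ) = 2 * x α ∧ |x α| = 1 / 2 := by
  have key : ∀ α, m α = 0 ∨ Odd (m α) ∧ (m α : ℝ) = 2 * x α ∧ |x α| = 1 / 2 := by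
    intro α
    obtain ⟨hx1, hx2⟩ := hx α
    obtain ⟨hy1, hy2⟩ := hy α
    -- An even coordinate is translated by at most `1`, hence by `0`. An odd one is subject to `x ↦
    -- m - x` with `|m| ≤ 1`, which forces `m = ±1` and the boundary value `x = m / 2`.
    rcases Int.even_or_odd (m α) with h | h
    · left
      rw [hs.apply_even x h] at hy1 hy2
      have h1 : (m α : ℝ) < 2 := by linarith
      have h2 : (-2 : ℝ) < m α := by linarith
      have h1' : m α < 2 := by exact_mod_cast h1
      have h2' : -2 < m α := by exact_mod_cast h2
      obtain ⟨k, hk⟩ := h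
      omega
    · right
      refine ⟨h, ?_⟩
      rw [hs.apply_odd x h] at hy1 hy2
      have h1 : (m α : ℝ) ≤ 1 := by linarith
      have h2 : (-1 : ℝ) ≤ m α := by linarith
      have h1' : m α ≤ 1 := by exact_mod_cast h1
      have h2' : -1 ≤ m α := by exact_mod_cast h2
      obtain ⟨k, hk⟩ := h
      have h3 : m α = 1 ∨ m α = -1 := by omega
      rcases h3 with h3 | h3 <;> rw [h3] at hy1 hy2 ⊢ <;> push_cast at hy1 hy2 ⊢
      · have : x α = 1 / 2 := by linarith
        rw [this]; norm_num
      · have : x α = -(1 / 2) := by linarith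
        rw [this]; norm_num [abs_of_neg]
  refine ⟨?_, key⟩
  ext α
  rcases key α with h | ⟨h, h', -⟩
  · rw [hs.apply_even x (by simp [h]), h]; simp
  · rw [hs.apply_odd x h, h']; ring

theorem openCube_subset_cube : openCube n ⊆ cube n := fun _ hx α => ⟨(hx α).1.le, (hx α).2.le⟩

/-- An interior point has no coordinate of absolute value `1/2`, so every coordinate of the cell
vanishes. This is why interior points of patches never meet other patches. -/
theorem IsCell.eq_one_of_openCube {s : E n ≃ᵃⁱ[ℝ] E n} {m : Fin n → ℤ} (hs : IsCell s m) {x : E n}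
    (hx : x ∈ openCube n) (hy : s x ∈ cube n) : s = 1 := by
  have h := (hs.fixed (openCube_subset_cube hx) hy).2
  have : m = 0 := by
    ext α
    rcases h α with h | ⟨-, -, h⟩
    · exact h
    · have := abs_lt.2 (hx α)
      linarith
  subst this
  exact hs.eq_one

/-! ### The signs of the elements of the reflection group -/

/-- The cell of an element of the reflection group. -/
def cellOf {Γ : Set (E n)} (s : reflectionGroup Γ) : Fin n → ℤ := (exists_isCell s.2).choose

theorem isCell_cellOf {Γ : Set (E n)} (s : reflectionGroup Γ) :
    IsCell (s : E n ≃ᵃⁱ[ℝ] E n) (cellOf s) := (exists_isCell s.2).choose_spec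

/-- The signs of the linear part of an element of the reflection group. -/
def signs (Γ : Set (E n)) : reflectionGroup Γ →* (Fin n → ℤˣ) where
  toFun s α := (cellOf s α).negOnePow
  map_one' := by
    ext α
    have h := (isCell_cellOf (1 : reflectionGroup Γ)).unique isCell_one
    rw [h]; simp
  map_mul' s t := by
    funext α
    have h := (isCell_cellOf (s * t)).unique ((isCell_cellOf s).mul (isCell_cellOf t))
    rw [h, Pi.mul_apply, Int.negOnePow_add, mul_comm]
    congr 1
    rcases Int.even_or_odd (cellOf s α) with h | h
    · simp [Int.negOnePow_even _ h]
    · simp [Int.negOnePow_odd _ h]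

theorem signs_apply {Γ : Set (E n)} (s : reflectionGroup Γ) {m : Fin n → ℤ}
    (h : IsCell (s : E n ≃ᵃⁱ[ℝ] E n) m) (α : Fin n) : signs Γ s α = (m α).negOnePow := by
  rw [← (isCell_cellOf s).unique h]; rfl

/-! ### Stabilizers -/

/-- The group generated by the reflections across the edges of `Γ` through the point `x`. -/
def edgeGroup (Γ : Set (E n)) (x : E n) : Subgroup (E n ≃ᵃⁱ[ℝ] E n) :=
  Subgroup.closure {s | ∃ a b, IsCubeEdge a b ∧ segment ℝ a b ⊆ Γ ∧ x ∈ segment ℝ a b ∧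
    s = schwarzReflection a b}

theorem edgeGroup_le (Γ : Set (E n)) (x : E n) : edgeGroup Γ x ≤ reflectionGroup Γ :=
  Subgroup.closure_mono fun _ ⟨a, b, h1, h2, _, h4⟩ => ⟨a, b, h1, h2, h4⟩

theorem edgeGroup_fixes {Γ : Set (E n)} {x : E n} {s : E n ≃ᵃⁱ[ℝ] E n} (hs : s ∈ edgeGroup Γ x) :
    s x = x := by
  refine Subgroup.closure_induction (p := fun s _ => s x = x) ?_ rfl ?_ ?_ hs
  · rintro _ ⟨a, b, -, -, hx, rfl⟩
    exact schwarzReflection_apply_of_mem hx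
  · intro s t _ _ hs ht
    rw [AffineIsometryEquiv.coe_mul, Function.comp_apply, ht, hs]
  · intro s _ hs
    nth_rw 1 [← hs]
    exact s.symm_apply_apply x

/-- The reflection across the edge at the vertex `a` in direction `β`. -/
abbrev edgeReflection (a : E n) (β : Fin n) : E n ≃ᵃⁱ[ℝ] E n := schwarzReflection a (flip β a)

theorem schwarzReflection_symm (a b : E n) : schwarzReflection a b = schwarzReflection b a := by
  unfold schwarzReflection
  simp only [Set.pair_comm a b]

theorem edgeReflection_flip (a : E n) (β : Fin n) :
    edgeReflection (flip β a) β = edgeReflection a β := by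
  unfold edgeReflection
  rw [flip_flip, schwarzReflection_symm]

theorem edgeReflection_mul_self {a : E n} (ha : a ∈ cubeVertices n) (β : Fin n) :
    edgeReflection a β * edgeReflection a β = 1 := by
  ext x α
  rw [AffineIsometryEquiv.coe_mul, Function.comp_apply, schwarzReflection_flip_apply ha,
    schwarzReflection_flip_apply ha]
  split_ifs <;> simp

theorem edgeReflection_comm {a : E n} (ha : a ∈ cubeVertices n) (β γ : Fin n) :
    edgeReflection a β * edgeReflection a γ = edgeReflection a γ * edgeReflection a β := by
  ext x α
  simp only [AffineIsometryEquiv.coe_mul, Function.comp_apply, schwarzReflection_flip_apply ha]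
  split_ifs <;> simp

theorem edgeReflection_inv {a : E n} (ha : a ∈ cubeVertices n) (β : Fin n) :
    (edgeReflection a β)⁻¹ = edgeReflection a β :=
  inv_eq_of_mul_eq_one_left (edgeReflection_mul_self ha β)

theorem edgeReflection_mem_reflectionGroup {Γ : Set (E n)} {a : E n} (ha : a ∈ cubeVertices n)
    {β : Fin n} (h : segment ℝ a (flip β a) ⊆ Γ) : edgeReflection a β ∈ reflectionGroup Γ :=
  Subgroup.subset_closure ⟨a, _, isCubeEdge_flip ha β, h, rfl⟩

/-- `Γ` has exactly two edges at the vertex `v`, in the directions `β` and `δ`. -/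
structure IsCorner (Γ : Set (E n)) (v : E n) (β δ : Fin n) : Prop where
  vertex : v ∈ cubeVertices n
  ne : β ≠ δ
  iff : ∀ η, segment ℝ v (flip η v) ⊆ Γ ↔ η = β ∨ η = δ

theorem IsCorner.symm {Γ : Set (E n)} {v : E n} {β δ : Fin n} (h : IsCorner Γ v β δ) :
    IsCorner Γ v δ β := ⟨h.vertex, h.ne.symm, fun η => by rw [h.iff, or_comm]⟩

theorem JordanWord.isCorner {p : E n} {γ : List (Fin n)} (h : JordanWord p γ) {i : ℕ}
    (hi : i < γ.length) : IsCorner (wordPath p γ) (wordVertex p γ i) γ[i]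
      (γ[prevIdx γ.length i]'(prevIdx_lt hi)) :=
  ⟨h.vertex_mem i, (h.dir_prev_ne hi).symm, h.segment_subset_iff hi⟩

theorem IsJordanPath.exists_isCorner {Γ : Set (E n)} (h : IsJordanPath Γ) {v : E n} (hv : v ∈ Γ)
    (hv' : v ∈ cubeVertices n) : ∃ β δ, IsCorner Γ v β δ := by
  obtain ⟨p, γ, hw, rfl⟩ := isJordanPath_iff.1 h
  obtain ⟨i, hi, rfl⟩ := hw.exists_idx hv hv'
  exact ⟨_, _, hw.isCorner hi⟩

theorem IsJordanPath.exists_edge {Γ : Set (E n)} (h : IsJordanPath Γ) {x : E n} (hx : x ∈ Γ) :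
    ∃ a ∈ cubeVertices n, ∃ β, segment ℝ a (flip β a) ⊆ Γ ∧ x ∈ segment ℝ a (flip β a) := by
  obtain ⟨p, γ, hw, rfl⟩ := isJordanPath_iff.1 h
  obtain ⟨i, hi, hx⟩ := hw.exists_of_mem hx
  exact ⟨_, hw.vertex_mem i, _, hw.segment_subset hi, hx⟩

/-- The half-turns about the two edges at `v` are commuting involutions, so they generate a Klein
four-group. An edge through `v` may be presented from either endpoint, with the same half-turn. -/
theorem mem_edgeGroup_corner {Γ : Set (E n)} {v : E n} {β δ : Fin n} (h : IsCorner Γ v β δ)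
    {s : E n ≃ᵃⁱ[ℝ] E n} : s ∈ edgeGroup Γ v ↔ s = 1 ∨ s = edgeReflection v β ∨
      s = edgeReflection v δ ∨ s = edgeReflection v β * edgeReflection v δ := by
  have hv := h.vertex
  have hb : edgeReflection v β ∈ edgeGroup Γ v := Subgroup.subset_closure
    ⟨v, _, isCubeEdge_flip hv β, (h.iff β).2 (Or.inl rfl), left_mem_segment _ _ _, rfl⟩
  have hd : edgeReflection v δ ∈ edgeGroup Γ v := Subgroup.subset_closure
    ⟨v, _, isCubeEdge_flip hv δ, (h.iff δ).2 (Or.inr rfl), left_mem_segment _ _ _, rfl⟩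
  have h1 := edgeReflection_mul_self hv β
  have h2 := edgeReflection_mul_self hv δ
  have h3 := edgeReflection_comm hv β δ
  constructor
  · intro hs
    refine Subgroup.closure_induction (p := fun s _ => s = 1 ∨ s = edgeReflection v β ∨
      s = edgeReflection v δ ∨ s = edgeReflection v β * edgeReflection v δ) ?_ (Or.inl rfl) ?_ ?_ hs
    · rintro _ ⟨a, b, hab, hΓ, hx, rfl⟩
      obtain ⟨ha, η, rfl⟩ := isCubeEdge_iff.1 hab
      rcases vertex_mem_segment ha hv hx with rfl | rfl
      · rcases (h.iff η).1 hΓ with rfl | rfl <;> simp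
      · rw [← segment_flip_symm] at hΓ
        change edgeReflection a η = _ ∨ edgeReflection a η = _ ∨ edgeReflection a η = _ ∨
          edgeReflection a η = _
        rw [← edgeReflection_flip a η]
        rcases (h.iff η).1 hΓ with rfl | rfl <;> simp
    · generalize edgeReflection v β = r at *
      generalize edgeReflection v δ = t at *
      have h4 : ∀ x, r * (r * x) = x := fun x => by rw [← mul_assoc, h1, one_mul]
      have h6 : ∀ x, t * (r * x) = r * (t * x) := fun x => by rw [← mul_assoc, ← h3, mul_assoc]
      rintro x y - - (rfl | rfl | rfl | rfl) (rfl | rfl | rfl | rfl) <;>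
        simp [mul_assoc, h1, h2, h4, h6, ← h3]
    · rintro x - (rfl | rfl | rfl | rfl)
      · simp
      · simp [edgeReflection_inv hv]
      · simp [edgeReflection_inv hv]
      · right; right; right
        rw [mul_inv_rev, edgeReflection_inv hv, edgeReflection_inv hv, h3]
  · rintro (rfl | rfl | rfl | rfl)
    · exact one_mem _
    · exact hb
    · exact hd
    · exact mul_mem hb hd

/-- At an inner point of an edge, only the reflection across this edge occurs. -/
theorem mem_edgeGroup_inner {Γ : Set (E n)} {a x : E n} (ha : a ∈ cubeVertices n) {β : Fin n}
    (hΓ : segment ℝ a (flip β a) ⊆ Γ) (hx : x ∈ segment ℝ a (flip β a)) (hxv : x ∉ cubeVertices n)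
    {s : E n ≃ᵃⁱ[ℝ] E n} : s ∈ edgeGroup Γ x ↔ s = 1 ∨ s = edgeReflection a β := by
  have h1 := edgeReflection_mul_self ha β
  constructor
  · intro hs
    refine Subgroup.closure_induction (p := fun s _ => s = 1 ∨ s = edgeReflection a β)
      ?_ (Or.inl rfl) ?_ ?_ hs
    · rintro _ ⟨c, b, hcb, -, hx', rfl⟩
      obtain ⟨hc, η, rfl⟩ := isCubeEdge_iff.1 hcb
      obtain ⟨rfl, rfl | rfl⟩ := edge_eq_of_mem ha hc hx hx' hxv
      · exact Or.inr rfl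
      · exact Or.inr (edgeReflection_flip c β).symm
    · rintro x y - - (rfl | rfl) (rfl | rfl) <;> simp [h1]
    · rintro x - (rfl | rfl)
      · simp
      · simp [edgeReflection_inv ha]
  · rintro (rfl | rfl)
    · exact one_mem _
    · exact Subgroup.subset_closure ⟨a, _, isCubeEdge_flip ha β, hΓ, hx, rfl⟩

theorem edgeGroup_eq_bot {Γ : Set (E n)} {x : E n} (hx : x ∉ Γ) : edgeGroup Γ x = ⊥ := by
  rw [edgeGroup, Subgroup.closure_eq_bot_iff]
  rintro _ ⟨a, b, -, hΓ, hx', -⟩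
  exact absurd (hΓ hx') hx

/-- Only the obvious elements of the reflection group fix a vertex of `Γ`. -/
def VertexCondition (Γ : Set (E n)) : Prop :=
  ∀ v ∈ Γ, v ∈ cubeVertices n → ∀ s ∈ reflectionGroup Γ, s v = v → s ∈ edgeGroup Γ v

/-- The vertex condition determines all stabilizers. -/
theorem VertexCondition.mem_edgeGroup {Γ : Set (E n)} (hΓ : IsJordanPath Γ)
    (h : VertexCondition Γ) {x : E n} (hx : x ∈ Γ) {s : E n ≃ᵃⁱ[ℝ] E n}
    (hs : s ∈ reflectionGroup Γ) (hsx : s x = x) : s ∈ edgeGroup Γ x := by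
  by_cases hxv : x ∈ cubeVertices n
  · exact h x hx hxv s hs hsx
  obtain ⟨a, ha, β, haΓ, hxa⟩ := hΓ.exists_edge hx
  obtain ⟨m, hm⟩ := exists_isCell hs
  have hxc := segment_subset_cube ha β hxa
  obtain ⟨h1, h2⟩ := (mem_segment_flip_iff ha β).1 hxa
  have h3 := (hm.fixed hxc (by rwa [hsx])).2
  -- As `x` is not a vertex, its coordinate along the edge is an inner one, and `s` does not reflect
  -- it.
  have hβ : m β = 0 := by
    rcases h3 β with h | ⟨-, -, h⟩
    · exact h
    · refine absurd (fun α => ?_) hxv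
      by_cases hα : α = β
      · rw [hα]
        rcases (abs_eq (by norm_num)).1 h with h | h <;> simp [h]
      · rw [h1 α hα]; exact ha α
  -- The points `x` and `a` agree in all other coordinates, so `s` fixes the vertex `a` as well, and
  -- the vertex condition applies there.
  have hsa : s a = a := by
    ext α
    by_cases hα : α = β
    · rw [hα, hm.apply_even a (by simp [hβ]), hβ]; simp
    · rcases h3 α with h | ⟨ho, h, -⟩
      · rw [hm.apply_even a (by simp [h]), h]; simp
      · rw [hm.apply_odd a ho, h, h1 α hα]; ring
  have haΓ' : a ∈ Γ := haΓ (left_mem_segment _ _ _)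
  obtain ⟨η, δ, hc⟩ := hΓ.exists_isCorner haΓ' ha
  have h4 := h a haΓ' ha s hs hsa
  have hc' : ∃ δ, IsCorner Γ a β δ := by
    rcases (hc.iff β).1 haΓ with rfl | rfl
    · exact ⟨δ, hc⟩
    · exact ⟨η, hc.symm⟩
  obtain ⟨δ, hc'⟩ := hc'
  rw [mem_edgeGroup_inner ha haΓ hxa hxv]
  -- Of the four elements at the corner `a`, the two that involve the other edge reflect the
  -- coordinate `β`, contrary to `hβ`.
  obtain ⟨k, hk, hk0, hk1⟩ := isCell_schwarz ha δ
  have hodd := (hk1 β hc'.ne).2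
  rcases (mem_edgeGroup_corner hc').1 h4 with rfl | rfl | rfl | rfl
  · exact Or.inl rfl
  · exact Or.inr rfl
  · rw [hm.unique hk] at hβ
    rw [hβ] at hodd
    exact absurd hodd (by decide)
  · obtain ⟨l, hl, hl0, -⟩ := isCell_schwarz ha β
    have h5 := hm.unique (hl.mul hk)
    rw [h5] at hβ
    simp [hl0] at hβ
    rw [hβ] at hodd
    exact absurd hodd (by decide)

/-! ### Symmetries of the cube -/

/-- The vertices are the extreme points of the cube. This description uses only midpoints, so it is
preserved by every affine isometry that preserves the cube. -/
theorem mem_cubeVertices_iff {x : E n} : x ∈ cubeVertices n ↔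
    x ∈ cube n ∧ ∀ y ∈ cube n, ∀ z ∈ cube n, midpoint ℝ y z = x → y = x := by
  constructor
  · refine fun hx => ⟨cubeVertices_subset hx, fun y hy z hz h => ?_⟩
    ext α
    have h1 : (y α + z α) / 2 = x α := by
      rw [← h, midpoint_eq_smul_add]
      simp; ring
    obtain ⟨h2, h3⟩ := hy α
    obtain ⟨h4, h5⟩ := hz α
    rcases hx α with h | h <;> rw [h] at h1 ⊢ <;> linarith
  · rintro ⟨hx, h⟩ α
    by_contra hcon
    rw [not_or] at hcon
    obtain ⟨h1, h2⟩ := hx α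
    have h1' := lt_of_le_of_ne h1 (Ne.symm hcon.1)
    have h2' := lt_of_le_of_ne h2 hcon.2
    -- The distance from `x α` to the nearer end of the interval: moving by `±t` in direction `α`
    -- gives two points of the cube with midpoint `x`.
    set t : ℝ := min (x α + 1 / 2) (1 / 2 - x α) with ht
    have ht0 : 0 < t := lt_min (by linarith) (by linarith)
    have ht1 : t ≤ x α + 1 / 2 := min_le_left _ _
    have ht2 : t ≤ 1 / 2 - x α := min_le_right _ _
    have hmem : ∀ c : ℝ, |c| ≤ 1 → x + EuclideanSpace.single α (c * t) ∈ cube n := by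
      intro c hc δ
      obtain ⟨hc1, hc2⟩ := abs_le.1 hc
      by_cases hδ : δ = α
      · subst hδ
        simp only [PiLp.add_apply, PiLp.single_apply, if_true]
        constructor <;> nlinarith
      · simpa [hδ] using hx δ
    have := h _ (hmem 1 (by simp)) _ (hmem (-1) (by simp)) (by
      rw [midpoint_eq_smul_add]
      ext δ
      by_cases hδ : δ = α
      · subst hδ
        simp
        ring
      · simp [hδ]
        ring)
    have := congrArg (fun y : E n => y α) this
    simp at this
    linarith

/-- Each coordinate in which two vertices differ contributes `1` to the squared distance, so
isometries recognize edges. -/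
theorem isCubeEdge_iff_dist {a b : E n} :
    IsCubeEdge a b ↔ a ∈ cubeVertices n ∧ b ∈ cubeVertices n ∧ dist a b = 1 := by
  constructor
  · intro h
    obtain ⟨ha, β, rfl⟩ := isCubeEdge_iff.1 h
    refine ⟨ha, flip_mem ha β, ?_⟩
    rw [EuclideanSpace.dist_eq, Finset.sum_eq_single β]
    · rw [Real.sqrt_sq dist_nonneg, Real.dist_eq, flip_apply_self]
      have := vertex_sq ha β
      rw [show a β - -a β = 2 * a β by ring, abs_mul, this]
      norm_num
    · intro α _ hα
      rw [flip_apply_of_ne hα, dist_self]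
      norm_num
    · simp
  · rintro ⟨ha, hb, hd⟩
    refine ⟨ha, hb, ?_⟩
    have hd2 : ∑ α, dist (a α) (b α) ^ 2 = 1 := by
      rw [EuclideanSpace.dist_eq] at hd
      exact (Real.sqrt_eq_one).1 hd
    have hterm : ∀ α, a α ≠ b α → dist (a α) (b α) ^ 2 = 1 := by
      intro α hα
      rcases ha α with h | h <;> rcases hb α with h' | h' <;> rw [h, h'] at hα ⊢
      · exact absurd rfl hα
      · norm_num [Real.dist_eq]
      · norm_num [Real.dist_eq]
      · exact absurd rfl hα
    have hex : ∃ β, a β ≠ b β := by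
      by_contra hcon
      push Not at hcon
      rw [Finset.sum_eq_zero (fun α _ => by rw [hcon α, dist_self]; norm_num)] at hd2
      norm_num at hd2
    obtain ⟨β, hβ⟩ := hex
    refine ⟨β, hβ, fun α hα => ?_⟩
    by_contra hne
    have h1 : ∑ δ ∈ {β, α}, dist (a δ) (b δ) ^ 2 ≤ ∑ δ, dist (a δ) (b δ) ^ 2 :=
      Finset.sum_le_sum_of_subset_of_nonneg (Finset.subset_univ _) fun _ _ _ => sq_nonneg _
    rw [Finset.sum_pair (Ne.symm hα), hterm β hβ, hterm α hne, hd2] at h1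
    norm_num at h1

/-- An affine isometry which preserves the cube. -/
def PreservesCube (g : E n ≃ᵃⁱ[ℝ] E n) : Prop := g '' cube n = cube n

theorem cubeSymmetric_iff {Γ Γ' : Set (E n)} :
    CubeSymmetric Γ Γ' ↔ ∃ g : E n ≃ᵃⁱ[ℝ] E n, PreservesCube g ∧ g '' Γ = Γ' :=
  ⟨fun ⟨g, h1, h2⟩ => ⟨g.toRealAffineIsometryEquiv, by simpa [PreservesCube] using h1, by
    simpa using h2⟩, fun ⟨g, h1, h2⟩ => ⟨g.toIsometryEquiv, h1, h2⟩⟩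

namespace PreservesCube

variable {g : E n ≃ᵃⁱ[ℝ] E n}

theorem mem_cube (h : PreservesCube g) {x : E n} (hx : x ∈ cube n) : g x ∈ cube n := by
  have : g x ∈ g '' cube n := mem_image_of_mem _ hx
  rwa [h] at this

theorem inv (h : PreservesCube g) : PreservesCube g⁻¹ := by
  unfold PreservesCube
  nth_rw 1 [← h]
  rw [← image_comp]
  have : ⇑(g⁻¹) ∘ ⇑g = id := funext fun x => g.symm_apply_apply x
  rw [this, image_id]

theorem inv_apply (x : E n) : g⁻¹ (g x) = x := g.symm_apply_apply x

theorem apply_inv (x : E n) : g (g⁻¹ x) = x := g.apply_symm_apply x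

theorem mem_vertices (h : PreservesCube g) {x : E n} (hx : x ∈ cubeVertices n) :
    g x ∈ cubeVertices n := by
  rw [mem_cubeVertices_iff] at hx ⊢
  refine ⟨h.mem_cube hx.1, fun y hy z hz hyz => ?_⟩
  have := hx.2 _ (h.inv.mem_cube hy) _ (h.inv.mem_cube hz) (by
    have h1 := (g⁻¹).toAffineEquiv.map_midpoint y z
    simp only [AffineIsometryEquiv.coe_toAffineEquiv] at h1
    rw [← h1, hyz, inv_apply])
  rw [← this, apply_inv]

theorem isCubeEdge (h : PreservesCube g) {a b : E n} (hab : IsCubeEdge a b) :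
    IsCubeEdge (g a) (g b) := by
  rw [isCubeEdge_iff_dist] at hab ⊢
  exact ⟨h.mem_vertices hab.1, h.mem_vertices hab.2.1, by rw [g.dist_map, hab.2.2]⟩

end PreservesCube

theorem image_segment_isometry (g : E n ≃ᵃⁱ[ℝ] E n) (a b : E n) :
    g '' segment ℝ a b = segment ℝ (g a) (g b) :=
  image_segment ℝ (g.toAffineEquiv : E n →ᵃ[ℝ] E n) a b

/-- An isometry conjugates the reflection in a subspace to the reflection in its image. Thus
symmetries of the cube carry the reflection group of a path to that of the image path. -/
theorem schwarzReflection_conj (g : E n ≃ᵃⁱ[ℝ] E n) (a b : E n) :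
    schwarzReflection (g a) (g b) = g * schwarzReflection a b * g⁻¹ := by
  ext1 x
  obtain ⟨y, rfl⟩ := g.surjective x
  have h1 : ((affineSpan ℝ {a, b}).map g.toAffineIsometry.toAffineMap) =
      affineSpan ℝ {g a, g b} := by
    rw [AffineSubspace.map_span, image_pair]
    rfl
  have h2 := EuclideanGeometry.reflection_map (affineSpan ℝ {a, b}) g.toAffineIsometry y
  rw [AffineIsometryEquiv.coe_mul, AffineIsometryEquiv.coe_mul, Function.comp_apply,
    Function.comp_apply, PreservesCube.inv_apply]
  refine Eq.trans ?_ h2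
  exact EuclideanGeometry.eq_reflection_of_eq_subspace h1.symm (g y)

theorem conj_mem_closure {g : E n ≃ᵃⁱ[ℝ] E n} {A B : Set (E n ≃ᵃⁱ[ℝ] E n)}
    (h : ∀ s ∈ A, g * s * g⁻¹ ∈ B) {s : E n ≃ᵃⁱ[ℝ] E n} (hs : s ∈ Subgroup.closure A) :
    g * s * g⁻¹ ∈ Subgroup.closure B := by
  have : Subgroup.closure A ≤ (Subgroup.closure B).comap (MulAut.conj g).toMonoidHom := by
    rw [Subgroup.closure_le]
    intro s hs
    exact Subgroup.subset_closure (h s hs)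
  exact this hs

theorem conj_mem_reflectionGroup {g : E n ≃ᵃⁱ[ℝ] E n} (h : PreservesCube g) {Γ : Set (E n)}
    {s : E n ≃ᵃⁱ[ℝ] E n} (hs : s ∈ reflectionGroup Γ) :
    g * s * g⁻¹ ∈ reflectionGroup (g '' Γ) := by
  refine conj_mem_closure ?_ hs
  rintro _ ⟨a, b, hab, hΓ, rfl⟩
  exact ⟨g a, g b, h.isCubeEdge hab, by rw [← image_segment_isometry]; exact image_mono hΓ,
    (schwarzReflection_conj g a b).symm⟩

theorem conj_mem_edgeGroup {g : E n ≃ᵃⁱ[ℝ] E n} (h : PreservesCube g) {Γ : Set (E n)} {x : E n}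
    {s : E n ≃ᵃⁱ[ℝ] E n} (hs : s ∈ edgeGroup Γ x) :
    g * s * g⁻¹ ∈ edgeGroup (g '' Γ) (g x) := by
  refine conj_mem_closure ?_ hs
  rintro _ ⟨a, b, hab, hΓ, hx, rfl⟩
  exact ⟨g a, g b, h.isCubeEdge hab, by rw [← image_segment_isometry]; exact image_mono hΓ,
    by rw [← image_segment_isometry]; exact mem_image_of_mem _ hx,
    (schwarzReflection_conj g a b).symm⟩

theorem VertexCondition.image {g : E n ≃ᵃⁱ[ℝ] E n} (h : PreservesCube g) {Γ : Set (E n)}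
    (hΓ : VertexCondition Γ) : VertexCondition (g '' Γ) := by
  rintro _ ⟨v, hv, rfl⟩ hgv s hs hsv
  have h1 := conj_mem_reflectionGroup h.inv hs
  rw [← image_comp, show ⇑(g⁻¹) ∘ ⇑g = id from funext fun x => g.symm_apply_apply x,
    image_id, inv_inv] at h1
  have hv' : v ∈ cubeVertices n := by
    have := h.inv.mem_vertices hgv
    rwa [PreservesCube.inv_apply] at this
  have h2 := conj_mem_edgeGroup h (hΓ v hv hv' _ h1 (by
    rw [AffineIsometryEquiv.coe_mul, AffineIsometryEquiv.coe_mul, Function.comp_apply,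
      Function.comp_apply, hsv, PreservesCube.inv_apply]))
  simpa [mul_assoc] using h2

theorem CubeSymmetric.symm {Γ Γ' : Set (E n)} (h : CubeSymmetric Γ Γ') : CubeSymmetric Γ' Γ := by
  obtain ⟨g, hg, rfl⟩ := h
  refine ⟨g.symm, ?_, ?_⟩
  · nth_rw 1 [← hg]
    rw [← image_comp]; simp
  · rw [← image_comp]; simp

theorem CubeSymmetric.trans {Γ Γ' Γ'' : Set (E n)} (h : CubeSymmetric Γ Γ')
    (h' : CubeSymmetric Γ' Γ'') : CubeSymmetric Γ Γ'' := by
  obtain ⟨g, hg, rfl⟩ := h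
  obtain ⟨g', hg', rfl⟩ := h'
  refine ⟨g.trans g', ?_, ?_⟩
  · change (g' ∘ g) '' _ = _
    rw [image_comp, hg, hg']
  · change (g' ∘ g) '' _ = _
    rw [image_comp]

theorem VertexCondition.of_cubeSymmetric {Γ Γ' : Set (E n)} (h : CubeSymmetric Γ Γ')
    (hΓ : VertexCondition Γ) : VertexCondition Γ' := by
  obtain ⟨g, hg, rfl⟩ := cubeSymmetric_iff.1 h
  exact hΓ.image hg

end

/-! ### Dimension four: coding by bits, obstructions and invariants -/

section

/-! ### Signed permutations of the coordinates -/

section SignedPerm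

variable {n : ℕ}

/-- The isometry which permutes the coordinates by `σ` and then changes the sign of those for
which `t` holds. -/
def signedPerm (σ : Equiv.Perm (Fin n)) (t : Fin n → Bool) : E n ≃ᵃⁱ[ℝ] E n :=
  ((LinearIsometryEquiv.piLpCongrLeft 2 ℝ ℝ σ).trans
    (LinearIsometryEquiv.piLpCongrRight 2 fun α =>
      if t α then LinearIsometryEquiv.neg ℝ else LinearIsometryEquiv.refl ℝ ℝ)).toAffineIsometryEquiv

theorem signedPerm_apply (σ : Equiv.Perm (Fin n)) (t : Fin n → Bool) (x : E n) (α : Fin n) :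
    signedPerm σ t x α = if t α then -x (σ.symm α) else x (σ.symm α) := by
  simp only [signedPerm, LinearIsometryEquiv.coe_toAffineIsometryEquiv,
    LinearIsometryEquiv.trans_apply, LinearIsometryEquiv.piLpCongrRight_apply]
  split_ifs <;> rfl

theorem preservesCube_signedPerm (σ : Equiv.Perm (Fin n)) (t : Fin n → Bool) :
    PreservesCube (signedPerm σ t) := by
  ext y
  constructor
  · rintro ⟨x, hx, rfl⟩ α
    rw [signedPerm_apply]
    obtain ⟨h1, h2⟩ := hx (σ.symm α)
    split_ifs <;> constructor <;> linarith
  · intro hy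
    refine ⟨(signedPerm σ t).symm y, fun α => ?_, (signedPerm σ t).apply_symm_apply y⟩
    have h := signedPerm_apply σ t ((signedPerm σ t).symm y) (σ α)
    rw [(signedPerm σ t).apply_symm_apply, σ.symm_apply_apply] at h
    obtain ⟨h1, h2⟩ := hy (σ α)
    rw [h] at h1 h2
    split_ifs at h1 h2 <;> constructor <;> linarith

theorem signedPerm_flip (σ : Equiv.Perm (Fin n)) (t : Fin n → Bool) (x : E n) (β : Fin n) :
    signedPerm σ t (flip β x) = flip (σ β) (signedPerm σ t x) := by
  ext α
  by_cases h : α = σ β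
  · subst h
    rw [signedPerm_apply, flip_apply_self, signedPerm_apply]
    split_ifs <;> simp
  · rw [flip_apply_of_ne h, signedPerm_apply, signedPerm_apply, flip_apply_of_ne]
    rintro rfl
    simp at h

theorem wordVertex_map (σ : Equiv.Perm (Fin n)) (t : Fin n → Bool) (p : E n) (γ : List (Fin n))
    (i : ℕ) : wordVertex (signedPerm σ t p) (γ.map σ) i = signedPerm σ t (wordVertex p γ i) := by
  ext α
  rw [signedPerm_apply]
  simp only [wordVertex, ← List.map_take, signedPerm_apply]
  have h : List.count α (List.map σ (List.take i γ)) = List.count (σ.symm α) (List.take i γ) := by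
    conv_lhs => rw [← σ.apply_symm_apply α]
    exact List.count_map_of_injective _ _ σ.injective _
  rw [h]
  split_ifs <;> simp

theorem wordPath_map (σ : Equiv.Perm (Fin n)) (t : Fin n → Bool) (p : E n) (γ : List (Fin n)) :
    wordPath (signedPerm σ t p) (γ.map σ) = signedPerm σ t '' wordPath p γ := by
  simp only [wordPath, image_iUnion, image_segment_isometry, wordVertex_map, List.length_map]

theorem JordanWord.map {p : E n} {γ : List (Fin n)} (h : JordanWord p γ) (σ : Equiv.Perm (Fin n))
    (t : Fin n → Bool) : JordanWord (signedPerm σ t p) (γ.map σ) where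
  vertex := (preservesCube_signedPerm σ t).mem_vertices h.vertex
  length := by simpa using h.length
  mem β := List.mem_map.2 ⟨σ.symm β, h.mem _, by simp⟩
  closed := by rw [List.length_map, wordVertex_map, h.closed]
  inj i hi j hj hij := by
    rw [List.length_map] at hi hj
    rw [wordVertex_map, wordVertex_map] at hij
    exact h.inj hi hj ((signedPerm σ t).injective hij)

end SignedPerm

/-! ### Vertices encoded by numbers -/

/-- The vertex of the cube whose negative coordinates are the bits of `c`. -/
def codeVec (c : ℕ) : E 4 := WithLp.toLp 2 fun α => if c.testBit α then -(1 / 2) else 1 / 2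

theorem codeVec_apply (c : ℕ) (α : Fin 4) :
    codeVec c α = if c.testBit α then -(1 / 2) else 1 / 2 := rfl

theorem codeVec_mem (c : ℕ) : codeVec c ∈ cubeVertices 4 := by
  intro α
  rw [codeVec_apply]
  split_ifs <;> simp

theorem codeVec_flip (c : ℕ) (d : Fin 4) : codeVec (c ^^^ 2 ^ (d : ℕ)) = flip d (codeVec c) := by
  ext α
  by_cases h : α = d
  · subst h
    rw [flip_apply_self, codeVec_apply, codeVec_apply, Nat.testBit_xor, Nat.testBit_two_pow_self]
    cases c.testBit α <;> simp
  · rw [flip_apply_of_ne h, codeVec_apply, codeVec_apply, Nat.testBit_xor,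
      Nat.testBit_two_pow_of_ne fun h' => h (Fin.ext h'.symm)]
    simp

theorem codeVec_apply_eq_iff {c c' : ℕ} {α : Fin 4} :
    codeVec c α = codeVec c' α ↔ c.testBit α = c'.testBit α := by
  rw [codeVec_apply, codeVec_apply]
  cases c.testBit α <;> cases c'.testBit α <;> norm_num

theorem exists_codeVec {a : E 4} (ha : a ∈ cubeVertices 4) : ∃ c, a = codeVec c := by
  classical
  have h : ∀ b0 b1 b2 b3 : Bool, ∃ c : Fin 16, ∀ α : Fin 4,
      (c : ℕ).testBit α = (![b0, b1, b2, b3] : Fin 4 → Bool) α := by decide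
  obtain ⟨c, hc⟩ := h (decide (a 0 < 0)) (decide (a 1 < 0)) (decide (a 2 < 0)) (decide (a 3 < 0))
  refine ⟨c, ?_⟩
  ext α
  rw [codeVec_apply, hc α]
  fin_cases α <;> simp
  · rcases ha 0 with h | h <;> rw [h] <;> norm_num
  · rcases ha 1 with h | h <;> rw [h] <;> norm_num
  · rcases ha 2 with h | h <;> rw [h] <;> norm_num
  · rcases ha 3 with h | h <;> rw [h] <;> norm_num

theorem codeVec_zero : codeVec 0 = WithLp.toLp 2 fun _ => 1 / 2 := by
  ext α; simp [codeVec]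

theorem eq_zero_of_codeVec {c : ℕ} (hc : c < 2 ^ 4) (h : codeVec c = codeVec 0) : c = 0 := by
  apply Nat.eq_of_testBit_eq
  intro i
  by_cases hi : i < 4
  · exact codeVec_apply_eq_iff.1 (congrArg (fun v : E 4 => v (⟨i, hi⟩ : Fin 4)) h)
  · rw [Nat.testBit_lt_two_pow (hc.trans_le (Nat.pow_le_pow_right (by norm_num) (by omega)))]
    simp

/-- The code of the end of the path from `c` along a word. -/
def codeEnd (c : ℕ) (γ : List (Fin 4)) : ℕ := γ.foldl (fun c d => c ^^^ 2 ^ (d : ℕ)) c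

theorem codeEnd_append (c : ℕ) (γ : List (Fin 4)) (d : Fin 4) :
    codeEnd c (γ ++ [d]) = codeEnd c γ ^^^ 2 ^ (d : ℕ) := by
  simp [codeEnd]

theorem codeEnd_lt {c : ℕ} (hc : c < 2 ^ 4) (γ : List (Fin 4)) : codeEnd c γ < 2 ^ 4 := by
  induction γ generalizing c with
  | nil => exact hc
  | cons d γ ih =>
    exact ih (Nat.xor_lt_two_pow hc (Nat.pow_lt_pow_right (by norm_num) d.2))

theorem wordVertex_codeVec (c : ℕ) (γ : List (Fin 4)) {i : ℕ} (hi : i ≤ γ.length) :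
    wordVertex (codeVec c) γ i = codeVec (codeEnd c (γ.take i)) := by
  induction i with
  | zero => simp [wordVertex_zero, codeEnd]
  | succ i ih =>
    rw [wordVertex_succ _ _ (by omega), ih (by omega), ← codeVec_flip, ← codeEnd_append]
    simp

/-- The edges of the path from `c` along a word, as pairs of a code of a vertex and a direction. -/
def edgeCodes : ℕ → List (Fin 4) → List (ℕ × Fin 4)
  | _, [] => []
  | c, d :: ds => (c, d) :: edgeCodes (c ^^^ 2 ^ (d : ℕ)) ds

/-- The edge with a given code. -/
def codeEdge (q : ℕ × Fin 4) : Set (E 4) := segment ℝ (codeVec q.1) (flip q.2 (codeVec q.1))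

theorem mem_edgeCodes {c : ℕ} {γ : List (Fin 4)} {q : ℕ × Fin 4} :
    q ∈ edgeCodes c γ ↔ ∃ i, ∃ hi : i < γ.length, q = (codeEnd c (γ.take i), γ[i]) := by
  induction γ generalizing c with
  | nil => simp [edgeCodes]
  | cons d ds ih =>
    simp only [edgeCodes, List.mem_cons, ih]
    constructor
    · rintro (rfl | ⟨i, hi, rfl⟩)
      · exact ⟨0, by simp, by simp [codeEnd]⟩
      · exact ⟨i + 1, by simpa using hi, by simp [codeEnd]⟩
    · rintro ⟨i, hi, rfl⟩
      cases i with
      | zero => left; simp [codeEnd]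
      | succ i => right; exact ⟨i, by simpa using hi, by simp [codeEnd]⟩

theorem wordPath_eq_codeEdges (c : ℕ) (γ : List (Fin 4)) :
    wordPath (codeVec c) γ = ⋃ q ∈ edgeCodes c γ, codeEdge q := by
  ext x
  simp only [wordPath, mem_iUnion, mem_edgeCodes, exists_prop]
  constructor
  · rintro ⟨i, hi, hx⟩
    refine ⟨_, ⟨i, hi, rfl⟩, ?_⟩
    rwa [wordVertex_succ _ _ hi, wordVertex_codeVec c γ (le_of_lt hi)] at hx
  · rintro ⟨_, ⟨i, hi, rfl⟩, hx⟩
    refine ⟨i, hi, ?_⟩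
    rwa [wordVertex_succ _ _ hi, wordVertex_codeVec c γ (le_of_lt hi)]

/-- The corners of a path: the code of the vertex, and the set of the two directions. -/
def corners : Fin 4 → ℕ → List (Fin 4) → List (ℕ × ℕ)
  | _, _, [] => []
  | pr, c, d :: ds => (c, (2 ^ (pr : ℕ)) ||| (2 ^ (d : ℕ))) :: corners d (c ^^^ 2 ^ (d : ℕ)) ds

theorem mem_corners {pr : Fin 4} {c : ℕ} {γ : List (Fin 4)} {q : ℕ × ℕ} : q ∈ corners pr c γ ↔
    ∃ i, ∃ hi : i < γ.length, q = (codeEnd c (γ.take i),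
      2 ^ ((if i = 0 then pr else γ[i - 1] : Fin 4) : ℕ) ||| 2 ^ (γ[i] : ℕ)) := by
  induction γ generalizing c pr with
  | nil => simp [corners]
  | cons d ds ih =>
    simp only [corners, List.mem_cons, ih]
    constructor
    · rintro (rfl | ⟨i, hi, rfl⟩)
      · exact ⟨0, by simp, by simp [codeEnd]⟩
      · refine ⟨i + 1, by simpa using hi, ?_⟩
        cases i with
        | zero => simp [codeEnd]
        | succ i => simp [codeEnd]
    · rintro ⟨i, hi, rfl⟩
      cases i with
      | zero => left; simp [codeEnd]
      | succ i =>
        refine Or.inr ⟨i, by simpa using hi, ?_⟩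
        cases i with
        | zero => simp [codeEnd]
        | succ i => simp [codeEnd]

theorem testBit_pair (a b α : Fin 4) :
    (2 ^ (a : ℕ) ||| 2 ^ (b : ℕ)).testBit (α : ℕ) = decide (α = a ∨ α = b) := by
  rw [Nat.testBit_or, Nat.testBit_two_pow, Nat.testBit_two_pow]
  have h1 : ((a : ℕ) = α) ↔ α = a := by rw [Fin.ext_iff, eq_comm]
  have h2 : ((b : ℕ) = α) ↔ α = b := by rw [Fin.ext_iff, eq_comm]
  simp [h1, h2]

/-- The predecessor of the first edge is the last one, whence the start value `γ.getLastD 0`; its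
default `0` never matters, as a word with a corner is not empty. -/
theorem exists_isCorner_of_mem_corners {γ : List (Fin 4)} (h : JordanWord (codeVec 0) γ)
    {q : ℕ × ℕ} (hq : q ∈ corners (γ.getLastD 0) 0 γ) :
    ∃ β δ, IsCorner (wordPath (codeVec 0) γ) (codeVec q.1) β δ ∧ codeVec q.1 ∈ wordPath (codeVec 0) γ ∧
      ∀ α : Fin 4, q.2.testBit α = decide (α = β ∨ α = δ) := by
  obtain ⟨i, hi, rfl⟩ := mem_corners.1 hq
  have h1 := h.isCorner hi
  have h2 := h.vertex_mem_path hi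
  rw [wordVertex_codeVec 0 γ hi.le] at h1 h2
  refine ⟨_, _, h1.symm, h2, fun α => ?_⟩
  rw [testBit_pair]
  have h3 : (if i = 0 then γ.getLastD 0 else γ[i - 1]) =
      γ[prevIdx γ.length i]'(prevIdx_lt hi) := by
    unfold prevIdx
    split_ifs with h0
    · have hne : γ ≠ [] := by rintro rfl; simp at hi
      rw [List.getLastD_eq_getLast?, List.getLast?_eq_getElem?]
      simp [List.getElem?_eq_getElem (show γ.length - 1 < γ.length by omega)]
    · rfl
  rw [h3]

/-! ### Obstructions -/

/-- The cell with odd coordinates `α` for which `P α` holds, adjacent to the vertex `c`. -/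
def patCell (c : ℕ) (P : Fin 4 → Bool) (α : Fin 4) : ℤ :=
  if P α then (if c.testBit α then -1 else 1) else 0

theorem patCell_cast (c : ℕ) (P : Fin 4 → Bool) (α : Fin 4) :
    (patCell c P α : ℝ) = if P α then 2 * codeVec c α else 0 := by
  rw [codeVec_apply, patCell]
  split_ifs <;> norm_num

theorem odd_patCell {c : ℕ} {P : Fin 4 → Bool} {α : Fin 4} : Odd (patCell c P α) ↔ P α := by
  unfold patCell
  split_ifs with h1 h2 <;> simp [h1]

/-- These cells belong to the maps which reverse the coordinates in `P` about the vertex `c`; so an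
element that fixes the vertex is described by a pattern of four bits. -/
theorem isCell_patCell_iff {s : E 4 ≃ᵃⁱ[ℝ] E 4} {c : ℕ} {P : Fin 4 → Bool} :
    IsCell s (patCell c P) ↔ ∀ x α, s x α = if P α then 2 * codeVec c α - x α else x α := by
  refine forall_congr' fun x => forall_congr' fun α => ?_
  rw [patCell_cast]
  have h1 : (((patCell c P α).negOnePow : ℤ) : ℝ) = if P α then -1 else 1 := by
    split_ifs with h
    · rw [Int.negOnePow_odd _ (odd_patCell.2 h)]; simp
    · rw [Int.negOnePow_even _ (by rw [← Int.not_odd_iff_even, odd_patCell]; exact h)]; simp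
  rw [h1]
  constructor
  · intro h
    rw [h]
    split_ifs <;> ring
  · intro h
    rw [h]
    split_ifs <;> ring

theorem isCell_edgeReflection (c : ℕ) (d : Fin 4) :
    IsCell (edgeReflection (codeVec c) d) (patCell c fun α => decide (α ≠ d)) := by
  rw [isCell_patCell_iff]
  intro x α
  rw [schwarzReflection_flip_apply (codeVec_mem c)]
  by_cases h : α = d <;> simp [h]

/-- Each half-turn reverses three of the four coordinates, so the two coordinates off both edges are
reversed twice. -/
theorem isCell_corner (c : ℕ) {d e : Fin 4} (hde : d ≠ e) :
    IsCell (edgeReflection (codeVec c) d * edgeReflection (codeVec c) e)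
      (patCell c fun α => decide (α = d ∨ α = e)) := by
  rw [isCell_patCell_iff]
  intro x α
  rw [AffineIsometryEquiv.coe_mul, Function.comp_apply,
    schwarzReflection_flip_apply (codeVec_mem c), schwarzReflection_flip_apply (codeVec_mem c)]
  by_cases h : α = d
  · have : α ≠ e := fun h' => hde (h.symm.trans h')
    simp [h, hde]
  · by_cases h' : α = e
    · simp [h', hde.symm]
    · simp [h, h']

theorem isCell_one_patCell (c : ℕ) : IsCell (1 : E 4 ≃ᵃⁱ[ℝ] E 4) (patCell c fun _ => false) := by
  rw [isCell_patCell_iff]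
  simp

theorem patCell_injective {c : ℕ} {P Q : Fin 4 → Bool} (h : patCell c P = patCell c Q) : P = Q := by
  ext α
  rw [Bool.eq_iff_iff, ← odd_patCell (c := c), h, odd_patCell]

/-- An element of the edge group at a corner has one of four sign patterns. -/
theorem pattern_of_mem_edgeGroup {Γ : Set (E 4)} {c : ℕ} {β δ : Fin 4}
    (h : IsCorner Γ (codeVec c) β δ) {s : E 4 ≃ᵃⁱ[ℝ] E 4} (hs : s ∈ edgeGroup Γ (codeVec c))
    {P : Fin 4 → Bool} (hP : IsCell s (patCell c P)) :
    P = (fun _ => false) ∨ P = (fun α => decide (α ≠ β)) ∨ P = (fun α => decide (α ≠ δ)) ∨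
      P = fun α => decide (α = β ∨ α = δ) := by
  rcases (mem_edgeGroup_corner h).1 hs with rfl | rfl | rfl | rfl
  · exact Or.inl (patCell_injective (hP.unique (isCell_one_patCell c)))
  · exact Or.inr (Or.inl (patCell_injective (hP.unique (isCell_edgeReflection c β))))
  · exact Or.inr (Or.inr (Or.inl (patCell_injective (hP.unique (isCell_edgeReflection c δ)))))
  · exact Or.inr (Or.inr (Or.inr (patCell_injective (hP.unique (isCell_corner c h.ne)))))

theorem mem_edgeGroup_of_pattern {Γ : Set (E 4)} {c : ℕ} {β δ : Fin 4}
    (h : IsCorner Γ (codeVec c) β δ) {s : E 4 ≃ᵃⁱ[ℝ] E 4}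
    {P : Fin 4 → Bool} (hP : IsCell s (patCell c P))
    (hP' : P = (fun _ => false) ∨ P = (fun α => decide (α ≠ β)) ∨ P = (fun α => decide (α ≠ δ)) ∨
      P = fun α => decide (α = β ∨ α = δ)) : s ∈ edgeGroup Γ (codeVec c) := by
  rw [mem_edgeGroup_corner h]
  rcases hP' with rfl | rfl | rfl | rfl
  · exact Or.inl (hP.eq (isCell_one_patCell c))
  · exact Or.inr (Or.inl (hP.eq (isCell_edgeReflection c β)))
  · exact Or.inr (Or.inr (Or.inl (hP.eq (isCell_edgeReflection c δ))))
  · exact Or.inr (Or.inr (Or.inr (hP.eq (isCell_corner c h.ne))))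

/-- Two corners with different directions, whose vertices agree in the directions of the first. -/
def isBad (w : List (Fin 4)) : Bool :=
  let l := corners (w.getLastD 0) 0 w
  l.any fun q => l.any fun q' => !(Nat.beq q.2 q'.2) && Nat.beq ((q.1 ^^^ q'.1) &&& q.2) 0

/-- The pattern `{β, δ}` has two elements while the first three alternatives have none or three, so
only the last one can hold, and the pairs agree as sets. -/
theorem pattern_pair_aux : ∀ β δ β' δ' : Fin 4, β ≠ δ → β' ≠ δ' →
    ((∀ α, decide (α = β ∨ α = δ) = false) ∨
      (∀ α, decide (α = β ∨ α = δ) = decide (α ≠ β')) ∨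
      (∀ α, decide (α = β ∨ α = δ) = decide (α ≠ δ')) ∨
      (∀ α, decide (α = β ∨ α = δ) = decide (α = β' ∨ α = δ'))) →
    2 ^ (β : ℕ) ||| 2 ^ (δ : ℕ) = 2 ^ (β' : ℕ) ||| 2 ^ (δ' : ℕ) := by
  decide

theorem corners_mask {γ : List (Fin 4)} {pr : Fin 4} {c : ℕ} {q : ℕ × ℕ} (hq : q ∈ corners pr c γ) :
    q.2 < 2 ^ 4 := by
  obtain ⟨i, hi, rfl⟩ := mem_corners.1 hq
  exact Nat.or_lt_two_pow (Nat.pow_lt_pow_right (by norm_num) (Fin.is_lt _))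
    (Nat.pow_lt_pow_right (by norm_num) (Fin.is_lt _))

theorem eq_of_testBit_lt {a b : ℕ} (ha : a < 2 ^ 4) (hb : b < 2 ^ 4)
    (h : ∀ α : Fin 4, a.testBit α = b.testBit α) : a = b := by
  apply Nat.eq_of_testBit_eq
  intro i
  by_cases hi : i < 4
  · exact h ⟨i, hi⟩
  · have h1 : 2 ^ 4 ≤ 2 ^ i := Nat.pow_le_pow_right (by norm_num) (by omega)
    rw [Nat.testBit_lt_two_pow (ha.trans_le h1), Nat.testBit_lt_two_pow (hb.trans_le h1)]

/-- The product of the two half-turns at the first corner reverses only the coordinates `β` and `δ`,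
about values shared by the second vertex, so it fixes that vertex too. The vertex condition there
would force the two pairs of directions to agree. -/
theorem not_vertexCondition_of_isBad {γ : List (Fin 4)} (h : JordanWord (codeVec 0) γ)
    (hb : isBad γ = true) : ¬ VertexCondition (wordPath (codeVec 0) γ) := by
  intro hv
  simp only [isBad, List.any_eq_true] at hb
  obtain ⟨q, hq, q', hq', hb⟩ := hb
  simp only [Bool.and_eq_true, Bool.not_eq_true'] at hb
  obtain ⟨hne, hz⟩ := hb
  have hz := Nat.eq_of_beq_eq_true hz
  have hne := Nat.ne_of_beq_eq_false hne
  obtain ⟨β, δ, hc, hm, hbit⟩ := exists_isCorner_of_mem_corners h hq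
  obtain ⟨β', δ', hc', hm', hbit'⟩ := exists_isCorner_of_mem_corners h hq'
  have hcell := isCell_corner q.1 hc.ne
  have hagree : ∀ α : Fin 4, (α = β ∨ α = δ) → q.1.testBit α = q'.1.testBit α := by
    intro α hα
    have h1 := congrArg (fun k => Nat.testBit k α) hz
    simp only [Nat.testBit_and, Nat.testBit_xor, Nat.zero_testBit, hbit, hα, decide_true,
      Bool.and_true] at h1
    simpa using h1
  have hpat : patCell q.1 (fun α => decide (α = β ∨ α = δ)) =
      patCell q'.1 fun α => decide (α = β ∨ α = δ) := by
    funext α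
    unfold patCell
    by_cases hα : α = β ∨ α = δ
    · rw [hagree α hα]
    · simp [hα]
  rw [hpat] at hcell
  have hmem : edgeReflection (codeVec q.1) β * edgeReflection (codeVec q.1) δ ∈
      reflectionGroup (wordPath (codeVec 0) γ) :=
    mul_mem (edgeReflection_mem_reflectionGroup hc.vertex ((hc.iff β).2 (Or.inl rfl)))
      (edgeReflection_mem_reflectionGroup hc.vertex ((hc.iff δ).2 (Or.inr rfl)))
  have hfix := hv _ hm' hc'.vertex _ hmem (by
    ext α
    rw [isCell_patCell_iff.1 hcell]
    split_ifs <;> ring)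
  have h4 := pattern_of_mem_edgeGroup hc' hfix hcell
  simp only [funext_iff] at h4
  have h5 := pattern_pair_aux β δ β' δ' hc.ne hc'.ne h4
  apply hne
  apply eq_of_testBit_lt (corners_mask hq) (corners_mask hq')
  intro α
  rw [hbit, hbit', ← testBit_pair, ← testBit_pair, h5]

/-- The word `12341234` is not excluded by a pair of corners. -/
theorem not_vertexCondition_exception (h : JordanWord (codeVec 0) [0, 1, 2, 3, 0, 1, 2, 3]) :
    ¬ VertexCondition (wordPath (codeVec 0) [0, 1, 2, 3, 0, 1, 2, 3]) := by
  intro hv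
  have hmem : ∀ i (hi : i < 8), edgeReflection
      (wordVertex (codeVec 0) [0, 1, 2, 3, 0, 1, 2, 3] i) ([0, 1, 2, 3, 0, 1, 2, 3][i]) ∈
      reflectionGroup (wordPath (codeVec 0) [0, 1, 2, 3, 0, 1, 2, 3]) := fun i hi =>
    edgeReflection_mem_reflectionGroup (h.vertex_mem i) (h.segment_subset (by simpa using hi))
  have hcode : ∀ i (hi : i < 8), wordVertex (codeVec 0) [0, 1, 2, 3, 0, 1, 2, 3] i =
      codeVec (codeEnd 0 (([0, 1, 2, 3, 0, 1, 2, 3] : List (Fin 4)).take i)) := fun i hi =>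
    wordVertex_codeVec 0 _ (by simpa using hi.le)
  have h0 : edgeReflection (codeVec 0) 0 ∈
      reflectionGroup (wordPath (codeVec 0) [0, 1, 2, 3, 0, 1, 2, 3]) := by
    have := hmem 0 (by norm_num); rwa [hcode _ (by norm_num)] at this
  have h1 : edgeReflection (codeVec 1) 1 ∈
      reflectionGroup (wordPath (codeVec 0) [0, 1, 2, 3, 0, 1, 2, 3]) := by
    have := hmem 1 (by norm_num); rwa [hcode _ (by norm_num)] at this
  have h3 : edgeReflection (codeVec 7) 3 ∈
      reflectionGroup (wordPath (codeVec 0) [0, 1, 2, 3, 0, 1, 2, 3]) := by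
    have := hmem 3 (by norm_num); rwa [hcode _ (by norm_num)] at this
  have h4 : edgeReflection (codeVec 15) 0 ∈
      reflectionGroup (wordPath (codeVec 0) [0, 1, 2, 3, 0, 1, 2, 3]) := by
    have := hmem 4 (by norm_num); rwa [hcode _ (by norm_num)] at this
  have hc : IsCorner (wordPath (codeVec 0) [0, 1, 2, 3, 0, 1, 2, 3]) (codeVec 12) 2 1 := by
    have := h.isCorner (i := 6) (by simp); rwa [hcode _ (by norm_num)] at this
  have hm : codeVec 12 ∈ wordPath (codeVec 0) [0, 1, 2, 3, 0, 1, 2, 3] := by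
    have := h.vertex_mem_path (i := 6) (by simp); rwa [hcode _ (by norm_num)] at this
  -- This product of four half-turns is the identity in the coordinates `0, 2` and reverses `1, 3`
  -- about the vertex with code `12`. The corner there has directions `2, 1`, which do not allow the
  -- pattern `{1, 3}`.
  have hcell : IsCell (edgeReflection (codeVec 0) 0 * edgeReflection (codeVec 1) 1 *
      (edgeReflection (codeVec 7) 3 * edgeReflection (codeVec 15) 0))
      (patCell 12 fun α => decide (α = 1 ∨ α = 3)) := by
    rw [isCell_patCell_iff]
    intro x α
    have h0 : ∀ α : Fin 4, Nat.testBit 0 α = ![false, false, false, false] α := by decide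
    have h1 : ∀ α : Fin 4, Nat.testBit 1 α = ![true, false, false, false] α := by decide
    have h7 : ∀ α : Fin 4, Nat.testBit 7 α = ![true, true, true, false] α := by decide
    have h15 : ∀ α : Fin 4, Nat.testBit 15 α = ![true, true, true, true] α := by decide
    have h12 : ∀ α : Fin 4, Nat.testBit 12 α = ![false, false, true, true] α := by decide
    have hα : ∀ α : Fin 4, α = 0 ∨ α = 1 ∨ α = 2 ∨ α = 3 := by decide
    simp only [AffineIsometryEquiv.coe_mul, Function.comp_apply,
      schwarzReflection_flip_apply (codeVec_mem _), codeVec_apply, h0, h1, h7, h15, h12]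
    rcases hα α with rfl | rfl | rfl | rfl <;> simp
  have hfix := hv _ hm hc.vertex _ (mul_mem (mul_mem h0 h1) (mul_mem h3 h4)) (by
    ext α
    rw [isCell_patCell_iff.1 hcell]
    split_ifs <;> ring)
  have h5 := pattern_of_mem_edgeGroup hc hfix hcell
  simp only [funext_iff] at h5
  revert h5
  decide

/-! ### The five Jordan paths satisfy the vertex condition -/

/-- The parities of the two kinds of reflections which occur in a coordinate of a product of
reflections, evaluated on a functional `f` on `(ℤ/2)^8`. -/
def parity (f : ℕ) (m : Fin 4 → ℤ) (α : Fin 4) : Bool :=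
  xor (f.testBit (2 * α) && (m α % 4 == 1 || m α % 4 == 2))
    (f.testBit (2 * α + 1) && (m α % 4 == 2 || m α % 4 == 3))

/-- The sum of the parities of all coordinates. -/
def totalParity (f : ℕ) (m : Fin 4 → ℤ) : Bool :=
  xor (xor (parity f m 0) (parity f m 1)) (xor (parity f m 2) (parity f m 3))

/-- In a coordinate, a group element lies in the infinite dihedral group generated by `x ↦ 1 - x`
and `x ↦ -1 - x`. Counting either generator modulo two is a homomorphism, and `m` modulo `4`
determines both counts: it is `1` and `3` for the generators and `2` for their product. -/
theorem parity_mul (f : ℕ) (m k : Fin 4 → ℤ) (α : Fin 4) :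
    parity f (fun α => ((m α).negOnePow : ℤ) * k α + m α) α = xor (parity f m α) (parity f k α) := by
  simp only [parity]
  generalize f.testBit (2 * α) = a
  generalize f.testBit (2 * α + 1) = b
  generalize m α = m
  generalize k α = k
  have h1 : (((m.negOnePow : ℤ) * k + m) % 4 = if m % 2 = 0 then (k % 4 + m % 4) % 4
      else (m % 4 + 4 - k % 4) % 4) := by
    split_ifs with h
    · rw [Int.negOnePow_even _ (Int.even_iff.2 h)]
      simp only [Units.val_one, one_mul]
      omega
    · rw [Int.negOnePow_odd _ (Int.odd_iff.2 (by omega))]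
      simp only [Units.val_neg, Units.val_one, neg_mul, one_mul]
      omega
  have h2 : m % 2 = (m % 4) % 2 := by omega
  rw [h1, h2]
  have hm : m % 4 = 0 ∨ m % 4 = 1 ∨ m % 4 = 2 ∨ m % 4 = 3 := by omega
  have hk : k % 4 = 0 ∨ k % 4 = 1 ∨ k % 4 = 2 ∨ k % 4 = 3 := by omega
  rcases hm with hm | hm | hm | hm <;> rcases hk with hk | hk | hk | hk <;> rw [hm, hk] <;>
    revert a b <;> decide

theorem totalParity_mul (f : ℕ) (m k : Fin 4 → ℤ) :
    totalParity f (fun α => ((m α).negOnePow : ℤ) * k α + m α) =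
      xor (totalParity f m) (totalParity f k) := by
  simp only [totalParity, parity_mul]
  generalize parity f m 0 = a
  generalize parity f m 1 = b
  generalize parity f m 2 = c
  generalize parity f m 3 = d
  generalize parity f k 0 = a'
  generalize parity f k 1 = b'
  generalize parity f k 2 = c'
  generalize parity f k 3 = d'
  revert a b c d a' b' c' d'
  decide

/-- A functional which vanishes on the generators vanishes on the whole reflection group. -/
theorem totalParity_eq_false {Γ : Set (E 4)} {f : ℕ}
    (h : ∀ c d, segment ℝ (codeVec c) (flip d (codeVec c)) ⊆ Γ →
      totalParity f (patCell c fun α => decide (α ≠ d)) = false)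
    {s : E 4 ≃ᵃⁱ[ℝ] E 4} (hs : s ∈ reflectionGroup Γ) {m : Fin 4 → ℤ} (hm : IsCell s m) :
    totalParity f m = false := by
  suffices ∃ m, IsCell s m ∧ totalParity f m = false by
    obtain ⟨k, hk, h1⟩ := this
    rwa [hm.unique hk]
  refine Subgroup.closure_induction (p := fun s _ => ∃ m, IsCell s m ∧ totalParity f m = false)
    ?_ ⟨0, isCell_one, by simp [totalParity, parity]⟩ ?_ ?_ hs
  · rintro _ ⟨a, b, hab, hΓ, rfl⟩
    obtain ⟨ha, β, rfl⟩ := isCubeEdge_iff.1 hab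
    obtain ⟨c, rfl⟩ := exists_codeVec ha
    exact ⟨_, isCell_edgeReflection c β, h c β hΓ⟩
  · rintro s t - - ⟨m, hm, h1⟩ ⟨k, hk, h2⟩
    exact ⟨_, hm.mul hk, by rw [totalParity_mul, h1, h2]; rfl⟩
  · rintro s - ⟨m, hm, h1⟩
    refine ⟨_, hm.inv, ?_⟩
    have h2 := totalParity_mul f m (fun α => -((m α).negOnePow : ℤ) * m α)
    have h3 : (fun α => ((m α).negOnePow : ℤ) * (-((m α).negOnePow : ℤ) * m α) + m α) = 0 := by
      funext α
      have : ((m α).negOnePow : ℤ) * (m α).negOnePow = 1 := by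
        rw [← Units.val_mul]; simp
      simp only [Pi.zero_apply]
      linear_combination (-m α) * this
    rw [h3, h1] at h2
    simpa [totalParity, parity] using h2.symm

end

/-! ### The finite classification of Jordan paths -/

section

/-- The functionals `fs` vanish on the reflections across the edges of the path `w`, and they
determine the stabilizers of its vertices. -/
def goodCheck (fs : List ℕ) (w : List (Fin 4)) : Bool :=
  (edgeCodes 0 w).all (fun q => fs.all fun f =>
    !totalParity f (patCell q.1 fun α => decide (α ≠ q.2))) &&
  (corners (w.getLastD 0) 0 w).all fun q =>
    decide (∀ b0 b1 b2 b3 : Bool,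
      (∀ f ∈ fs, totalParity f (patCell q.1 ![b0, b1, b2, b3]) = false) →
      (∀ α, ![b0, b1, b2, b3] α = false) ∨
      (∃ β : Fin 4, q.2.testBit β = true ∧ ∀ α, ![b0, b1, b2, b3] α = decide (α ≠ β)) ∨
      ∀ α : Fin 4, ![b0, b1, b2, b3] α = q.2.testBit α)

theorem patCell_congr {c c' : ℕ} {P : Fin 4 → Bool}
    (h : ∀ α, P α = true → codeVec c α = codeVec c' α) : patCell c P = patCell c' P := by
  funext α
  unfold patCell
  by_cases hP : P α = true
  · rw [codeVec_apply_eq_iff.1 (h α hP)]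
  · simp [hP]

/-- An element that fixes a vertex reverses some pattern `P` of coordinates about it. The
functionals in `fs` vanish on the generators, hence on this element, and the check confirms that
this leaves only the patterns of the edge group. -/
theorem vertexCondition_of_goodCheck {fs : List ℕ} {w : List (Fin 4)}
    (hw : JordanWord (codeVec 0) w) (h : goodCheck fs w = true) :
    VertexCondition (wordPath (codeVec 0) w) := by
  simp only [goodCheck, Bool.and_eq_true, List.all_eq_true, Bool.not_eq_true',
    decide_eq_true_eq] at h
  obtain ⟨h1, h2⟩ := h
  intro v hv hvv s hs hsv
  obtain ⟨i, hi, rfl⟩ := hw.exists_idx hv hvv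
  have hmem := (mem_corners (pr := w.getLastD 0) (c := 0)).2 ⟨i, hi, rfl⟩
  obtain ⟨β, δ, hc, -, hbit⟩ := exists_isCorner_of_mem_corners hw hmem
  have h3 := h2 _ hmem
  rw [wordVertex_codeVec 0 w hi.le] at hsv ⊢
  obtain ⟨m, hm⟩ := exists_isCell hs
  set c := codeEnd 0 (w.take i) with hcdef
  have hfix := (hm.fixed (cubeVertices_subset hc.vertex)
    (by rw [hsv]; exact cubeVertices_subset hc.vertex)).2
  let P : Fin 4 → Bool := fun α => decide (m α ≠ 0)
  have hmP : m = patCell c P := by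
    funext α
    rcases hfix α with h0 | ⟨ho, h0, -⟩
    · simp [patCell, P, h0]
    · have hne : m α ≠ 0 := by rintro h; rw [h] at ho; exact absurd ho (by decide)
      have : ((m α : ℤ) : ℝ) = (patCell c P α : ℝ) := by
        rw [patCell_cast, h0]; simp [P, hne]
      exact_mod_cast this
  have hP4 : ![P 0, P 1, P 2, P 3] = P := by
    funext α; fin_cases α <;> rfl
  rw [hmP] at hm
  have h4 := h3 (P 0) (P 1) (P 2) (P 3) (fun f hf => by
    rw [hP4]
    refine totalParity_eq_false (fun c' d hseg => ?_) hs hm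
    obtain ⟨j, hj, hjd, hj'⟩ := hw.exists_edge (codeVec_mem c') hseg
    rw [wordVertex_codeVec 0 w hj.le] at hj'
    have h5 := h1 _ (mem_edgeCodes.2 ⟨j, hj, rfl⟩) f hf
    rw [← h5]
    subst hjd
    congr 1
    -- An edge may be presented from either end; the two vertices differ only in its direction,
    -- where the pattern is false.
    refine patCell_congr fun α hα => ?_
    have hα : α ≠ w[j] := by simpa using hα
    rcases hj' with h | h
    · rw [h]
    · rw [h, flip_apply_of_ne hα])
  rw [hP4] at h4
  refine mem_edgeGroup_of_pattern hc hm ?_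
  rcases h4 with h4 | ⟨η, hη, h4⟩ | h4
  · exact Or.inl (funext h4)
  · rw [hbit η] at hη
    rcases of_decide_eq_true hη with rfl | rfl
    · exact Or.inr (Or.inl (funext h4))
    · exact Or.inr (Or.inr (Or.inl (funext h4)))
  · exact Or.inr (Or.inr (Or.inr (funext fun α => (h4 α).trans (hbit α))))

theorem codeVec_injOn {c c' : ℕ} (hc : c < 2 ^ 4) (hc' : c' < 2 ^ 4) (h : codeVec c = codeVec c') :
    c = c' :=
  eq_of_testBit_lt hc hc' fun α =>
    codeVec_apply_eq_iff.1 (congrArg (fun v : E 4 => v α) h)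

theorem jordanWord_of_codes {w : List (Fin 4)} (h1 : 3 ≤ w.length) (h2 : ∀ β, β ∈ w)
    (h3 : codeEnd 0 w = 0)
    (h4 : ∀ i < w.length, ∀ j < w.length, codeEnd 0 (w.take i) = codeEnd 0 (w.take j) → i = j) :
    JordanWord (codeVec 0) w where
  vertex := codeVec_mem 0
  length := h1
  mem := h2
  closed := by rw [wordVertex_codeVec 0 w le_rfl, List.take_length, h3]
  inj i hi j hj hij := by
    have hi : i < w.length := hi
    have hj : j < w.length := hj
    rw [wordVertex_codeVec 0 w hi.le, wordVertex_codeVec 0 w hj.le] at hij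
    exact h4 i hi j hj (codeVec_injOn (codeEnd_lt (by norm_num) _) (codeEnd_lt (by norm_num) _) hij)

theorem jordanWord_fiveWords (k : Fin 5) : JordanWord (codeVec 0) (fiveWords k) := by
  apply jordanWord_of_codes <;> revert k <;> decide

theorem fivePaths_eq (k : Fin 5) : fivePaths k = wordPath (codeVec 0) (fiveWords k) := by
  rw [fivePaths, codeVec_zero]

theorem vertexCondition_fivePaths (k : Fin 5) : VertexCondition (fivePaths k) := by
  rw [fivePaths_eq]
  -- Three functionals on `(ℤ/2)^8` for each path, as bit masks: bit `2α` weighs the reflections `x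
  -- ↦ 1 - x` of the coordinate `α`, and bit `2α + 1` the reflections `x ↦ -1 - x`. They vanish on
  -- all edge reflections, and at each vertex only the four patterns of the edge group survive.
  apply vertexCondition_of_goodCheck (jordanWord_fiveWords k)
    (fs := (![[103, 190, 217], [89, 190, 231], [71, 190, 249], [62, 217, 231], [62, 199, 249]] :
      Fin 5 → List ℕ) k)
  revert k
  decide +kernel

/-! ### The classification -/

/-- The code of a vertex after a permutation of the coordinates. -/
def permCode (f : Fin 4 → Fin 4) (c : ℕ) : ℕ :=
  ((List.filter (fun α : Fin 4 => c.testBit α) [0, 1, 2, 3]).map fun α => 2 ^ (f α : ℕ)).sum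

/-- The code of an edge after a permutation of the coordinates and the sign changes `x`, up to its
direction. -/
def moveEdge (f : Fin 4 → Fin 4) (x : ℕ) (q : ℕ × Fin 4) : ℕ × Fin 4 :=
  ((permCode f q.1 ^^^ x) &&& (15 ^^^ 2 ^ (f q.2 : ℕ)), f q.2)

/-- For the words which satisfy the vertex condition: the number of the path among the five, and a
permutation and sign changes which lead to it. -/
def goodTable : List (List (Fin 4) × Fin 5 × (Fin 4 → Fin 4) × ℕ) :=
  [
    ([0, 1, 0, 2, 3, 0, 1, 0, 3, 2], 3, ![0, 3, 1, 2], 1),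
    ([0, 1, 0, 2, 3, 1, 3, 2], 2, ![3, 2, 0, 1], 0),
    ([0, 1, 0, 2, 3, 2, 0, 1, 0, 2, 3, 2], 4, ![0, 3, 1, 2], 1),
    ([0, 1, 2, 0, 3, 0, 2, 1, 0, 3], 3, ![0, 1, 2, 3], 0),
    ([0, 1, 2, 0, 3, 1, 2, 3], 0, ![0, 1, 2, 3], 0),
    ([0, 1, 2, 0, 3, 2, 1, 3], 1, ![0, 1, 2, 3], 0),
    ([0, 1, 2, 1, 0, 3, 0, 1, 2, 1, 0, 3], 4, ![0, 1, 2, 3], 0),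
    ([0, 1, 2, 1, 0, 3, 1, 2, 1, 3], 3, ![1, 0, 3, 2], 3),
    ([0, 1, 2, 1, 0, 3, 2, 3], 2, ![0, 1, 2, 3], 0),
    ([0, 1, 2, 3, 0, 1, 3, 2], 0, ![1, 2, 0, 3], 1),
    ([0, 1, 2, 3, 0, 2, 1, 3], 0, ![1, 0, 3, 2], 3),
    ([0, 1, 2, 3, 0, 3, 2, 1], 2, ![2, 1, 0, 3], 3),
    ([0, 1, 2, 3, 1, 0, 1, 3, 2, 1], 3, ![3, 0, 1, 2], 0),
    ([0, 1, 2, 3, 1, 0, 2, 3], 0, ![0, 3, 2, 1], 1),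
    ([0, 1, 2, 3, 1, 0, 3, 2], 1, ![0, 3, 1, 2], 1),
    ([0, 1, 2, 3, 2, 1, 0, 1, 2, 3, 2, 1], 4, ![3, 0, 1, 2], 0),
    ([0, 1, 2, 3, 2, 1, 0, 2, 3, 2], 3, ![1, 2, 0, 3], 1),
    ([0, 1, 2, 3, 2, 1, 0, 3], 2, ![1, 0, 3, 2], 3)]

/-- The word `w` agrees with one of the five paths by the symmetry in the table. -/
def isGood (w : List (Fin 4)) : Bool :=
  goodTable.any fun t => t.1 == w &&
    ((edgeCodes 0 w).all (fun q => (edgeCodes 0 (fiveWords t.2.1)).any fun q' =>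
      moveEdge t.2.2.1 t.2.2.2 q == moveEdge id 0 q') &&
    (edgeCodes 0 (fiveWords t.2.1)).all (fun q' => (edgeCodes 0 w).any fun q =>
      moveEdge t.2.2.1 t.2.2.2 q == moveEdge id 0 q')) && decide (Function.Injective t.2.2.1)

theorem testBit_permCode : ∀ f : Fin 4 → Fin 4, Function.Injective f →
    ∀ c < 16, ∀ α, (permCode f c).testBit (f α) = c.testBit α := by
  decide +kernel

/-- The bit in the direction of the edge only selects an endpoint. -/
theorem codeEdge_congr {c c' : ℕ} {d : Fin 4}
    (h : ∀ α : Fin 4, α ≠ d → c.testBit α = c'.testBit α) : codeEdge (c, d) = codeEdge (c', d) := by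
  ext x
  unfold codeEdge
  rw [mem_segment_flip_iff (codeVec_mem c), mem_segment_flip_iff (codeVec_mem c')]
  refine and_congr_left fun _ => forall_congr' fun α => forall_congr' fun hα => ?_
  rw [codeVec_apply_eq_iff.2 (h α hα)]

/-- The mask in `moveEdge` clears only the bit in the direction of the image edge, which makes codes
of edges comparable; all other bits are permuted and flipped. -/
theorem testBit_moveEdge {f : Fin 4 → Fin 4} (hf : Function.Injective f) (x : ℕ) {q : ℕ × Fin 4}
    (hq : q.1 < 2 ^ 4) {α : Fin 4} (hα : α ≠ q.2) :
    (moveEdge f x q).1.testBit (f α) = xor (q.1.testBit α) (x.testBit (f α)) := by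
  have h15 : ∀ β : Fin 4, Nat.testBit 15 β = true := by decide
  have hne : (f q.2 : ℕ) ≠ f α := fun h => hα (hf (Fin.ext h.symm))
  simp only [moveEdge, Nat.testBit_and, Nat.testBit_xor, testBit_permCode f hf q.1 hq, h15,
    Nat.testBit_two_pow_of_ne hne]
  simp

theorem codeEdge_moveEdge_id {q : ℕ × Fin 4} (hq : q.1 < 2 ^ 4) :
    codeEdge (moveEdge id 0 q) = codeEdge q := by
  refine codeEdge_congr fun α hα => ?_
  have := testBit_moveEdge Function.injective_id 0 hq hα
  simp only [id_eq, Nat.zero_testBit, Bool.xor_false] at this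
  exact this

theorem image_codeEdge (σ : Equiv.Perm (Fin 4)) (x : ℕ) {q : ℕ × Fin 4} (hq : q.1 < 2 ^ 4) :
    signedPerm σ (fun α => x.testBit α) '' codeEdge q = codeEdge (moveEdge σ x q) := by
  unfold codeEdge
  rw [image_segment_isometry, signedPerm_flip]
  have h1 : signedPerm σ (fun α => x.testBit α) (codeVec q.1) = codeVec (permCode σ q.1 ^^^ x) := by
    ext α
    obtain ⟨β, rfl⟩ := σ.surjective α
    rw [signedPerm_apply, σ.symm_apply_apply, codeVec_apply, codeVec_apply, Nat.testBit_xor,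
      testBit_permCode σ σ.injective q.1 hq]
    cases q.1.testBit β <;> cases x.testBit (σ β) <;> simp
  rw [h1]
  refine codeEdge_congr (c := permCode σ q.1 ^^^ x) (d := σ q.2) fun α hα => ?_
  obtain ⟨β, rfl⟩ := σ.surjective α
  change _ = (moveEdge σ x q).1.testBit (σ β)
  rw [testBit_moveEdge σ.injective x hq fun h => hα (by rw [h]), Nat.testBit_xor,
    testBit_permCode σ σ.injective q.1 hq]

theorem edgeCodes_lt {w : List (Fin 4)} {q : ℕ × Fin 4} (hq : q ∈ edgeCodes 0 w) : q.1 < 2 ^ 4 := by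
  obtain ⟨i, hi, rfl⟩ := mem_edgeCodes.1 hq
  exact codeEnd_lt (by norm_num) _

/-- The tabulated permutation and sign changes form a symmetry of the cube, and equality of the two
paths is read off from the codes of their edges, by one inclusion in each direction. -/
theorem cubeSymmetric_of_isGood {w : List (Fin 4)} (h : isGood w = true) :
    ∃ k, CubeSymmetric (wordPath (codeVec 0) w) (fivePaths k) := by
  simp only [isGood, List.any_eq_true, Bool.and_eq_true, List.all_eq_true, beq_iff_eq,
    decide_eq_true_eq] at h
  obtain ⟨⟨w', k, f, x⟩, -, ⟨-, h1, h2⟩, hf⟩ := h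
  let σ : Equiv.Perm (Fin 4) := Equiv.ofBijective f (Finite.injective_iff_bijective.1 hf)
  refine ⟨k, cubeSymmetric_iff.2 ⟨signedPerm σ fun α => x.testBit α,
    preservesCube_signedPerm _ _, ?_⟩⟩
  rw [fivePaths_eq, wordPath_eq_codeEdges, wordPath_eq_codeEdges, image_iUnion₂]
  apply Subset.antisymm
  · refine iUnion₂_subset fun q hq => ?_
    obtain ⟨q', hq', h3⟩ := h1 q hq
    refine Subset.trans (Eq.subset ?_) (subset_biUnion_of_mem hq')
    rw [image_codeEdge σ x (edgeCodes_lt hq), ← codeEdge_moveEdge_id (edgeCodes_lt hq'), ← h3]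
    rfl
  · refine iUnion₂_subset fun q' hq' => ?_
    obtain ⟨q, hq, h3⟩ := h2 q' hq'
    refine Subset.trans (Eq.subset ?_) (subset_biUnion_of_mem (u := fun q =>
      signedPerm σ (fun α => x.testBit α) '' codeEdge q) hq)
    rw [image_codeEdge σ x (edgeCodes_lt hq), ← codeEdge_moveEdge_id (edgeCodes_lt hq'), ← h3]
    rfl

/-- The dichotomy for closed words. -/
def settled (w : List (Fin 4)) : Bool := isBad w || isGood w || w == [0, 1, 2, 3, 0, 1, 2, 3]

/-- Depth first search through all closed words without repeated vertices which begin with the word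
`pre`. The letters of `pre` are the numbers below `m`, its end is `c`, and `vis` is the set of the
vertices that it visited. -/
def search : ℕ → List (Fin 4) → ℕ → ℕ → ℕ → Bool
  | 0, _, _, _, _ => false
  | k + 1, pre, m, c, vis => ([0, 1, 2, 3] : List (Fin 4)).all fun d =>
    bif Nat.ble d m then
      bif Nat.beq (c ^^^ 2 ^ (d : ℕ)) 0 then (Nat.ble (max m (d + 1)) 3 || settled (pre ++ [d]))
      else (vis.testBit (c ^^^ 2 ^ (d : ℕ)) ||
        search k (pre ++ [d]) (max m (d + 1)) (c ^^^ 2 ^ (d : ℕ)) (vis ||| 2 ^ (c ^^^ 2 ^ (d : ℕ))))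
    else true

/-- Fuel `17` suffices: apart from the initial vertex there are only fifteen vertices to visit, so
no branch exhausts it. -/
theorem search_eq_true : search 17 [] 0 0 0 = true := by decide +kernel

/-- The statement of the classification for a word. -/
def Classified (γ : List (Fin 4)) : Prop :=
  VertexCondition (wordPath (codeVec 0) γ) →
    ∃ k, CubeSymmetric (wordPath (codeVec 0) γ) (fivePaths k)

theorem classified_of_settled {γ : List (Fin 4)} (h : JordanWord (codeVec 0) γ)
    (hs : settled γ = true) : Classified γ := by
  intro hv
  simp only [settled, Bool.or_eq_true, beq_iff_eq] at hs
  rcases hs with (hs | hs) | rfl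
  · exact absurd hv (not_vertexCondition_of_isBad h hs)
  · exact cubeSymmetric_of_isGood hs
  · exact absurd hv (not_vertexCondition_exception h)

theorem signedPerm_codeVec_zero (σ : Equiv.Perm (Fin 4)) :
    signedPerm σ (fun _ => false) (codeVec 0) = codeVec 0 := by
  ext α
  rw [signedPerm_apply]
  simp [codeVec_apply]

/-- Renaming the directions is a symmetry of the cube that fixes the initial vertex. -/
theorem Classified.of_map {γ : List (Fin 4)} (σ : Equiv.Perm (Fin 4))
    (h : Classified (γ.map σ)) : Classified γ := by
  intro hv
  have h1 : CubeSymmetric (wordPath (codeVec 0) γ) (wordPath (codeVec 0) (γ.map σ)) := by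
    refine cubeSymmetric_iff.2 ⟨signedPerm σ fun _ => false, preservesCube_signedPerm _ _, ?_⟩
    rw [← wordPath_map, signedPerm_codeVec_zero]
  obtain ⟨k, hk⟩ := h (hv.of_cubeSymmetric h1)
  exact ⟨k, h1.trans hk⟩

/-- Induction on the fuel, following the word. Up to renaming, new directions appear in the order
`0, 1, 2, 3`, so only letters at most `m` need to be tried: a larger letter is interchanged with
`m`, and this leaves `pre` unchanged. -/
theorem classified_of_search (k : ℕ) : ∀ (pre : List (Fin 4)) (m vis : ℕ),
    search k pre m (codeEnd 0 pre) vis = true → (∀ d ∈ pre, (d : ℕ) < m) →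
    (∀ x, vis.testBit x = true → ∃ i, 0 < i ∧ i ≤ pre.length ∧ codeEnd 0 (pre.take i) = x) →
    ∀ rest, rest ≠ [] → JordanWord (codeVec 0) (pre ++ rest) → Classified (pre ++ rest) := by
  induction k with
  | zero => intro pre m vis h; simp [search] at h
  | succ k ih =>
    intro pre m vis h hm hvis
    have main : ∀ (d : Fin 4) (rest : List (Fin 4)), (d : ℕ) ≤ m →
        JordanWord (codeVec 0) (pre ++ d :: rest) → Classified (pre ++ d :: rest) := by
      intro d rest hd hw
      have hd4 : ∀ d : Fin 4, d ∈ ([0, 1, 2, 3] : List (Fin 4)) := by decide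
      have h1 := List.all_eq_true.1 h d (hd4 d)
      rw [Nat.ble_eq_true_of_le hd, cond_true] at h1
      rw [← codeEnd_append] at h1
      have hlen : (pre ++ d :: rest).length = pre.length + 1 + rest.length := by
        simp; omega
      have htake : (pre ++ d :: rest).take (pre.length + 1) = pre ++ [d] := by
        rw [List.take_append]; simp
      have hv := wordVertex_codeVec 0 (pre ++ d :: rest) (i := pre.length + 1) (by omega)
      rw [htake] at hv
      have hlt : codeEnd 0 (pre ++ [d]) < 2 ^ 4 := codeEnd_lt (by norm_num) _
      have hm' : ∀ e ∈ pre ++ [d], (e : ℕ) < max m (d + 1) := by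
        intro e he
        rcases List.mem_append.1 he with he | he
        · exact lt_max_of_lt_left (hm e he)
        · rw [List.mem_singleton.1 he]; exact lt_max_of_lt_right (Nat.lt_succ_self _)
      by_cases hr : rest = []
      · subst hr
        have h0 : codeEnd 0 (pre ++ [d]) = 0 := by
          have h2 := hw.closed
          rw [hlen, List.length_nil, Nat.add_zero, hv] at h2
          exact eq_zero_of_codeVec hlt h2
        rw [h0] at h1
        simp only [Nat.beq_refl, cond_true, Bool.or_eq_true] at h1
        rcases h1 with h1 | h1
        -- A word that closes up with at most three directions is not a Jordan word.
        · have h2 := Nat.le_of_ble_eq_true h1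
          have h3 := hm' 3 (hw.mem 3)
          exact absurd h3 (by simpa using h2)
        · exact classified_of_settled hw h1
      · have hrl : 0 < rest.length := List.length_pos_iff.2 hr
        have h0 : Nat.beq (codeEnd 0 (pre ++ [d])) 0 = false := by
          by_contra hcon
          have h2 := Nat.eq_of_beq_eq_true (eq_true_of_ne_false hcon)
          rw [h2] at hv
          have := hw.inj (show pre.length + 1 < _ by omega) (show 0 < _ by omega)
            (hv.trans (wordVertex_zero _ _).symm)
          omega
        rw [h0, cond_false, Bool.or_eq_true] at h1
        rcases h1 with h1 | h1
        · obtain ⟨i, hi0, hi, hx⟩ := hvis _ h1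
          have hv' := wordVertex_codeVec 0 (pre ++ d :: rest) (i := i) (by omega)
          rw [List.take_append_of_le_length hi, hx, ← hv] at hv'
          have := hw.inj (show i < _ by omega) (show pre.length + 1 < _ by omega) hv'
          omega
        · have := ih (pre ++ [d]) _ _ h1 hm' ?_ rest hr (by simpa using hw)
          · simpa using this
          · intro x hx
            rw [Nat.testBit_or, Bool.or_eq_true] at hx
            rcases hx with hx | hx
            · obtain ⟨i, hi0, hi, hx⟩ := hvis x hx
              exact ⟨i, hi0, by simp; omega, by rw [List.take_append_of_le_length hi, hx]⟩
            · rw [Nat.testBit_two_pow, decide_eq_true_eq] at hx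
              exact ⟨(pre ++ [d]).length, by simp, le_rfl, by rw [List.take_length, hx]⟩
    intro rest hne hw
    cases rest with
    | nil => exact absurd rfl hne
    | cons d rest =>
      by_cases hd : (d : ℕ) ≤ m
      · exact main d rest hd hw
      · have hm4 : m < 4 := by have := d.2; omega
        let σ : Equiv.Perm (Fin 4) := Equiv.swap d ⟨m, hm4⟩
        apply Classified.of_map σ
        have hpre : pre.map σ = pre := by
          conv_rhs => rw [← List.map_id pre]
          refine List.map_congr_left fun e he => ?_
          have := hm e he
          refine Equiv.swap_apply_of_ne_of_ne ?_ ?_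
          · rintro rfl; omega
          · rintro rfl; simp at this
        have hw' := hw.map σ fun _ => false
        rw [signedPerm_codeVec_zero] at hw'
        rw [List.map_append, hpre, List.map_cons] at hw' ⊢
        have hσ : σ d = ⟨m, hm4⟩ := Equiv.swap_apply_left _ _
        rw [hσ] at hw' ⊢
        exact main _ _ le_rfl hw'

theorem JordanWord.classified {γ : List (Fin 4)} (h : JordanWord (codeVec 0) γ) : Classified γ := by
  have hne : γ ≠ [] := by rintro rfl; have := h.length; simp at this
  exact classified_of_search 17 [] 0 0 search_eq_true (by simp) (by simp) γ hne h

/-- The vertex condition holds exactly for the five Jordan paths. -/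
theorem vertexCondition_iff {Γ : Set (E 4)} (hΓ : IsJordanPath Γ) :
    VertexCondition Γ ↔ ∃ k, CubeSymmetric Γ (fivePaths k) := by
  constructor
  · intro hv
    obtain ⟨p, γ, hw, rfl⟩ := isJordanPath_iff.1 hΓ
    -- Sign changes move the initial vertex to `(1/2, 1/2, 1/2, 1/2)`.
    let t : Fin 4 → Bool := fun α => decide (p α < 0)
    have hp : signedPerm 1 t p = codeVec 0 := by
      ext α
      rw [signedPerm_apply]
      change (if t α = true then -p α else p α) = _
      rw [codeVec_apply]
      rcases hw.vertex α with h | h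
      · have ht : t α = true := decide_eq_true (by rw [h]; norm_num)
        rw [ht, h]
        simp
      · have ht : t α = false := decide_eq_false (by rw [h]; norm_num)
        rw [ht, h]
        simp
    have h1 : CubeSymmetric (wordPath p γ) (wordPath (codeVec 0) γ) := by
      refine cubeSymmetric_iff.2 ⟨signedPerm 1 t, preservesCube_signedPerm _ _, ?_⟩
      rw [← wordPath_map, hp]
      simp
    have hw' : JordanWord (codeVec 0) γ := by
      have := hw.map 1 t
      rwa [hp, Equiv.Perm.coe_one, List.map_id] at this
    obtain ⟨k, hk⟩ := hw'.classified (hv.of_cubeSymmetric h1)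
    exact ⟨k, h1.trans hk⟩
  · rintro ⟨k, hk⟩
    exact (vertexCondition_fivePaths k).of_cubeSymmetric hk.symm

/-! ### The five Jordan paths are different -/

/-- The number of pairs of vertices of `Γ` at distance at most `3/2`. -/
def nearPairs (Γ : Set (E 4)) : ℕ :=
  {q : E 4 × E 4 | (q.1 ∈ Γ ∧ q.1 ∈ cubeVertices 4) ∧ (q.2 ∈ Γ ∧ q.2 ∈ cubeVertices 4) ∧
    dist q.1 q.2 ≤ 3 / 2}.ncard

theorem nearPairs_eq {Γ Γ' : Set (E 4)} (h : CubeSymmetric Γ Γ') : nearPairs Γ = nearPairs Γ' := by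
  obtain ⟨g, hg, rfl⟩ := cubeSymmetric_iff.1 h
  refine Set.ncard_congr (fun q _ => (g q.1, g q.2)) ?_ ?_ ?_
  · rintro ⟨a, b⟩ ⟨⟨h1, h2⟩, ⟨h3, h4⟩, h5⟩
    exact ⟨⟨mem_image_of_mem _ h1, hg.mem_vertices h2⟩, ⟨mem_image_of_mem _ h3, hg.mem_vertices h4⟩,
      by rwa [g.dist_map]⟩
  · rintro ⟨a, b⟩ ⟨c, d⟩ - - h
    simp only [Prod.mk.injEq, EmbeddingLike.apply_eq_iff_eq] at h
    rw [h.1, h.2]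
  · rintro ⟨a, b⟩ ⟨⟨⟨a, h1, rfl⟩, h2⟩, ⟨⟨b, h3, rfl⟩, h4⟩, h5⟩
    have h2 := hg.inv.mem_vertices h2
    have h4 := hg.inv.mem_vertices h4
    rw [PreservesCube.inv_apply] at h2 h4
    exact ⟨(a, b), ⟨⟨h1, h2⟩, ⟨h3, h4⟩, by rwa [g.dist_map] at h5⟩, rfl⟩

/-- The distance is the square root of the number of differing coordinates, and `3/2` lies between
`√2` and `√3`. -/
theorem dist_codeVec_le_iff (c c' : ℕ) : dist (codeVec c) (codeVec c') ≤ 3 / 2 ↔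
    (Finset.univ.filter fun α : Fin 4 => c.testBit α ≠ c'.testBit α).card ≤ 2 := by
  rw [EuclideanSpace.dist_eq]
  have h1 : ∀ α : Fin 4, dist (codeVec c α) (codeVec c' α) ^ 2 =
      if c.testBit α ≠ c'.testBit α then 1 else 0 := by
    intro α
    rw [codeVec_apply, codeVec_apply, Real.dist_eq]
    cases c.testBit α <;> cases c'.testBit α <;> norm_num
  rw [Finset.sum_congr rfl fun α _ => h1 α, Finset.sum_boole, Real.sqrt_le_left (by norm_num)]
  constructor
  · intro h
    have h3 : ((Finset.univ.filter fun α : Fin 4 => c.testBit α ≠ c'.testBit α).card : ℝ) < 3 :=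
      h.trans_lt (by norm_num)
    exact Nat.lt_succ_iff.1 (by exact_mod_cast h3)
  · intro h
    have h3 : ((Finset.univ.filter fun α : Fin 4 => c.testBit α ≠ c'.testBit α).card : ℝ) ≤ 2 := by
      exact_mod_cast h
    linarith

theorem nearPairs_fivePaths (k : Fin 5) :
    nearPairs (fivePaths k) = (Finset.univ.filter fun q : Fin (fiveWords k).length ×
      Fin (fiveWords k).length => (Finset.univ.filter fun α : Fin 4 =>
        (codeEnd 0 ((fiveWords k).take q.1)).testBit α ≠
        (codeEnd 0 ((fiveWords k).take q.2)).testBit α).card ≤ 2).card := by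
  have hw := jordanWord_fiveWords k
  rw [← Set.ncard_coe_finset]
  symm
  refine Set.ncard_congr (fun q _ => (wordVertex (codeVec 0) (fiveWords k) q.1,
    wordVertex (codeVec 0) (fiveWords k) q.2)) ?_ ?_ ?_
  · rintro ⟨i, j⟩ h
    simp only [Finset.coe_filter, Finset.mem_univ, true_and, mem_ofPred_eq] at h
    rw [fivePaths_eq]
    refine ⟨⟨hw.vertex_mem_path i.2, hw.vertex_mem _⟩, ⟨hw.vertex_mem_path j.2, hw.vertex_mem _⟩, ?_⟩
    rw [wordVertex_codeVec _ _ i.2.le, wordVertex_codeVec _ _ j.2.le, dist_codeVec_le_iff]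
    exact h
  · rintro ⟨i, j⟩ ⟨i', j'⟩ - - h
    simp only [Prod.mk.injEq] at h
    ext
    · exact hw.inj i.2 i'.2 h.1
    · exact hw.inj j.2 j'.2 h.2
  · rintro ⟨a, b⟩ ⟨⟨h1, h2⟩, ⟨h3, h4⟩, h5⟩
    rw [fivePaths_eq] at h1 h3
    obtain ⟨i, hi, rfl⟩ := hw.exists_idx h1 h2
    obtain ⟨j, hj, rfl⟩ := hw.exists_idx h3 h4
    refine ⟨(⟨i, hi⟩, ⟨j, hj⟩), ?_, rfl⟩
    simp only [wordVertex_codeVec _ _ hi.le, wordVertex_codeVec _ _ hj.le,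
      dist_codeVec_le_iff] at h5
    simpa using h5

/-- The number of near pairs is a symmetry invariant, and it takes five different values. -/
theorem fivePaths_injective {j k : Fin 5} (h : CubeSymmetric (fivePaths j) (fivePaths k)) :
    j = k := by
  have h1 : ∀ k, nearPairs (fivePaths k) = (![42, 44, 48, 68, 104] : Fin 5 → ℕ) k := by
    intro k
    rw [nearPairs_fivePaths]
    revert k
    decide +kernel
  have h2 := nearPairs_eq h
  rw [h1, h1] at h2
  clear h h1
  revert j k
  decide

theorem isJordanPath_fivePaths (k : Fin 5) : IsJordanPath (fivePaths k) :=
  isJordanPath_iff.2 ⟨_, _, jordanWord_fiveWords k, fivePaths_eq k⟩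

end

/-! ### Embeddedness is equivalent to the vertex condition -/

section

variable {n : ℕ} {Γ S₀ : Set (E n)}

/-! ### The position of the patches -/

theorem cellOf_injective (Γ : Set (E n)) : Function.Injective (cellOf (Γ := Γ)) := fun s t h =>
  Subtype.ext ((isCell_cellOf s).eq (by rw [h]; exact isCell_cellOf t))

theorem IsCell.abs_sub_le {s : E n ≃ᵃⁱ[ℝ] E n} {m : Fin n → ℤ} (hs : IsCell s m) {x : E n}
    (hx : x ∈ cube n) (α : Fin n) : |s x α - m α| ≤ 1 / 2 := by
  have h := hx α
  rcases Int.even_or_odd (m α) with he | ho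
  · rw [hs.apply_even x he, add_sub_cancel_right, abs_le]; exact h
  · rw [hs.apply_odd x ho, add_sub_cancel_right, abs_neg, abs_le]; exact h

theorem abs_apply_sub_le_dist (x y : E n) (α : Fin n) : |x α - y α| ≤ dist x y := by
  rw [dist_eq_norm]
  have := PiLp.norm_apply_le (x - y) α
  rwa [PiLp.sub_apply, Real.norm_eq_abs] at this

/-- A patch lies in the unit cube about its integer centre `cellOf s`, the centre determines `s`,
and only finitely many integer points are near `x`. -/
theorem locallyFinite_patches (F : reflectionGroup Γ → Set (E n)) (hF : ∀ s, F s ⊆ cube n) :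
    LocallyFinite fun s : reflectionGroup Γ => (s : E n ≃ᵃⁱ[ℝ] E n) '' F s := by
  intro x
  refine ⟨Metric.ball x 1, Metric.ball_mem_nhds x one_pos, ?_⟩
  refine Finite.of_finite_image (f := cellOf) (Finite.subset
    (Set.finite_Icc (fun α => ⌊x α - 2⌋) (fun α => ⌈x α + 2⌉)) ?_) (cellOf_injective Γ).injOn
  rintro _ ⟨s, ⟨_, ⟨y, hy, rfl⟩, hyx⟩, rfl⟩
  have h : ∀ α, |x α - cellOf s α| ≤ 2 := by
    intro α
    have h1 := (isCell_cellOf s).abs_sub_le (hF s hy) α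
    have h2 := abs_apply_sub_le_dist ((s : E n ≃ᵃⁱ[ℝ] E n) y) x α
    have h3 := Metric.mem_ball.1 hyx
    rw [abs_le] at *
    constructor <;> linarith
  constructor <;> intro α
  · have := (abs_le.1 (h α)).2
    exact Int.floor_le_iff.2 (by linarith)
  · have := (abs_le.1 (h α)).1
    exact Int.le_ceil_iff.2 (by linarith)

theorem isClosed_iUnion_patches (F : reflectionGroup Γ → Set (E n)) (hF : ∀ s, F s ⊆ cube n)
    (hc : ∀ s, IsClosed (F s)) :
    IsClosed (⋃ s : reflectionGroup Γ, (s : E n ≃ᵃⁱ[ℝ] E n) '' F s) :=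
  (locallyFinite_patches F hF).isClosed_iUnion fun s =>
    (s : E n ≃ᵃⁱ[ℝ] E n).toHomeomorph.isClosedMap _ (hc s)

theorem coe_inv_mul_apply (s t : reflectionGroup Γ) (x y : E n) :
    ((s⁻¹ * t : reflectionGroup Γ) : E n ≃ᵃⁱ[ℝ] E n) x = y ↔
      (t : E n ≃ᵃⁱ[ℝ] E n) x = (s : E n ≃ᵃⁱ[ℝ] E n) y := by
  simp only [Subgroup.coe_mul, Subgroup.coe_inv, AffineIsometryEquiv.coe_mul, Function.comp_apply]
  exact (s : E n ≃ᵃⁱ[ℝ] E n).symm_apply_eq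

theorem IsInitialSurface.mem_cube (h : IsInitialSurface Γ S₀) (x : S₀) : (x : E n) ∈ cube n :=
  h.subset_cube x.2

/-- The stabilizers in the abstract surface of the point `x` of the initial surface. -/
def stabilizerAt (Γ S₀ : Set (E n)) (x : S₀) : Subgroup (reflectionGroup Γ) :=
  (edgeGroup Γ (x : E n)).subgroupOf (reflectionGroup Γ)

theorem mem_stabilizerAt {x : S₀} {s : reflectionGroup Γ} :
    s ∈ stabilizerAt Γ S₀ x ↔ (s : E n ≃ᵃⁱ[ℝ] E n) ∈ edgeGroup Γ (x : E n) :=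
  Subgroup.mem_subgroupOf

/-- Two points of patches agree only if they are the same point in patches which are obtained from
each other by reflections across edges through this point. -/
theorem IsInitialSurface.apply_eq_iff (h : IsInitialSurface Γ S₀) (hv : VertexCondition Γ)
    {s t : reflectionGroup Γ} {x y : S₀} :
    (s : E n ≃ᵃⁱ[ℝ] E n) x = (t : E n ≃ᵃⁱ[ℝ] E n) y ↔ x = y ∧ s⁻¹ * t ∈ stabilizerAt Γ S₀ x := by
  constructor
  · intro he
    have h1 := (coe_inv_mul_apply s t (y : E n) x).2 he.symm
    have hc := isCell_cellOf (s⁻¹ * t)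
    -- The element `s⁻¹ * t` maps a point of the cube to a point of the cube, so it fixes this
    -- point.
    have h2 := (hc.fixed (h.mem_cube y) (by rw [h1]; exact h.mem_cube x)).1
    have hxy : x = y := Subtype.ext (h1.symm.trans h2)
    subst hxy
    refine ⟨rfl, mem_stabilizerAt.2 ?_⟩
    by_cases hx : (x : E n) ∈ Γ
    · exact hv.mem_edgeGroup h.jordan hx (s⁻¹ * t).2 h1
    · rw [hc.eq_one_of_openCube (h.interior_subset ⟨x.2, hx⟩) (by rw [h1]; exact h.mem_cube x)]
      exact one_mem _
  · rintro ⟨rfl, hk⟩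
    exact ((coe_inv_mul_apply s t (x : E n) x).1 (edgeGroup_fixes (mem_stabilizerAt.1 hk))).symm

/-- Each gluing multiplies by a half-turn about an edge through the point, so a chain of gluings
stays within one coset of its edge group. -/
theorem mem_stabilizerAt_of_eqvGen {p q : reflectionGroup Γ × S₀}
    (h : Relation.EqvGen (Glue Γ S₀) p q) : p.2 = q.2 ∧ p.1⁻¹ * q.1 ∈ stabilizerAt Γ S₀ p.2 := by
  induction h with
  | rel p q h =>
    obtain ⟨s, t, x, a, b, hab, hΓ, hx, ht⟩ := h
    refine ⟨rfl, mem_stabilizerAt.2 ?_⟩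
    have : ((s⁻¹ * t : reflectionGroup Γ) : E n ≃ᵃⁱ[ℝ] E n) = schwarzReflection a b := by
      rw [Subgroup.coe_mul, ht, Subgroup.coe_inv, inv_mul_cancel_left]
    rw [this]
    exact Subgroup.subset_closure ⟨a, b, hab, hΓ, hx, rfl⟩
  | refl p => exact ⟨rfl, by rw [inv_mul_cancel]; exact one_mem _⟩
  | symm p q _ ih =>
    obtain ⟨h1, h2⟩ := ih
    refine ⟨h1.symm, ?_⟩
    rw [← h1]
    simpa using inv_mem h2
  | trans p q r _ _ ih ih' =>
    obtain ⟨h1, h2⟩ := ih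
    obtain ⟨h3, h4⟩ := ih'
    refine ⟨h1.trans h3, ?_⟩
    rw [← h1] at h4
    simpa [mul_assoc] using mul_mem h2 h4

/-- A product of half-turns about edges through `x` is realized one gluing at a time; the
intermediate patches exist because the edge group lies in the reflection group. -/
theorem mk_eq_of_mem_edgeGroup (x : S₀) {k : E n ≃ᵃⁱ[ℝ] E n} (hk : k ∈ edgeGroup Γ (x : E n)) :
    ∀ s t : reflectionGroup Γ, (t : E n ≃ᵃⁱ[ℝ] E n) = s * k →
      (Quot.mk _ (s, x) : AbstractSurface Γ S₀) = Quot.mk _ (t, x) := by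
  refine Subgroup.closure_induction (p := fun k _ => ∀ s t : reflectionGroup Γ,
    (t : E n ≃ᵃⁱ[ℝ] E n) = s * k → (Quot.mk _ (s, x) : AbstractSurface Γ S₀) = Quot.mk _ (t, x))
    ?_ ?_ ?_ ?_ hk
  · rintro _ ⟨a, b, hab, hΓ, hx, rfl⟩ s t ht
    exact Quot.sound ⟨s, t, x, a, b, hab, hΓ, hx, ht⟩
  · intro s t ht
    rw [mul_one] at ht
    rw [Subtype.ext ht]
  · intro k k' hk hk' h1 h2 s t ht
    have := h1 s ⟨s * k, mul_mem s.2 (edgeGroup_le Γ _ hk)⟩ rfl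
    rw [this]
    exact h2 _ t (by rw [ht, mul_assoc])
  · intro k hk h1 s t ht
    exact (h1 t s (by rw [ht, inv_mul_cancel_right])).symm

theorem continuous_position (Γ S₀ : Set (E n)) : Continuous (position Γ S₀) := by
  refine continuous_quot_lift _ ?_
  have : DiscreteTopology (reflectionGroup Γ) := ⟨rfl⟩
  refine continuous_prod_of_discrete_left.2 fun s => ?_
  exact (s : E n ≃ᵃⁱ[ℝ] E n).continuous.comp continuous_subtype_val

/-- The complete surface is embedded exactly if the vertex condition holds. -/
theorem IsInitialSurface.generatesEmbedded_iff (h : IsInitialSurface Γ S₀) :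
    GeneratesEmbedded Γ S₀ ↔ VertexCondition Γ := by
  constructor
  -- If `s` fixes `v`, then the patches `1` and `s` have the same position at `v`. By injectivity
  -- they are glued there, so `s` lies in the edge group.
  · intro he v hv _ s hs hsv
    let x : S₀ := ⟨v, h.boundary_subset hv⟩
    have h1 : (Quot.mk _ (1, x) : AbstractSurface Γ S₀) = Quot.mk _ (⟨s, hs⟩, x) :=
      he.injective hsv.symm
    have h2 := (mem_stabilizerAt_of_eqvGen (Quot.eqvGen_exact h1)).2
    rw [mem_stabilizerAt] at h2
    simpa using h2
  · intro hv
    refine (IsClosedEmbedding.of_continuous_injective_isClosedMap (continuous_position Γ S₀)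
      ?_ ?_).isEmbedding
    · rintro ⟨s, x⟩ ⟨t, y⟩ hst
      obtain ⟨rfl, hk⟩ := (h.apply_eq_iff hv).1 hst
      exact mk_eq_of_mem_edgeGroup x (mem_stabilizerAt.1 hk) s t (by simp)
    -- The map is closed because a union of closed pieces, one in each patch, is locally finite.
    · intro C hC
      have h1 : IsClosed {q : reflectionGroup Γ × S₀ | (Quot.mk _ q : AbstractSurface Γ S₀) ∈ C} :=
        hC.preimage continuous_quot_mk
      have h2 : ∀ s : reflectionGroup Γ, IsClosed {x : S₀ |
          (Quot.mk _ (s, x) : AbstractSurface Γ S₀) ∈ C} := fun s =>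
        h1.preimage (Continuous.prodMk_right s)
      have h3 := isClosed_iUnion_patches (Γ := Γ) (fun s => Subtype.val '' {x : S₀ |
          (Quot.mk _ (s, x) : AbstractSurface Γ S₀) ∈ C})
        (fun s => by rintro _ ⟨x, -, rfl⟩; exact h.mem_cube x)
        (fun s => h.compact.isClosed.isClosedEmbedding_subtypeVal.isClosedMap _ (h2 s))
      convert h3 using 1
      ext z
      simp only [mem_image, mem_iUnion]
      constructor
      · rintro ⟨⟨s, x⟩, hq, rfl⟩
        exact ⟨s, x, ⟨x, hq, rfl⟩, rfl⟩
      · rintro ⟨s, _, ⟨x, hq, rfl⟩, rfl⟩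
        exact ⟨_, hq, rfl⟩

/-- The patch `s` in the complete surface. -/
def patch (Γ S₀ : Set (E n)) (s : reflectionGroup Γ) (x : S₀) : completeSurface Γ S₀ :=
  ⟨(s : E n ≃ᵃⁱ[ℝ] E n) x, mem_biUnion s.2 (mem_image_of_mem _ x.2)⟩

theorem exists_patch (z : completeSurface Γ S₀) : ∃ s x, patch Γ S₀ s x = z := by
  obtain ⟨z, hz⟩ := z
  obtain ⟨s, hs, x, hx, rfl⟩ := mem_iUnion₂.1 hz
  exact ⟨⟨s, hs⟩, ⟨x, hx⟩, rfl⟩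

theorem IsInitialSurface.isPatchSystem (h : IsInitialSurface Γ S₀) (hv : VertexCondition Γ) :
    IsPatchSystem (stabilizerAt Γ S₀) (patch Γ S₀) where
  continuous s := ((s : E n ≃ᵃⁱ[ℝ] E n).continuous.comp continuous_subtype_val).subtype_mk _
  surj := exists_patch
  eq_iff := by
    intro s t x y
    rw [← h.apply_eq_iff hv, Subtype.ext_iff]
    rfl
  closed F hF := by
    have h3 := isClosed_iUnion_patches (Γ := Γ) (fun s => Subtype.val '' F s)
        (fun s => by rintro _ ⟨x, -, rfl⟩; exact h.mem_cube x)
        (fun s => h.compact.isClosed.isClosedEmbedding_subtypeVal.isClosedMap _ (hF s))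
    convert h3.preimage continuous_subtype_val using 1
    ext z
    simp only [mem_iUnion, mem_image, mem_preimage]
    constructor
    · rintro ⟨s, x, hx, rfl⟩
      exact ⟨s, x, ⟨x, hx, rfl⟩, rfl⟩
    · rintro ⟨s, _, ⟨x, hx, rfl⟩, hz⟩
      exact ⟨s, x, hx, Subtype.ext hz⟩

end

/-! ### Boundary charts of the initial surface -/

section

/-! ### Charts at the boundary -/

/-- The half open box which serves as the range of the charts at boundary points. -/
def halfBox : Set ℂ := {z | 0 ≤ z.re ∧ z.re < 1 ∧ |z.im| < 1}

/-- A chart of the surface `Y` with boundary `B` at a boundary point. -/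
structure HalfChart {Y : Type*} [TopologicalSpace Y] (B : Set Y) where
  U : Set Y
  isOpen_U : IsOpen U
  ψ : Y → ℂ
  inv : ℂ → Y
  continuousOn_ψ : ContinuousOn ψ U
  continuousOn_inv : ContinuousOn inv halfBox
  mapsTo : ∀ u ∈ U, ψ u ∈ halfBox
  mapsTo_inv : ∀ z ∈ halfBox, inv z ∈ U
  left_inv : ∀ u ∈ U, inv (ψ u) = u
  right_inv : ∀ z ∈ halfBox, ψ (inv z) = z
  mem_iff : ∀ u ∈ U, u ∈ B ↔ (ψ u).re = 0

/-- Off the boundary, the domain of the chart is the continuous image of a convex open box. -/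
theorem HalfChart.isPreconnected {Y : Type*} [TopologicalSpace Y] {B : Set Y} (c : HalfChart B) :
    IsPreconnected (c.U \ B) := by
  have h : c.U \ B = c.inv '' {z | 0 < z.re ∧ z.re < 1 ∧ |z.im| < 1} := by
    ext u
    constructor
    · rintro ⟨hu, hB⟩
      have h1 := c.mapsTo u hu
      rw [c.mem_iff u hu] at hB
      exact ⟨c.ψ u, ⟨lt_of_le_of_ne h1.1 (Ne.symm hB), h1.2⟩, c.left_inv u hu⟩
    · rintro ⟨z, hz, rfl⟩
      have hz' : z ∈ halfBox := ⟨hz.1.le, hz.2⟩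
      refine ⟨c.mapsTo_inv z hz', ?_⟩
      rw [c.mem_iff _ (c.mapsTo_inv z hz'), c.right_inv z hz']
      exact hz.1.ne'
  rw [h]
  refine IsPreconnected.image (Convex.isPreconnected ?_) _
    (c.continuousOn_inv.mono fun z hz => ⟨hz.1.le, hz.2⟩)
  have h2 : {z : ℂ | 0 < z.re ∧ z.re < 1 ∧ |z.im| < 1} =
      Complex.reLm ⁻¹' Ioo 0 1 ∩ Complex.imLm ⁻¹' Ioo (-1) 1 := by
    ext z; simp [abs_lt, and_assoc]
  rw [h2]
  exact ((convex_Ioo 0 1).linear_preimage _).inter ((convex_Ioo (-1) 1).linear_preimage _)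

/-- Coordinates in the half plane. -/
def toHalfSpace (z : ℂ) : EuclideanHalfSpace 2 := ⟨!₂[max z.re 0, z.im], by simp⟩

theorem continuous_toHalfSpace : Continuous toHalfSpace := by
  refine Continuous.subtype_mk ?_ _
  refine (PiLp.continuous_toLp 2 _).comp (continuous_pi fun i => ?_)
  fin_cases i
  · exact Complex.continuous_re.max continuous_const
  · exact Complex.continuous_im

theorem toHalfSpace_zero (z : ℂ) : (toHalfSpace z).val 0 = max z.re 0 := rfl

theorem toHalfSpace_one (z : ℂ) : (toHalfSpace z).val 1 = z.im := rfl

variable {n : ℕ} {Γ S₀ : Set (E n)}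

/-- A given chart at `x` is translated along the boundary line so that `x` goes to `0`, and rescaled
by a small `ε` so that its range becomes `halfBox` and its domain lies in `W`. -/
theorem exists_halfChart (h : IsSurfaceWithBoundary S₀ Γ) {x : S₀} (hx : (x : E n) ∈ Γ) {W : Set S₀}
    (hW : IsOpen W) (hxW : x ∈ W) : ∃ c : HalfChart {y : S₀ | (y : E n) ∈ Γ}, x ∈ c.U ∧
      c.U ⊆ W ∧ c.ψ x = 0 := by
  obtain ⟨e, hxe, he⟩ := h x
  have h0 := (he x hxe).1 hx
  set t₀ := (e x).val 1 with ht₀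
  let J : ℂ → EuclideanHalfSpace 2 := fun z => toHalfSpace (z + ⟨0, t₀⟩)
  have hJ : Continuous J := continuous_toHalfSpace.comp (continuous_id.add continuous_const)
  have hJ0 : J 0 = e x := by
    apply Subtype.ext
    ext i
    fin_cases i
    · change max (0 + 0 : ℝ) 0 = (e x).val 0
      rw [h0]; simp
    · change (0 + t₀ : ℝ) = (e x).val 1
      rw [zero_add]
  have hT : IsOpen (e.target ∩ e.symm ⁻¹' W) := e.isOpen_inter_preimage_symm hW
  have hnhds : J ⁻¹' (e.target ∩ e.symm ⁻¹' W) ∈ 𝓝 (0 : ℂ) := by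
    refine (hT.preimage hJ).mem_nhds ?_
    rw [mem_preimage, hJ0]
    exact ⟨e.map_source hxe, by rw [mem_preimage, e.left_inv hxe]; exact hxW⟩
  obtain ⟨r, hr, hrT⟩ := Metric.mem_nhds_iff.1 hnhds
  -- Points of `halfBox` have norm below `2`, so `ε = r / 2` keeps `ε * z` in the ball of radius
  -- `r`.
  obtain ⟨ε, hε, hεr⟩ : ∃ ε : ℝ, 0 < ε ∧ 2 * ε = r := ⟨r / 2, by linarith, by ring⟩
  have hbox : ∀ z ∈ halfBox, J (ε * z) ∈ e.target ∩ e.symm ⁻¹' W := by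
    intro z hz
    apply hrT
    rw [mem_ball_zero_iff, norm_mul, Complex.norm_real, Real.norm_eq_abs, abs_of_pos hε, ← hεr,
      mul_comm]
    have := Complex.norm_le_abs_re_add_abs_im z
    rw [abs_of_nonneg hz.1] at this
    exact mul_lt_mul_of_pos_right (by linarith [hz.2.1, hz.2.2]) hε
  let ψ : S₀ → ℂ := fun u => ⟨(e u).val 0 / ε, ((e u).val 1 - t₀) / ε⟩
  have hcoord : ∀ i : Fin 2, ContinuousOn (fun u => (e u).val i) e.source := fun i =>
    ((EuclideanSpace.proj (𝕜 := ℝ) i).continuous.comp continuous_subtype_val).comp_continuousOn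
      e.continuousOn
  have hψ : ContinuousOn ψ e.source := by
    have h1 : ContinuousOn (fun u => (((e u).val 0 / ε : ℝ) : ℂ) +
        ((((e u).val 1 - t₀) / ε : ℝ) : ℂ) * Complex.I) e.source :=
      (Complex.continuous_ofReal.comp_continuousOn ((hcoord 0).div_const _)).add
        ((Complex.continuous_ofReal.comp_continuousOn
          (((hcoord 1).sub continuousOn_const).div_const _)).mul continuousOn_const)
    refine h1.congr fun u _ => ?_
    apply Complex.ext <;> simp [ψ]
  have hV : IsOpen {z : ℂ | z.re < 1 ∧ |z.im| < 1} :=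
    (isOpen_lt Complex.continuous_re continuous_const).inter
      (isOpen_lt Complex.continuous_im.abs continuous_const)
  have hJψ : ∀ u, J (ε * ψ u) = e u := by
    intro u
    apply Subtype.ext
    ext i
    fin_cases i
    · change max ((ε * ψ u).re + 0) 0 = (e u).val 0
      rw [Complex.re_ofReal_mul, add_zero, mul_div_cancel₀ _ hε.ne']
      exact max_eq_left (e u).2
    · change (ε * ψ u).im + t₀ = (e u).val 1
      rw [Complex.im_ofReal_mul, mul_div_cancel₀ _ hε.ne', sub_add_cancel]
  have hψJ : ∀ z ∈ halfBox, ∀ u, e u = J (ε * z) → ψ u = z := by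
    intro z hz u hu
    apply Complex.ext
    · change (e u).val 0 / ε = z.re
      rw [hu, toHalfSpace_zero, Complex.add_re, Complex.re_ofReal_mul]
      rw [add_zero, max_eq_left (mul_nonneg hε.le hz.1), mul_div_cancel_left₀ _ hε.ne']
    · change ((e u).val 1 - t₀) / ε = z.im
      rw [hu, toHalfSpace_one, Complex.add_im, Complex.im_ofReal_mul]
      rw [add_sub_cancel_right, mul_div_cancel_left₀ _ hε.ne']
  have hpos : ∀ u, 0 ≤ (ψ u).re := fun u => div_nonneg (e u).2 hε.le
  refine ⟨{
    U := (e.source ∩ W) ∩ ψ ⁻¹' {z : ℂ | z.re < 1 ∧ |z.im| < 1}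
    isOpen_U := (hψ.mono inter_subset_left).isOpen_inter_preimage (e.open_source.inter hW) hV
    ψ := ψ
    inv := fun z => e.symm (J (ε * z))
    continuousOn_ψ := hψ.mono fun u hu => hu.1.1
    continuousOn_inv := e.continuousOn_symm.comp
      (hJ.comp (continuous_const.mul continuous_id)).continuousOn fun z hz => (hbox z hz).1
    mapsTo := fun u hu => ⟨hpos u, hu.2⟩
    mapsTo_inv := fun z hz => ?_
    left_inv := fun u hu => ?_
    right_inv := fun z hz => hψJ z hz _ (e.right_inv (hbox z hz).1)
    mem_iff := fun u hu => ?_ }, ?_, ?_, ?_⟩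
  · refine ⟨⟨e.map_target (hbox z hz).1, (hbox z hz).2⟩, ?_⟩
    rw [mem_preimage, hψJ z hz _ (e.right_inv (hbox z hz).1)]
    exact hz.2
  · rw [hJψ, e.left_inv hu.1.1]
  · rw [mem_ofPred_eq, he u hu.1.1]
    change _ ↔ (e u).val 0 / ε = 0
    rw [div_eq_zero_iff, or_iff_left hε.ne']
  · have : ψ x = 0 := by
      apply Complex.ext
      · change (e x).val 0 / ε = 0
        rw [h0, zero_div]
      · change ((e x).val 1 - t₀) / ε = 0
        rw [← ht₀, sub_self, zero_div]
    exact ⟨⟨hxe, hxW⟩, by rw [mem_preimage, this]; simp⟩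
  · exact fun u hu => hu.1.2
  · apply Complex.ext
    · change (e x).val 0 / ε = 0
      rw [h0, zero_div]
    · change ((e x).val 1 - t₀) / ε = 0
      rw [← ht₀, sub_self, zero_div]

/-- Every neighbourhood of a boundary point contains a half chart, and the point with coordinate
`1/2` in this chart is off the boundary. -/
theorem IsInitialSurface.dense_interior (h : IsInitialSurface Γ S₀) :
    Dense {y : S₀ | (y : E n) ∉ Γ} := by
  intro x
  rw [mem_closure_iff]
  intro W hW hxW
  by_cases hx : (x : E n) ∈ Γ
  · obtain ⟨c, hxc, hcW, -⟩ := exists_halfChart h.surface hx hW hxW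
    have hz : (⟨1 / 2, 0⟩ : ℂ) ∈ halfBox := by
      refine ⟨?_, ?_, ?_⟩ <;> norm_num
    refine ⟨c.inv ⟨1 / 2, 0⟩, hcW (c.mapsTo_inv _ hz), fun hmem => ?_⟩
    have := (c.mem_iff _ (c.mapsTo_inv _ hz)).1 hmem
    rw [c.right_inv _ hz] at this
    norm_num at this
  · exact ⟨x, hxW, hx⟩

/-! ### Signs of charts on connected sets -/

/-- The chart of the part of the patch where a fold chart does not fold. -/
def FoldChart.interiorChart {Y G : Type*} [TopologicalSpace Y] [Group G] {K : Y → Subgroup G}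
    (c : FoldChart K) (D' : Set ℂ) (hD' : IsOpen D') (hD : D' ⊆ c.D) :
    OpenPartialHomeomorph Y ℂ where
  toFun := c.ψ
  invFun := c.inv
  source := c.U ∩ c.ψ ⁻¹' D'
  target := D' ∩ c.V
  map_source' u hu := ⟨hu.2, (c.mapsTo u hu.1).2⟩
  map_target' z hz := ⟨c.mapsTo_inv z ⟨hD hz.1, hz.2⟩, by
    rw [mem_preimage, c.right_inv z ⟨hD hz.1, hz.2⟩]; exact hz.1⟩
  left_inv' u hu := c.left_inv u hu.1
  right_inv' z hz := c.right_inv z ⟨hD hz.1, hz.2⟩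
  open_source := c.continuousOn_ψ.isOpen_inter_preimage c.isOpen_U hD'
  open_target := hD'.inter c.isOpen_V
  continuousOn_toFun := c.continuousOn_ψ.mono inter_subset_left
  continuousOn_invFun := c.continuousOn_inv.mono fun _ hz => ⟨hD hz.1, hz.2⟩

/-- A chart with connected domain has a constant sign with respect to an oriented atlas. -/
theorem exists_constant_sign {Y : Type*} [TopologicalSpace Y]
    {A : Set (OpenPartialHomeomorph Y ℂ)}
    (hA : ∀ e ∈ A, ∀ e' ∈ A, ∀ y ∈ e.source ∩ e'.source, HasSign e e' y 1)
    {f : OpenPartialHomeomorph Y ℂ} (hf : IsPreconnected f.source)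
    (hcov : ∀ u ∈ f.source, ∃ e ∈ A, u ∈ e.source) :
    ∃ d, ∀ e ∈ A, ∀ u ∈ e.source ∩ f.source, HasSign e f u d := by
  -- The sets of points of sign `1` and of sign `-1` are open and disjoint, and they cover the
  -- connected domain.
  let O : ℤ → Set Y := fun d => {u | ∃ e ∈ A, u ∈ e.source ∩ f.source ∧ HasSign e f u d}
  have hO : ∀ d, IsOpen (O d) := by
    intro d
    rw [isOpen_iff_mem_nhds]
    rintro u ⟨e, he, hu, hs⟩
    filter_upwards [hs.eventually hu.1 hu.2, e.open_source.mem_nhds hu.1,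
      f.open_source.mem_nhds hu.2] with w h1 h2 h3
    exact ⟨e, he, ⟨h2, h3⟩, h1⟩
  have hall : ∀ d, ∀ u ∈ O d, ∀ e ∈ A, u ∈ e.source ∩ f.source → HasSign e f u d := by
    rintro d u ⟨e', he', hu', hs⟩ e he hu
    simpa using (hA e he e' he' u ⟨hu.1, hu'.1⟩).trans hu.1 hu'.1 hu.2 hs
  have hdisj : Disjoint (O 1) (O (-1)) := by
    rw [Set.disjoint_left]
    intro u hu hu'
    obtain ⟨e, he, hue, hs⟩ := hu
    have := hs.unique (hall _ u hu' e he hue)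
    norm_num at this
  have hsub : f.source ⊆ O 1 ∪ O (-1) := by
    intro u hu
    obtain ⟨e, he, hue⟩ := hcov u hu
    rcases exists_hasSign hue hu with h | h
    · exact Or.inl ⟨e, he, ⟨hue, hu⟩, h⟩
    · exact Or.inr ⟨e, he, ⟨hue, hu⟩, h⟩
  rcases hf.subset_or_subset (hO _) (hO _) hdisj hsub with h | h
  · exact ⟨1, fun e he u hu => hall _ u (h hu.2) e he hu⟩
  · exact ⟨-1, fun e he u hu => hall _ u (h hu.2) e he hu⟩

/-- An orientable interior has an oriented atlas by charts of the surface with boundary. -/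
theorem exists_oriented_atlas (hc : IsClosed Γ) (ho : IsOrientableSurface ↥(S₀ \ Γ)) :
    ∃ A : Set (OpenPartialHomeomorph S₀ ℂ),
      (⋃ e ∈ A, e.source) = {y : S₀ | (y : E n) ∉ Γ} ∧
      ∀ e ∈ A, ∀ e' ∈ A, ∀ y ∈ e.source ∩ e'.source, HasSign e e' y 1 := by
  obtain ⟨-, -, A, hcov, hA⟩ := ho
  let ι : ↥(S₀ \ Γ) → S₀ := inclusion sdiff_subset
  have hι : IsOpenEmbedding ι := by
    refine ⟨IsEmbedding.inclusion _, ?_⟩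
    have : range ι = (Subtype.val : S₀ → E n) ⁻¹' Γᶜ := by
      ext y
      constructor
      · rintro ⟨z, rfl⟩; exact z.2.2
      · intro hy; exact ⟨⟨y, y.2, hy⟩, rfl⟩
    rw [this]
    exact hc.isOpen_compl.preimage continuous_subtype_val
  refine ⟨(fun e => e.lift_openEmbedding hι) '' A, ?_, ?_⟩
  · ext y
    simp only [mem_iUnion, mem_image, exists_prop]
    constructor
    · rintro ⟨_, ⟨e, -, rfl⟩, hy⟩
      obtain ⟨z, -, rfl⟩ := hy
      exact z.2.2
    · intro hy
      obtain ⟨e, he, hye⟩ := hcov ⟨y, y.2, hy⟩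
      exact ⟨_, ⟨e, he, rfl⟩, ⟨_, hye, rfl⟩⟩
  · rintro _ ⟨e, he, rfl⟩ _ ⟨e', he', rfl⟩ y ⟨hy, hy'⟩
    obtain ⟨z, hz, rfl⟩ := hy
    obtain ⟨z', hz', hzz⟩ := hy'
    obtain rfl := hι.injective hzz
    have h1 := (preservesOrientationAt_iff_hasSign hz hz').1 (hA e he e' he' z' ⟨hz, hz'⟩)
    refine h1.map hz ?_ ?_ ?_
    · filter_upwards [e.open_source.mem_nhds hz] with u hu using ⟨u, hu, rfl⟩
    · exact Eventually.of_forall fun u => e.lift_openEmbedding_apply hι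
    · exact Eventually.of_forall fun u => e'.lift_openEmbedding_apply hι

end

/-! ### The shape of the path in a boundary chart -/

section

variable {n : ℕ} {Γ S₀ : Set (E n)}

/-! ### The Jordan path near one of its points -/

/-- Near an inner point of an edge, the path consists of this edge. -/
theorem IsJordanPath.mem_edge (h : IsJordanPath Γ) {a u : E n} (ha : a ∈ cubeVertices n) {β : Fin n}
    (hu : u ∈ Γ) (huβ : |u β| < 1 / 2) (hpos : ∀ α, α ≠ β → 0 < a α * u α) :
    u ∈ segment ℝ a (flip β a) ∧ u ∉ cubeVertices n := by
  obtain ⟨c, hc, δ, -, hcu⟩ := h.exists_edge hu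
  obtain ⟨h1, h2⟩ := (mem_segment_flip_iff hc δ).1 hcu
  have hδ : δ = β := by
    by_contra hne
    rw [h1 β (Ne.symm hne), vertex_sq hc] at huβ
    exact lt_irrefl _ huβ
  subst hδ
  refine ⟨(mem_segment_flip_iff ha δ).2 ⟨fun α hα => ?_, h2⟩, fun hv => ?_⟩
  · have h3 := hpos α hα
    rw [h1 α hα] at h3 ⊢
    rcases vertex_eq_or ha hc α with h4 | h4
    · exact h4.symm
    · rw [h4] at h3
      nlinarith [mul_self_nonneg (c α)]
  · rw [vertex_sq hv] at huβ
    exact lt_irrefl _ huβ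

/-- Near a vertex, the path consists of two edges. -/
theorem IsJordanPath.mem_corner (h : IsJordanPath Γ) {v u : E n} {β δ : Fin n}
    (hc : IsCorner Γ v β δ) (hu : u ∈ Γ) (hpos : ∀ α, 0 < v α * u α) :
    u ∈ segment ℝ v (flip β v) ∨ u ∈ segment ℝ v (flip δ v) := by
  obtain ⟨c, hcv, η, hη, hcu⟩ := h.exists_edge hu
  obtain ⟨h1, -⟩ := (mem_segment_flip_iff hcv η).1 hcu
  have h2 : ∀ α, α ≠ η → c α = v α := by
    intro α hα
    have h3 := hpos α
    rw [h1 α hα] at h3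
    rcases vertex_eq_or hc.vertex hcv α with h4 | h4
    · exact h4.symm
    · rw [h4] at h3
      nlinarith [mul_self_nonneg (c α)]
  have h5 : c = v ∨ c = flip η v := by
    rcases vertex_eq_or hcv hc.vertex η with h6 | h6
    · left; ext α
      by_cases hα : α = η
      · rw [hα, h6]
      · exact h2 α hα
    · right; ext α
      by_cases hα : α = η
      · rw [hα, flip_apply_self, h6]
      · rw [flip_apply_of_ne hα, h2 α hα]
  have h6 : segment ℝ c (flip η c) = segment ℝ v (flip η v) := by
    rcases h5 with rfl | rfl
    · rfl
    · exact segment_flip_symm v η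
  rw [h6] at hη hcu
  rcases (hc.iff η).1 hη with rfl | rfl
  · exact Or.inl hcu
  · exact Or.inr hcu

/-- A point of an edge at `v` in the orthant of `v` other than `v`. -/
theorem not_vertex_of_pos {v u : E n} (hv : v ∈ cubeVertices n) {β : Fin n}
    (hu : u ∈ segment ℝ v (flip β v)) (hpos : ∀ α, 0 < v α * u α) (hne : u ≠ v) :
    u ∉ cubeVertices n := by
  intro huv
  rcases vertex_mem_segment hv huv hu with h | h
  · exact hne h
  · have := hpos β
    rw [h, flip_apply_self] at this
    nlinarith [mul_self_nonneg (v β)]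

/-- The signed distance to `v` along the two edges at `v` in the directions `β` and `δ`. -/
def cornerHeight (β δ : Fin n) (u : E n) : ℝ := |u δ| - |u β|

theorem cornerHeight_edge {v u : E n} (hv : v ∈ cubeVertices n) {β δ : Fin n} (hne : β ≠ δ)
    (hu : u ∈ segment ℝ v (flip β v)) : cornerHeight β δ u = 1 / 2 - |u β| ∧ |u β| ≤ 1 / 2 := by
  obtain ⟨h1, h2⟩ := (mem_segment_flip_iff hv β).1 hu
  exact ⟨by rw [cornerHeight, h1 δ hne.symm, vertex_sq hv], h2⟩

theorem cornerHeight_symm (β δ : Fin n) (u : E n) : cornerHeight δ β u = -cornerHeight β δ u := by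
  unfold cornerHeight; ring

theorem eq_of_edge {v u u' : E n} (hv : v ∈ cubeVertices n) {β : Fin n}
    (hu : u ∈ segment ℝ v (flip β v)) (hu' : u' ∈ segment ℝ v (flip β v))
    (hpos : ∀ α, 0 < v α * u α) (hpos' : ∀ α, 0 < v α * u' α) (h : |u β| = |u' β|) : u = u' := by
  obtain ⟨h1, -⟩ := (mem_segment_flip_iff hv β).1 hu
  obtain ⟨h2, -⟩ := (mem_segment_flip_iff hv β).1 hu'
  ext α
  by_cases hα : α = β
  · subst hα
    rcases abs_eq_abs.1 h with h3 | h3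
    · exact h3
    · have h4 := hpos α
      have h5 := hpos' α
      rw [h3] at h4
      linarith
  · rw [h1 α hα, h2 α hα]

/-- On one edge the height is `1/2 - |u β| ≥ 0`, on the other it is the negative of such a number,
and in the orthant of `v` the height determines the point on a given edge. Equal heights on
different edges occur only at `v`. -/
theorem cornerHeight_injOn (h : IsJordanPath Γ) {v : E n} {β δ : Fin n} (hc : IsCorner Γ v β δ) :
    InjOn (cornerHeight β δ) {u | u ∈ Γ ∧ ∀ α, 0 < v α * u α} := by
  have hvv : ∀ α, 0 < v α * v α := fun α =>
    mul_self_pos.2 (vertex_ne_zero hc.vertex α)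
  have key : ∀ {β δ : Fin n} (_ : IsCorner Γ v β δ) {u u' : E n}, (∀ α, 0 < v α * u α) →
      (∀ α, 0 < v α * u' α) → u ∈ segment ℝ v (flip β v) → u' ∈ segment ℝ v (flip δ v) →
      cornerHeight β δ u = cornerHeight β δ u' → u = u' := by
    intro β δ hc u u' hp hp' hu hu' he
    obtain ⟨h1, h2⟩ := cornerHeight_edge hc.vertex hc.ne hu
    obtain ⟨h3, h4⟩ := cornerHeight_edge hc.vertex hc.ne.symm hu'
    rw [cornerHeight_symm] at h3
    rw [eq_of_edge hc.vertex hu (left_mem_segment ℝ _ _) hp hvv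
        (by rw [vertex_sq hc.vertex]; linarith),
      eq_of_edge hc.vertex hu' (left_mem_segment ℝ _ _) hp' hvv
        (by rw [vertex_sq hc.vertex]; linarith)]
  rintro u ⟨huΓ, hp⟩ u' ⟨huΓ', hp'⟩ he
  rcases h.mem_corner hc huΓ hp with hu | hu <;> rcases h.mem_corner hc huΓ' hp' with hu' | hu'
  · refine eq_of_edge hc.vertex hu hu' hp hp' ?_
    linarith [(cornerHeight_edge hc.vertex hc.ne hu).1, (cornerHeight_edge hc.vertex hc.ne hu').1]
  · exact key hc hp hp' hu hu' he
  · exact key hc.symm hp hp' hu hu' (by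
      rw [cornerHeight_symm β δ, cornerHeight_symm β δ, he])
  · refine eq_of_edge hc.vertex hu hu' hp hp' ?_
    have h1 := (cornerHeight_edge hc.vertex hc.ne.symm hu).1
    have h2 := (cornerHeight_edge hc.vertex hc.ne.symm hu').1
    rw [cornerHeight_symm] at h1 h2
    linarith

theorem mem_edge_of_cornerHeight_pos (h : IsJordanPath Γ) {v u : E n} {β δ : Fin n}
    (hc : IsCorner Γ v β δ) (hu : u ∈ Γ) (hpos : ∀ α, 0 < v α * u α) (hh : 0 < cornerHeight β δ u) :
    u ∈ segment ℝ v (flip β v) := by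
  rcases h.mem_corner hc hu hpos with h1 | h1
  · exact h1
  · obtain ⟨h2, h3⟩ := cornerHeight_edge hc.vertex hc.ne.symm h1
    rw [cornerHeight_symm] at h2
    linarith

/-- In a chart at a vertex, the two edges are the two halves of the boundary line. -/
theorem exists_sides (h : IsJordanPath Γ) {x : S₀} {β δ : Fin n}
    (hc : IsCorner Γ (x : E n) β δ) (c : HalfChart {y : S₀ | (y : E n) ∈ Γ}) (hx : x ∈ c.U)
    (hx0 : c.ψ x = 0) (hpos : ∀ u ∈ c.U, ∀ α, 0 < (x : E n) α * (u : E n) α) :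
    ∃ η θ, IsCorner Γ (x : E n) η θ ∧ ∀ u ∈ c.U, (u : E n) ∈ Γ →
      (0 < (c.ψ u).im → (u : E n) ∈ segment ℝ (x : E n) (flip η x)) ∧
      ((c.ψ u).im < 0 → (u : E n) ∈ segment ℝ (x : E n) (flip θ x)) := by
  have hbox : ∀ t ∈ Ioo (-1 : ℝ) 1, (⟨0, t⟩ : ℂ) ∈ halfBox := fun t ht =>
    ⟨le_rfl, one_pos, abs_lt.2 ht⟩
  let κ : ℝ → S₀ := fun t => c.inv ⟨0, t⟩
  have hκU : ∀ t ∈ Ioo (-1 : ℝ) 1, κ t ∈ c.U := fun t ht => c.mapsTo_inv _ (hbox t ht)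
  have hκψ : ∀ t ∈ Ioo (-1 : ℝ) 1, c.ψ (κ t) = ⟨0, t⟩ := fun t ht => c.right_inv _ (hbox t ht)
  have hκΓ : ∀ t ∈ Ioo (-1 : ℝ) 1, (κ t : E n) ∈ Γ := fun t ht =>
    (c.mem_iff _ (hκU t ht)).2 (by rw [hκψ t ht])
  have hκ0 : κ 0 = x := by
    have : (⟨0, 0⟩ : ℂ) = c.ψ x := by rw [hx0]; rfl
    change c.inv ⟨0, 0⟩ = x
    rw [this, c.left_inv x hx]
  let g : ℝ → ℝ := fun t => cornerHeight β δ (κ t : E n)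
  have hline : Continuous fun t : ℝ => (⟨0, t⟩ : ℂ) := by
    have h1 : Continuous fun t : ℝ => (t : ℂ) * Complex.I := by fun_prop
    refine h1.congr fun t => ?_
    apply Complex.ext <;> simp
  have hcont : Continuous (cornerHeight β δ) :=
    ((EuclideanSpace.proj (𝕜 := ℝ) δ).continuous.abs).sub
      ((EuclideanSpace.proj (𝕜 := ℝ) β).continuous.abs)
  have hg : ContinuousOn g (Ioo (-1) 1) :=
    (hcont.comp continuous_subtype_val).comp_continuousOn
      (c.continuousOn_inv.comp hline.continuousOn hbox)
  have hgi : InjOn g (Ioo (-1) 1) := by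
    intro s hs t ht hst
    have h1 := cornerHeight_injOn h hc ⟨hκΓ s hs, hpos _ (hκU s hs)⟩ ⟨hκΓ t ht, hpos _ (hκU t ht)⟩ hst
    have h2 := congrArg c.ψ (Subtype.ext h1)
    rw [hκψ s hs, hκψ t ht] at h2
    exact congrArg Complex.im h2
  have hg0 : g 0 = 0 := by
    change cornerHeight β δ (κ 0 : E n) = 0
    rw [hκ0, cornerHeight, vertex_sq hc.vertex, vertex_sq hc.vertex, sub_self]
  have h0 : (0 : ℝ) ∈ Ioo (-1 : ℝ) 1 := by norm_num
  have him : ∀ u ∈ c.U, (u : E n) ∈ Γ → (c.ψ u).im ∈ Ioo (-1 : ℝ) 1 ∧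
      cornerHeight β δ u = g (c.ψ u).im := by
    intro u hu huΓ
    refine ⟨abs_lt.1 (c.mapsTo u hu).2.2, ?_⟩
    have h1 : (⟨0, (c.ψ u).im⟩ : ℂ) = c.ψ u :=
      Complex.ext ((c.mem_iff u hu).1 huΓ).symm rfl
    change _ = cornerHeight β δ (c.inv ⟨0, (c.ψ u).im⟩ : E n)
    rw [h1, c.left_inv u hu]
  -- An injective continuous function on an interval is strictly monotone, so the height changes
  -- sign exactly at `0`. In the decreasing case the two edges exchange their roles.
  rcases hg.strictMonoOn_of_injOn_Ioo (by norm_num) hgi with hm | hm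
  · refine ⟨β, δ, hc, fun u hu huΓ => ⟨fun hp => ?_, fun hp => ?_⟩⟩
    · obtain ⟨h1, h2⟩ := him u hu huΓ
      refine mem_edge_of_cornerHeight_pos h hc huΓ (hpos u hu) ?_
      rw [h2, ← hg0]
      exact hm h0 h1 hp
    · obtain ⟨h1, h2⟩ := him u hu huΓ
      refine mem_edge_of_cornerHeight_pos h hc.symm huΓ (hpos u hu) ?_
      rw [cornerHeight_symm, h2, Left.neg_pos_iff, ← hg0]
      exact hm h1 h0 hp
  · refine ⟨δ, β, hc.symm, fun u hu huΓ => ⟨fun hp => ?_, fun hp => ?_⟩⟩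
    · obtain ⟨h1, h2⟩ := him u hu huΓ
      refine mem_edge_of_cornerHeight_pos h hc.symm huΓ (hpos u hu) ?_
      rw [cornerHeight_symm, h2, Left.neg_pos_iff, ← hg0]
      exact hm h0 h1 hp
    · obtain ⟨h1, h2⟩ := him u hu huΓ
      refine mem_edge_of_cornerHeight_pos h hc huΓ (hpos u hu) ?_
      rw [h2, ← hg0]
      exact hm h1 h0 hp

/-! ### The half plane and the quarter plane -/

/-- The map of the half plane to the quarter plane. -/
def bend (z : ℂ) : ℂ := ⟨z.re + max z.im 0, z.re + max (-z.im) 0⟩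

/-- The map of the quarter plane to the half plane. -/
def unbend (z : ℂ) : ℂ := ⟨min z.re z.im, z.re - z.im⟩

theorem continuous_complex_mk {A : Type*} [TopologicalSpace A] {f g : A → ℝ} (hf : Continuous f)
    (hg : Continuous g) : Continuous fun a => (⟨f a, g a⟩ : ℂ) := by
  have h : Continuous fun a => (f a : ℂ) + (g a : ℂ) * Complex.I := by fun_prop
  refine h.congr fun a => ?_
  apply Complex.ext <;> simp

theorem continuous_bend : Continuous bend :=
  continuous_complex_mk (by fun_prop) (by fun_prop)

theorem continuous_unbend : Continuous unbend :=
  continuous_complex_mk (by fun_prop) (by fun_prop)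

theorem unbend_bend (z : ℂ) : unbend (bend z) = z := by
  apply Complex.ext
  · change min (z.re + max z.im 0) (z.re + max (-z.im) 0) = z.re
    rcases le_total 0 z.im with h | h
    · rw [max_eq_left h, max_eq_right (by linarith), min_eq_right (by linarith), add_zero]
    · rw [max_eq_right h, max_eq_left (by linarith), min_eq_left (by linarith), add_zero]
  · change z.re + max z.im 0 - (z.re + max (-z.im) 0) = z.im
    rcases le_total 0 z.im with h | h
    · rw [max_eq_left h, max_eq_right (by linarith)]; ring
    · rw [max_eq_right h, max_eq_left (by linarith)]; ring

theorem bend_unbend (z : ℂ) : bend (unbend z) = z := by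
  apply Complex.ext
  · change min z.re z.im + max (z.re - z.im) 0 = z.re
    rcases le_total z.re z.im with h | h
    · rw [min_eq_left h, max_eq_right (by linarith), add_zero]
    · rw [min_eq_right h, max_eq_left (by linarith)]; ring
  · change min z.re z.im + max (-(z.re - z.im)) 0 = z.im
    rcases le_total z.re z.im with h | h
    · rw [min_eq_left h, max_eq_left (by linarith)]; ring
    · rw [min_eq_right h, max_eq_right (by linarith), add_zero]

end

/-! ### Unfolding at edges and corners, and orientability -/

section

/-! ### Folding at the edges -/

section

variable {n : ℕ} {Γ S₀ : Set (E n)}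

theorem signs_edgeReflection {s : reflectionGroup Γ} {a : E n} (ha : a ∈ cubeVertices n)
    {β : Fin n} (hs : (s : E n ≃ᵃⁱ[ℝ] E n) = edgeReflection a β) (α : Fin n) :
    signs Γ s α = if α = β then 1 else -1 := by
  obtain ⟨m, hm, h0, h1⟩ := isCell_schwarz ha β
  rw [signs_apply s (show IsCell (s : E n ≃ᵃⁱ[ℝ] E n) m by rw [hs]; exact hm)]
  split_ifs with h
  · rw [h, h0, Int.negOnePow_zero]
  · exact Int.negOnePow_odd _ (h1 α h).2

variable {G : Type*} [Group G] (φ : reflectionGroup Γ →* G)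

/-- The stabilizers of the points of `S₀` in a quotient of the reflection group. -/
def stabilizerMap (S₀ : Set (E n)) (x : S₀) : Subgroup G := (stabilizerAt Γ S₀ x).map φ

variable {φ}

theorem stabilizerMap_eq_bot {x : S₀} (hx : (x : E n) ∉ Γ) : stabilizerMap φ S₀ x = ⊥ := by
  rw [stabilizerMap, stabilizerAt, edgeGroup_eq_bot hx, Subgroup.bot_subgroupOf, Subgroup.map_bot]

theorem mem_stabilizerMap_of_mem {x : S₀} {s : reflectionGroup Γ} {a : E n}
    (ha : a ∈ cubeVertices n) {β : Fin n} (hs : (s : E n ≃ᵃⁱ[ℝ] E n) = edgeReflection a β)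
    (hΓ : segment ℝ a (flip β a) ⊆ Γ) (hx : (x : E n) ∈ segment ℝ a (flip β a)) :
    φ s ∈ stabilizerMap φ S₀ x := by
  refine Subgroup.mem_map_of_mem _ (mem_stabilizerAt.2 ?_)
  rw [hs]
  exact Subgroup.subset_closure ⟨a, flip β a, isCubeEdge_flip ha β, hΓ, hx, rfl⟩

theorem mem_stabilizerMap_inner {x : S₀} {s : reflectionGroup Γ} {a : E n}
    (ha : a ∈ cubeVertices n) {β : Fin n} (hs : (s : E n ≃ᵃⁱ[ℝ] E n) = edgeReflection a β)
    (hΓ : segment ℝ a (flip β a) ⊆ Γ) (hx : (x : E n) ∈ segment ℝ a (flip β a))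
    (hxv : (x : E n) ∉ cubeVertices n) {k : G} :
    k ∈ stabilizerMap φ S₀ x ↔ k = 1 ∨ k = φ s := by
  constructor
  · rintro ⟨t, ht, rfl⟩
    rcases (mem_edgeGroup_inner ha hΓ hx hxv).1 (mem_stabilizerAt.1 ht) with h | h
    · exact Or.inl (by rw [show t = 1 from Subtype.ext h, map_one])
    · exact Or.inr (by rw [show t = s from Subtype.ext (h.trans hs.symm)])
  · rintro (rfl | rfl)
    · exact one_mem _
    · exact mem_stabilizerMap_of_mem ha hs hΓ hx

theorem mem_stabilizerMap_corner {x : S₀} {s t : reflectionGroup Γ} {β δ : Fin n}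
    (hc : IsCorner Γ (x : E n) β δ) (hs : (s : E n ≃ᵃⁱ[ℝ] E n) = edgeReflection (x : E n) β)
    (ht : (t : E n ≃ᵃⁱ[ℝ] E n) = edgeReflection (x : E n) δ) {k : G} :
    k ∈ stabilizerMap φ S₀ x ↔ k = 1 ∨ k = φ s ∨ k = φ t ∨ k = φ s * φ t := by
  constructor
  · rintro ⟨r, hr, rfl⟩
    rcases (mem_edgeGroup_corner hc).1 (mem_stabilizerAt.1 hr) with h | h | h | h
    · exact Or.inl (by rw [show r = 1 from Subtype.ext h, map_one])
    · exact Or.inr (Or.inl (by rw [show r = s from Subtype.ext (h.trans hs.symm)]))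
    · exact Or.inr (Or.inr (Or.inl (by rw [show r = t from Subtype.ext (h.trans ht.symm)])))
    · refine Or.inr (Or.inr (Or.inr ?_))
      rw [← map_mul, show r = s * t from Subtype.ext (by rw [h, Subgroup.coe_mul, hs, ht])]
  · have h1 : φ s ∈ stabilizerMap φ S₀ x := mem_stabilizerMap_of_mem hc.vertex hs
      ((hc.iff β).2 (Or.inl rfl)) (left_mem_segment ℝ _ _)
    have h2 : φ t ∈ stabilizerMap φ S₀ x := mem_stabilizerMap_of_mem hc.vertex ht
      ((hc.iff δ).2 (Or.inr rfl)) (left_mem_segment ℝ _ _)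
    rintro (rfl | rfl | rfl | rfl)
    · exact one_mem _
    · exact h1
    · exact h2
    · exact mul_mem h1 h2

theorem isOpen_val_preimage_coord {p : ℝ → Prop} (hp : IsOpen {t | p t}) (α : Fin n) :
    IsOpen {u : S₀ | p ((u : E n) α)} :=
  hp.preimage ((EuclideanSpace.proj (𝕜 := ℝ) α).continuous.comp continuous_subtype_val)

/-- A chart at a boundary point of a patch which is adapted to the reflections: it unfolds to a
chart of the complete surface. -/
structure AdaptedChart (φ : reflectionGroup Γ →* G) (χ : G →* ℤˣ) (x : S₀) where
  chart : FoldChart (stabilizerMap φ S₀)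
  mem : x ∈ chart.U
  character : ∀ k ∈ chart.group, χ k = chart.a k * chart.b k
  D' : Set ℂ
  isOpen_D' : IsOpen D'
  subset : D' ⊆ chart.D
  mem_iff : ∀ u ∈ chart.U, chart.ψ u ∈ D' ↔ (u : E n) ∉ Γ
  preconnected : IsPreconnected (chart.U \ {u | (u : E n) ∈ Γ})

end

variable {Γ S₀ : Set (E 4)} {G : Type*} [Group G] {φ : reflectionGroup Γ →* G}
  {σ : G →* (Fin 4 → ℤˣ)}

/-- The sign of the `α`-coordinate. -/
def coordSign (σ : G →* (Fin 4 → ℤˣ)) (α : Fin 4) : G →* ℤˣ :=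
  (Pi.evalMonoidHom (fun _ : Fin 4 => ℤˣ) α).comp σ

/-- The determinant. -/
def totalSign (σ : G →* (Fin 4 → ℤˣ)) : G →* ℤˣ := ∏ α, coordSign σ α

theorem coordSign_apply {s : reflectionGroup Γ} (hσ : ∀ s, σ (φ s) = signs Γ s) {a : E 4}
    (ha : a ∈ cubeVertices 4) {β : Fin 4} (hs : (s : E 4 ≃ᵃⁱ[ℝ] E 4) = edgeReflection a β)
    (α : Fin 4) : coordSign σ α (φ s) = if α = β then 1 else -1 := by
  rw [← signs_edgeReflection ha hs, ← hσ]; rfl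

/-- A half-turn in dimension four reverses three coordinates, so its determinant is `-1`, which
matches the orientation reversal of a fold across an edge. -/
theorem totalSign_apply {s : reflectionGroup Γ} (hσ : ∀ s, σ (φ s) = signs Γ s) {a : E 4}
    (ha : a ∈ cubeVertices 4) {β : Fin 4} (hs : (s : E 4 ≃ᵃⁱ[ℝ] E 4) = edgeReflection a β) :
    totalSign σ (φ s) = -1 := by
  rw [totalSign, MonoidHom.finsetProd_apply]
  rw [Finset.prod_congr rfl fun α _ => coordSign_apply hσ ha hs α]
  clear hs
  revert β
  decide

/-- At an inner point of an edge two patches meet, and `re ↦ -re` unfolds a half chart to a full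
chart. The character which realizes this fold is the sign of any coordinate `η ≠ β`, since the
half-turn reverses it. -/
theorem exists_adaptedChart_edge (h : IsInitialSurface Γ S₀) (hσ : ∀ s, σ (φ s) = signs Γ s) {x : S₀}
    (hx : (x : E 4) ∈ Γ) (hxv : (x : E 4) ∉ cubeVertices 4) :
    Nonempty (AdaptedChart φ (totalSign σ) x) := by
  obtain ⟨a, ha, β, hΓ, hxa⟩ := h.jordan.exists_edge hx
  obtain ⟨h1, h2⟩ := (mem_segment_flip_iff ha β).1 hxa
  let s : reflectionGroup Γ := ⟨edgeReflection a β, edgeReflection_mem_reflectionGroup ha hΓ⟩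
  have hs : (s : E 4 ≃ᵃⁱ[ℝ] E 4) = edgeReflection a β := rfl
  -- In this neighbourhood the path consists only of inner points of the edge through `x`.
  let W : Set S₀ := {u | |(u : E 4) β| < 1 / 2} ∩ ⋂ α, ⋂ _ : α ≠ β, {u : S₀ | 0 < a α * (u : E 4) α}
  have hW : IsOpen W := by
    refine (isOpen_val_preimage_coord (p := fun t => |t| < 1 / 2)
      (isOpen_lt continuous_abs continuous_const) β).inter
      (isOpen_iInter_of_finite fun α => isOpen_iInter_of_finite fun _ =>
        isOpen_val_preimage_coord (p := fun t => 0 < a α * t)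
          (isOpen_lt continuous_const (continuous_const.mul continuous_id)) α)
  have hxW : x ∈ W := by
    refine ⟨lt_of_le_of_ne h2 fun h3 => hxv fun α => ?_, mem_iInter₂.2 fun α hα => ?_⟩
    · by_cases hα : α = β
      · rw [hα]
        rcases eq_or_eq_neg_of_abs_eq h3 with h4 | h4
        · exact Or.inr h4
        · exact Or.inl h4
      · rw [h1 α hα]; exact ha α
    · change 0 < a α * (x : E 4) α
      rw [h1 α hα]
      exact mul_self_pos.2 (vertex_ne_zero ha α)
  obtain ⟨c, hxc, hcW, -⟩ := exists_halfChart h.surface hx hW hxW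
  have hedge : ∀ u ∈ c.U, (u : E 4) ∈ Γ →
      (u : E 4) ∈ segment ℝ a (flip β a) ∧ (u : E 4) ∉ cubeVertices 4 := fun u hu huΓ =>
    h.jordan.mem_edge ha huΓ (hcW hu).1 fun α hα => mem_iInter₂.1 (hcW hu).2 α hα
  have hgroup : ∀ k : G, k ∈ stabilizerMap φ S₀ x ↔ k = 1 ∨ k = φ s := fun k =>
    mem_stabilizerMap_inner ha hs hΓ hxa hxv
  obtain ⟨η, hη⟩ : ∃ η, η ≠ β := exists_ne β
  have hsη : coordSign σ η (φ s) = -1 := by rw [coordSign_apply hσ ha hs, if_neg hη]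
  have hbox : {z : ℂ | 0 ≤ z.re} ∩ {z | z.re < 1 ∧ |z.im| < 1} = halfBox := rfl
  refine ⟨{
    chart := {
      U := c.U
      isOpen_U := c.isOpen_U
      group := stabilizerMap φ S₀ x
      finite_group := ?_
      le_group := ?_
      D := {z | 0 ≤ z.re}
      isClosed_D := isClosed_le continuous_const Complex.continuous_re
      V := {z | z.re < 1 ∧ |z.im| < 1}
      isOpen_V := (isOpen_lt Complex.continuous_re continuous_const).inter
        (isOpen_lt Complex.continuous_im.abs continuous_const)
      ψ := c.ψ
      inv := c.inv
      continuousOn_ψ := c.continuousOn_ψ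
      continuousOn_inv := c.continuousOn_inv
      mapsTo := c.mapsTo
      mapsTo_inv := c.mapsTo_inv
      left_inv := c.left_inv
      right_inv := c.right_inv
      a := coordSign σ η
      b := 1
      exists_mem_D := ?_
      mem_K := ?_
      fixed := ?_ }
    mem := hxc
    character := ?_
    D' := {z | 0 < z.re}
    isOpen_D' := isOpen_lt continuous_const Complex.continuous_re
    subset := fun z (hz : 0 < z.re) => hz.le
    mem_iff := ?_
    preconnected := c.isPreconnected }⟩
  · refine Set.Finite.subset (Set.toFinite {1, φ s}) fun k hk => ?_
    exact (hgroup k).1 hk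
  · intro u hu k hk
    by_cases huΓ : (u : E 4) ∈ Γ
    · obtain ⟨h3, h4⟩ := hedge u hu huΓ
      exact (hgroup k).2 ((mem_stabilizerMap_inner ha hs hΓ h3 h4).1 hk)
    · rw [stabilizerMap_eq_bot huΓ] at hk
      rw [Subgroup.mem_bot.1 hk]; exact one_mem _
  · intro z
    rcases le_total 0 z.re with hz | hz
    · exact ⟨1, one_mem _, by simpa using hz⟩
    · exact ⟨φ s, (hgroup _).2 (Or.inr rfl), by simp [hsη, hz]⟩
  · intro u hu k hk hkD
    rcases (hgroup k).1 hk with rfl | rfl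
    · exact one_mem _
    · have h3 : (c.ψ u).re = 0 := by
        have h4 := (c.mapsTo u hu).1
        simp [hsη] at hkD
        exact le_antisymm hkD h4
      exact mem_stabilizerMap_of_mem ha hs hΓ (hedge u hu ((c.mem_iff u hu).2 h3)).1
  · intro u hu k hk
    by_cases huΓ : (u : E 4) ∈ Γ
    · obtain ⟨h3, h4⟩ := hedge u hu huΓ
      rcases (mem_stabilizerMap_inner ha hs hΓ h3 h4).1 hk with rfl | rfl
      · simp
      · have h5 := (c.mem_iff u hu).1 huΓ
        apply Complex.ext <;> simp [h5]
    · rw [stabilizerMap_eq_bot huΓ] at hk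
      rw [Subgroup.mem_bot.1 hk]; simp
  · intro k hk
    rcases (hgroup k).1 hk with rfl | rfl
    · simp
    · rw [totalSign_apply hσ ha hs]
      simp [hsη]
  · intro u hu
    have h3 := c.mem_iff u hu
    have h4 := (c.mapsTo u hu).1
    change 0 < (c.ψ u).re ↔ ¬ _
    rw [show ((u : E 4) ∈ Γ ↔ _) from h3]
    exact ⟨fun h => h.ne', fun h => lt_of_le_of_ne h4 (Ne.symm h)⟩

theorem bend_mem_iff (z : ℂ) : bend z ∈ {z : ℂ | 0 ≤ z.re ∧ 0 ≤ z.im} ↔ 0 ≤ z.re := by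
  change (0 ≤ z.re + max z.im 0 ∧ 0 ≤ z.re + max (-z.im) 0) ↔ _
  rcases le_total 0 z.im with h | h
  · rw [max_eq_left h, max_eq_right (by linarith)]
    exact ⟨fun h' => by linarith [h'.2], fun h' => ⟨by linarith, by linarith⟩⟩
  · rw [max_eq_right h, max_eq_left (by linarith)]
    exact ⟨fun h' => by linarith [h'.1], fun h' => ⟨by linarith, by linarith⟩⟩

theorem bend_mem_interior_iff (z : ℂ) : bend z ∈ {z : ℂ | 0 < z.re ∧ 0 < z.im} ↔ 0 < z.re := by
  change (0 < z.re + max z.im 0 ∧ 0 < z.re + max (-z.im) 0) ↔ _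
  rcases le_total 0 z.im with h | h
  · rw [max_eq_left h, max_eq_right (by linarith)]
    exact ⟨fun h' => by linarith [h'.2], fun h' => ⟨by linarith, by linarith⟩⟩
  · rw [max_eq_right h, max_eq_left (by linarith)]
    exact ⟨fun h' => by linarith [h'.1], fun h' => ⟨by linarith, by linarith⟩⟩

theorem bend_re_eq_zero {z : ℂ} (hz : 0 ≤ z.re) : (bend z).re = 0 ↔ z.re = 0 ∧ z.im ≤ 0 := by
  change z.re + max z.im 0 = 0 ↔ _
  rw [add_eq_zero_iff_of_nonneg hz (le_max_right _ _), max_eq_right_iff]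

theorem bend_im_eq_zero {z : ℂ} (hz : 0 ≤ z.re) : (bend z).im = 0 ↔ z.re = 0 ∧ 0 ≤ z.im := by
  change z.re + max (-z.im) 0 = 0 ↔ _
  rw [add_eq_zero_iff_of_nonneg hz (le_max_right _ _), max_eq_right_iff, neg_nonpos]

/-- At a corner four patches meet. The map `bend` turns a half chart into a quadrant chart, with the
edge in direction `β` on the real axis and the edge in direction `δ` on the imaginary axis. The
half-turn about the `β`-edge keeps the sign of `β` and reverses that of `δ`, so these two signs act
exactly as the reflections in the sides of the quadrant. -/
theorem exists_adaptedChart_corner (h : IsInitialSurface Γ S₀) (hσ : ∀ s, σ (φ s) = signs Γ s)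
    {x : S₀} (hx : (x : E 4) ∈ Γ) (hxv : (x : E 4) ∈ cubeVertices 4) :
    Nonempty (AdaptedChart φ (totalSign σ) x) := by
  obtain ⟨β₀, δ₀, hc₀⟩ := h.jordan.exists_isCorner hx hxv
  let W : Set S₀ := ⋂ α, {u : S₀ | 0 < (x : E 4) α * (u : E 4) α}
  have hW : IsOpen W := isOpen_iInter_of_finite fun α =>
    isOpen_val_preimage_coord (p := fun t => 0 < (x : E 4) α * t)
      (isOpen_lt continuous_const (continuous_const.mul continuous_id)) α
  have hxW : x ∈ W := mem_iInter.2 fun α => mul_self_pos.2 (vertex_ne_zero hxv α)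
  obtain ⟨c, hxc, hcW, hcx⟩ := exists_halfChart h.surface hx hW hxW
  have hpos : ∀ u ∈ c.U, ∀ α, 0 < (x : E 4) α * (u : E 4) α := fun u hu α =>
    mem_iInter.1 (hcW hu) α
  obtain ⟨β, δ, hc, hside⟩ := exists_sides h.jordan hc₀ c hxc hcx hpos
  have hΓβ := (hc.iff β).2 (Or.inl rfl)
  have hΓδ := (hc.iff δ).2 (Or.inr rfl)
  let s : reflectionGroup Γ :=
    ⟨edgeReflection (x : E 4) β, edgeReflection_mem_reflectionGroup hxv hΓβ⟩
  let t : reflectionGroup Γ :=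
    ⟨edgeReflection (x : E 4) δ, edgeReflection_mem_reflectionGroup hxv hΓδ⟩
  have hs : (s : E 4 ≃ᵃⁱ[ℝ] E 4) = edgeReflection (x : E 4) β := rfl
  have ht : (t : E 4 ≃ᵃⁱ[ℝ] E 4) = edgeReflection (x : E 4) δ := rfl
  have hgroup : ∀ k : G, k ∈ stabilizerMap φ S₀ x ↔ k = 1 ∨ k = φ s ∨ k = φ t ∨ k = φ s * φ t :=
    fun k => mem_stabilizerMap_corner hc hs ht
  have hsβ : coordSign σ β (φ s) = 1 := by rw [coordSign_apply hσ hxv hs, if_pos rfl]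
  have hsδ : coordSign σ δ (φ s) = -1 := by rw [coordSign_apply hσ hxv hs, if_neg hc.ne.symm]
  have htβ : coordSign σ β (φ t) = -1 := by rw [coordSign_apply hσ hxv ht, if_neg hc.ne]
  have htδ : coordSign σ δ (φ t) = 1 := by rw [coordSign_apply hσ hxv ht, if_pos rfl]
  have hχs : totalSign σ (φ s) = -1 := totalSign_apply hσ hxv hs
  have hχt : totalSign σ (φ t) = -1 := totalSign_apply hσ hxv ht
  have hψx : ∀ u ∈ c.U, c.ψ u = 0 → u = x := fun u hu h0 => by
    rw [← c.left_inv u hu, h0, ← hcx, c.left_inv x hxc]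
  have hβ : ∀ u ∈ c.U, (bend (c.ψ u)).im = 0 → (u : E 4) ∈ segment ℝ (x : E 4) (flip β x) := by
    intro u hu h0
    obtain ⟨h1, h2⟩ := (bend_im_eq_zero (c.mapsTo u hu).1).1 h0
    rcases h2.eq_or_lt with h3 | h3
    · rw [hψx u hu (Complex.ext h1 h3.symm)]
      exact left_mem_segment ℝ _ _
    · exact (hside u hu ((c.mem_iff u hu).2 h1)).1 h3
  have hδ : ∀ u ∈ c.U, (bend (c.ψ u)).re = 0 → (u : E 4) ∈ segment ℝ (x : E 4) (flip δ x) := by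
    intro u hu h0
    obtain ⟨h1, h2⟩ := (bend_re_eq_zero (c.mapsTo u hu).1).1 h0
    rcases h2.eq_or_lt with h3 | h3
    · rw [hψx u hu (Complex.ext h1 h3)]
      exact left_mem_segment ℝ _ _
    · exact (hside u hu ((c.mem_iff u hu).2 h1)).2 h3
  -- the possible positions of a point of the chart
  have hcases : ∀ u ∈ c.U, (u : E 4) ∉ Γ ∨ u = x ∨
      ((bend (c.ψ u)).im = 0 ∧ (u : E 4) ∉ cubeVertices 4) ∨
      ((bend (c.ψ u)).re = 0 ∧ (u : E 4) ∉ cubeVertices 4) := by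
    intro u hu
    by_cases huΓ : (u : E 4) ∈ Γ
    · by_cases hux : u = x
      · exact Or.inr (Or.inl hux)
      · have h0 := (c.mem_iff u hu).1 huΓ
        have hux' : (u : E 4) ≠ x := fun h => hux (Subtype.ext h)
        rcases le_total 0 (c.ψ u).im with h1 | h1
        · have h2 := (bend_im_eq_zero (c.mapsTo u hu).1).2 ⟨h0, h1⟩
          exact Or.inr (Or.inr (Or.inl
            ⟨h2, not_vertex_of_pos hxv (hβ u hu h2) (hpos u hu) hux'⟩))
        · have h2 := (bend_re_eq_zero (c.mapsTo u hu).1).2 ⟨h0, h1⟩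
          exact Or.inr (Or.inr (Or.inr
            ⟨h2, not_vertex_of_pos hxv (hδ u hu h2) (hpos u hu) hux'⟩))
    · exact Or.inl huΓ
  -- The other two coordinates are reversed together at a corner, so the determinant is the product
  -- of the signs of `β` and `δ`.
  have hchar : ∀ k ∈ stabilizerMap φ S₀ x,
      totalSign σ k = coordSign σ β k * coordSign σ δ k := by
    intro k hk
    rcases (hgroup k).1 hk with rfl | rfl | rfl | rfl
    · rw [map_one, map_one, map_one, one_mul]
    · rw [hχs, hsβ, hsδ, one_mul]
    · rw [hχt, htβ, htδ, mul_one]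
    · rw [map_mul, map_mul, map_mul, hχs, hχt, hsβ, hsδ, htβ, htδ, one_mul, mul_one]
  have hDV : ∀ z, z ∈ {z : ℂ | 0 ≤ z.re ∧ 0 ≤ z.im} ∩ unbend ⁻¹' {z | z.re < 1 ∧ |z.im| < 1} ↔
      unbend z ∈ halfBox := by
    intro z
    have := bend_mem_iff (unbend z)
    rw [bend_unbend] at this
    exact and_congr_left' this
  refine ⟨{
    chart := {
      U := c.U
      isOpen_U := c.isOpen_U
      group := stabilizerMap φ S₀ x
      finite_group := ?_
      le_group := ?_
      D := {z | 0 ≤ z.re ∧ 0 ≤ z.im}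
      isClosed_D := (isClosed_le continuous_const Complex.continuous_re).inter
        (isClosed_le continuous_const Complex.continuous_im)
      V := unbend ⁻¹' {z | z.re < 1 ∧ |z.im| < 1}
      isOpen_V := ((isOpen_lt Complex.continuous_re continuous_const).inter
        (isOpen_lt Complex.continuous_im.abs continuous_const)).preimage continuous_unbend
      ψ := fun u => bend (c.ψ u)
      inv := fun z => c.inv (unbend z)
      continuousOn_ψ := continuous_bend.comp_continuousOn c.continuousOn_ψ
      continuousOn_inv := c.continuousOn_inv.comp continuous_unbend.continuousOn
        fun z hz => (hDV z).1 hz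
      mapsTo := fun u hu => (hDV _).2 (by rw [unbend_bend]; exact c.mapsTo u hu)
      mapsTo_inv := fun z hz => c.mapsTo_inv _ ((hDV z).1 hz)
      left_inv := fun u hu => by rw [unbend_bend, c.left_inv u hu]
      right_inv := fun z hz => by rw [c.right_inv _ ((hDV z).1 hz), bend_unbend]
      a := coordSign σ β
      b := coordSign σ δ
      exists_mem_D := ?_
      mem_K := ?_
      fixed := ?_ }
    mem := hxc
    character := hchar
    D' := {z | 0 < z.re ∧ 0 < z.im}
    isOpen_D' := (isOpen_lt continuous_const Complex.continuous_re).inter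
      (isOpen_lt continuous_const Complex.continuous_im)
    subset := fun z (hz : 0 < z.re ∧ 0 < z.im) => ⟨hz.1.le, hz.2.le⟩
    mem_iff := ?_
    preconnected := c.isPreconnected }⟩
  · refine Set.Finite.subset (Set.toFinite {1, φ s, φ t, φ s * φ t}) fun k hk => ?_
    exact (hgroup k).1 hk
  · intro u hu k hk
    rcases hcases u hu with h1 | rfl | ⟨h1, h2⟩ | ⟨h1, h2⟩
    · rw [stabilizerMap_eq_bot h1] at hk
      rw [Subgroup.mem_bot.1 hk]; exact one_mem _
    · exact hk
    · rw [mem_stabilizerMap_inner hxv hs hΓβ (hβ u hu h1) h2] at hk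
      exact (hgroup k).2 (hk.imp_right Or.inl)
    · rw [mem_stabilizerMap_inner hxv ht hΓδ (hδ u hu h1) h2] at hk
      exact (hgroup k).2 (hk.imp_right fun h => Or.inr (Or.inl h))
  · intro z
    rcases le_total 0 z.re with h1 | h1 <;> rcases le_total 0 z.im with h2 | h2
    · exact ⟨1, one_mem _, by simp [h1, h2]⟩
    · exact ⟨φ s, (hgroup _).2 (by simp), by simp [hsβ, hsδ, h1, h2]⟩
    · exact ⟨φ t, (hgroup _).2 (by simp), by simp [htβ, htδ, h1, h2]⟩
    · exact ⟨φ s * φ t, (hgroup _).2 (by simp), by simp [hsβ, hsδ, htβ, htδ, h1, h2]⟩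
  · intro u hu k hk hkD
    obtain ⟨h1, h2⟩ := ((hDV _).2 (show unbend (bend (c.ψ u)) ∈ halfBox by
      rw [unbend_bend]; exact c.mapsTo u hu)).1
    obtain ⟨h3, h4⟩ := hkD
    rw [signIso_re] at h3
    rw [signIso_im] at h4
    rcases (hgroup k).1 hk with rfl | rfl | rfl | rfl
    · exact one_mem _
    · simp [hsδ] at h4
      exact mem_stabilizerMap_of_mem hxv hs hΓβ (hβ u hu (le_antisymm h4 h2))
    · simp [htβ] at h3
      exact mem_stabilizerMap_of_mem hxv ht hΓδ (hδ u hu (le_antisymm h3 h1))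
    · simp [hsδ, htδ] at h4
      simp [hsβ, htβ] at h3
      obtain ⟨h5, h6⟩ := (bend_im_eq_zero (c.mapsTo u hu).1).1 (le_antisymm h4 h2)
      obtain ⟨-, h7⟩ := (bend_re_eq_zero (c.mapsTo u hu).1).1 (le_antisymm h3 h1)
      rw [hψx u hu (Complex.ext h5 (le_antisymm h7 h6))]
      exact hk
  · intro u hu k hk
    rcases hcases u hu with h1 | rfl | ⟨h1, h2⟩ | ⟨h1, h2⟩
    · rw [stabilizerMap_eq_bot h1] at hk
      rw [Subgroup.mem_bot.1 hk]; simp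
    · have h3 : bend (c.ψ u) = 0 := by
        rw [hcx]; apply Complex.ext <;> simp [bend]
      apply Complex.ext <;> simp [h3]
    · rcases (mem_stabilizerMap_inner hxv hs hΓβ (hβ u hu h1) h2).1 hk with rfl | rfl
      · simp
      · apply Complex.ext <;> simp [h1, hsβ]
    · rcases (mem_stabilizerMap_inner hxv ht hΓδ (hδ u hu h1) h2).1 hk with rfl | rfl
      · simp
      · apply Complex.ext <;> simp [h1, htδ]
  · intro u hu
    have h3 := c.mem_iff u hu
    have h4 := (c.mapsTo u hu).1
    rw [bend_mem_interior_iff, show ((u : E 4) ∈ Γ ↔ _) from h3]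
    exact ⟨fun h => h.ne', fun h => lt_of_le_of_ne h4 (Ne.symm h)⟩

theorem exists_adaptedChart (h : IsInitialSurface Γ S₀) (hσ : ∀ s, σ (φ s) = signs Γ s) {x : S₀}
    (hx : (x : E 4) ∈ Γ) : Nonempty (AdaptedChart φ (totalSign σ) x) := by
  by_cases hxv : (x : E 4) ∈ cubeVertices 4
  · exact exists_adaptedChart_corner h hσ hx hxv
  · exact exists_adaptedChart_edge h hσ hx hxv

theorem isClosed_of_isJordanPath {n : ℕ} {Γ : Set (E n)} (h : IsJordanPath Γ) : IsClosed Γ := by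
  obtain ⟨p, γ, -, -, -, -, -, rfl⟩ := h
  refine Set.Finite.isClosed_biUnion (Set.finite_Iio _) fun i _ => ?_
  rw [← convexHull_pair]
  exact ((Set.toFinite _).isCompact_convexHull (𝕜 := ℝ)).isClosed

/-- A space assembled from oriented patches by the gluing of the complete surface is orientable. -/
theorem IsInitialSurface.isOrientableSurface (h : IsInitialSurface Γ S₀)
    (ho : IsOrientableSurface ↥(S₀ \ Γ)) (hσ : ∀ s, σ (φ s) = signs Γ s) {X : Type}
    [TopologicalSpace X] [T2Space X] [SecondCountableTopology X] {P : G → S₀ → X}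
    (hP : IsPatchSystem (stabilizerMap φ S₀) P) : IsOrientableSurface X := by
  obtain ⟨A, hA, hAs⟩ := exists_oriented_atlas (isClosed_of_isJordanPath h.jordan) ho
  have hAΓ : ∀ e ∈ A, ∀ y ∈ e.source, (y : E 4) ∉ Γ := fun e he y hy => by
    have : y ∈ ⋃ e ∈ A, e.source := mem_biUnion he hy
    rwa [hA] at this
  have hcov : ∀ y : S₀, (y : E 4) ∉ Γ → ∃ e ∈ A, y ∈ e.source := fun y hy => by
    have : y ∈ ⋃ e ∈ A, e.source := by rw [hA]; exact hy
    simpa using this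
  refine hP.isOrientableSurface (totalSign σ) A
    (fun e he y hy => stabilizerMap_eq_bot (hAΓ e he y hy)) hAs
    (by rw [hA]; exact h.dense_interior) fun y hy => ?_
  rw [hA] at hy
  obtain ⟨c⟩ := exists_adaptedChart (φ := φ) (σ := σ) h hσ (not_not.1 hy)
  -- The part of the chart off the path is connected, so its sign with respect to the oriented atlas
  -- is a constant `d`.
  let f := c.chart.interiorChart c.D' c.isOpen_D' c.subset
  have hf : f.source = c.chart.U \ {u | (u : E 4) ∈ Γ} := by
    ext u
    exact and_congr_right fun hu => c.mem_iff u hu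
  obtain ⟨d, hd⟩ := exists_constant_sign hAs (f := f) (by rw [hf]; exact c.preconnected)
    (by rw [hf]; exact fun u hu => hcov u hu.2)
  refine ⟨c.chart, f, d, c.mem, c.character, ?_, fun u _ => rfl, fun e he u hu => ?_⟩
  · rw [hf]; exact sdiff_subset
  · have huf : u ∈ f.source := by rw [hf]; exact ⟨hu.2, hAΓ e he u hu.1⟩
    exact ⟨huf, hd e he u ⟨hu.1, huf⟩⟩

end

/-! ### The complete surface modulo even translations -/

section

open scoped Pointwise

section

variable {n : ℕ} {Γ S₀ : Set (E n)}

/-! ### Translations of the complete surface -/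

theorem image_completeSurface {s : E n ≃ᵃⁱ[ℝ] E n} (hs : s ∈ reflectionGroup Γ) :
    s '' completeSurface Γ S₀ = completeSurface Γ S₀ := by
  have key : ∀ t ∈ reflectionGroup Γ, t '' completeSurface Γ S₀ ⊆ completeSurface Γ S₀ := by
    rintro t ht _ ⟨x, hx, rfl⟩
    obtain ⟨r, hr, y, hy, rfl⟩ := mem_iUnion₂.1 hx
    exact mem_biUnion (mul_mem ht hr) ⟨y, hy, rfl⟩
  refine Subset.antisymm (key s hs) fun x hx => ?_
  exact ⟨s⁻¹ x, key _ (inv_mem hs) (mem_image_of_mem _ hx), s.apply_symm_apply x⟩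

theorem IsInitialSurface.nonempty_interior (h : IsInitialSurface Γ S₀) : (S₀ \ Γ).Nonempty := by
  obtain ⟨p, γ, hw, hΓ⟩ := isJordanPath_iff.1 h.jordan
  have hp : wordVertex p γ 0 ∈ Γ := by
    rw [hΓ]
    exact hw.vertex_mem_path (by have := hw.length; omega)
  have : Nonempty S₀ := ⟨⟨_, h.boundary_subset hp⟩⟩
  obtain ⟨y, hy⟩ := h.dense_interior.nonempty
  exact ⟨y, y.2, hy⟩

/-- The vectors of the lattice with even coordinates are the translations in the reflection
group. -/
theorem IsInitialSurface.mem_lattice_iff (h : IsInitialSurface Γ S₀) {v : E n} :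
    v ∈ lattice (completeSurface Γ S₀) ⊓ multiples n 2 ↔
      ∃ s : reflectionGroup Γ, signs Γ s = 1 ∧ ∀ x, (s : E n ≃ᵃⁱ[ℝ] E n) x = v + x := by
  constructor
  · rintro ⟨⟨hv, -⟩, hv2⟩
    choose z hz using hv2
    let τ : E n ≃ᵃⁱ[ℝ] E n := AffineIsometryEquiv.constVAdd ℝ (E n) v
    -- Evenness is essential here: a translation has positive signs, so it has the form `IsCell`
    -- only if its vector is even.
    have hτ : IsCell τ fun α => 2 * z α := by
      intro x α
      rw [Int.negOnePow_even _ (even_two_mul _)]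
      change v α + x α = _
      rw [hz α]
      push_cast
      ring
    -- The translate of an interior point of the initial patch lies in some patch `s`. Then `s⁻¹ *
    -- τ` maps an interior point of the cube into the cube, so it is the identity, and the
    -- translation `τ` belongs to the group.
    obtain ⟨x, hx⟩ := h.nonempty_interior
    have hx1 : v + x ∈ completeSurface Γ S₀ := by
      have h1 : x ∈ completeSurface Γ S₀ := mem_biUnion (one_mem _) ⟨x, hx.1, rfl⟩
      have h2 := Set.vadd_mem_vadd_set (a := v) h1
      rwa [AddAction.mem_stabilizer_iff.1 hv] at h2
    obtain ⟨s, hs, y, hy, hsy⟩ := mem_iUnion₂.1 hx1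
    obtain ⟨m, hm⟩ := exists_isCell hs
    have h3 : (s⁻¹ * τ) x = y := by
      change s.symm (v + x) = y
      rw [← hsy]
      exact s.symm_apply_apply y
    have h4 : s⁻¹ * τ = 1 := (hm.inv.mul hτ).eq_one_of_openCube (h.interior_subset hx)
      (by rw [h3]; exact h.subset_cube hy)
    have h5 : s = τ := inv_mul_eq_one.1 h4
    have h6 : IsCell s fun α => 2 * z α := by rw [h5]; exact hτ
    refine ⟨⟨s, hs⟩, ?_, fun x => ?_⟩
    · funext α
      rw [signs_apply ⟨s, hs⟩ h6, Int.negOnePow_even _ (even_two_mul _)]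
      rfl
    · exact congrArg (fun g : E n ≃ᵃⁱ[ℝ] E n => g x) h5
  · rintro ⟨s, hs, hsv⟩
    have heven : ∀ α, Even (cellOf s α) := fun α => by
      have h1 : (cellOf s α).negOnePow = 1 := congrFun hs α
      exact (Int.negOnePow_eq_one_iff _).1 h1
    have hv : ∀ α, v α = cellOf s α := fun α => by
      have h1 := (isCell_cellOf s).apply_even 0 (heven α)
      rw [hsv 0] at h1
      simpa using h1
    refine ⟨⟨?_, fun α => ⟨cellOf s α, by rw [hv α]; simp⟩⟩, fun α => ?_⟩
    · refine AddAction.mem_stabilizer_iff.2 ?_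
      conv_rhs => rw [← image_completeSurface s.2]
      exact (image_congr fun x _ => hsv x).symm
    · obtain ⟨k, hk⟩ := heven α
      refine ⟨k, ?_⟩
      rw [hv α, hk]
      push_cast
      ring

/-- Distinct points differ by at least `2` in some coordinate, so the group is uniformly discrete.
-/
theorem isClosed_multiples (L : AddSubgroup (E n)) (hL : L ≤ multiples n 2) :
    IsClosed (L : Set (E n)) := by
  refine Metric.isClosed_of_pairwise_le_dist (one_pos : (0 : ℝ) < 1) fun u hu v hv huv => ?_
  obtain ⟨α, hα⟩ : ∃ α, u α ≠ v α := by
    by_contra! hcon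
    exact huv (by ext α; exact hcon α)
  obtain ⟨y, hy⟩ := hL hu α
  obtain ⟨z, hz⟩ := hL hv α
  refine le_trans ?_ (abs_apply_sub_le_dist u v α)
  have hyz : y ≠ z := by rintro rfl; exact hα (hy.trans hz.symm)
  have h1 : (1 : ℝ) ≤ |((y - z : ℤ) : ℝ)| := by
    exact_mod_cast Int.one_le_abs (sub_ne_zero.2 hyz)
  rw [hy, hz, ← mul_sub, abs_mul]
  push_cast at h1 ⊢
  norm_num
  linarith

/-! ### Quotients by translations -/

variable {X : Set (E n)} {L : AddSubgroup (E n)}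

/-- The projection to the quotient. -/
def proj (X : Set (E n)) (L : AddSubgroup (E n)) : X → TranslationQuotient X L := Quotient.mk _

theorem continuous_proj : Continuous (proj X L) := continuous_quot_mk

theorem proj_surjective : Function.Surjective (proj X L) := Quotient.mk_surjective

theorem proj_eq_iff {x y : X} : proj X L x = proj X L y ↔ -(x : E n) + y ∈ L := by
  unfold proj
  rw [Quotient.eq]
  exact QuotientAddGroup.leftRel_apply

/-- The saturation of an open set is the union of its translates. -/
theorem isOpenMap_proj (hL : ∀ v ∈ L, ∀ x ∈ X, v + x ∈ X) : IsOpenMap (proj X L) := by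
  intro U hU
  have h1 : proj X L ⁻¹' (proj X L '' U) =
      ⋃ v : L, (fun x : X => (⟨v + x, hL v v.2 x x.2⟩ : X)) ⁻¹' U := by
    ext x
    simp only [mem_preimage, mem_image, mem_iUnion]
    constructor
    · rintro ⟨y, hy, hyx⟩
      have h2 := proj_eq_iff.1 hyx.symm
      refine ⟨⟨_, h2⟩, ?_⟩
      convert hy
      change -(x : E n) + y + x = y
      abel
    · rintro ⟨v, hv⟩
      refine ⟨_, hv, proj_eq_iff.2 ?_⟩
      have : -(v + (x : E n)) + x = -v := by abel
      change -((v : E n) + (x : E n)) + x ∈ L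
      rw [this]
      exact neg_mem v.2
  refine (isOpen_coinduced (f := proj X L)).2 ?_
  rw [h1]
  exact isOpen_iUnion fun v => hU.preimage
    ((continuous_const.add continuous_subtype_val).subtype_mk _)

/-- The quotient injects continuously into `E n ⧸ L`, which is Hausdorff because `L` is closed. -/
theorem t2Space_translationQuotient (hL : IsClosed (L : Set (E n))) :
    T2Space (TranslationQuotient X L) := by
  let j : TranslationQuotient X L → E n ⧸ L := Quotient.lift (fun x : X => ((x : E n) : E n ⧸ L))
    fun x y hxy => QuotientAddGroup.eq.2 (QuotientAddGroup.leftRel_apply.1 hxy)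
  have hj : Continuous j := continuous_quot_lift _
    (continuous_quot_mk.comp continuous_subtype_val)
  have hinj : Function.Injective j := by
    intro p q hpq
    obtain ⟨x, rfl⟩ := proj_surjective p
    obtain ⟨y, rfl⟩ := proj_surjective q
    exact proj_eq_iff.2 (QuotientAddGroup.eq.1 hpq)
  exact T2Space.of_injective_continuous hinj hj

theorem secondCountable_translationQuotient (hL : ∀ v ∈ L, ∀ x ∈ X, v + x ∈ X) :
    SecondCountableTopology (TranslationQuotient X L) :=
  IsQuotientMap.secondCountableTopology (π := proj X L) isQuotientMap_quot_mk (isOpenMap_proj hL)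

/-! ### Connectedness -/

/-- A generator fixes a point of `S₀`, so `S₀` and its image have a connected union. For a product
`s * r`, the set for `s` is joined to the image under `s` of the set for `r`. -/
theorem exists_preconnected (hc : IsPreconnected S₀) (hΓ : Γ ⊆ S₀) {s : E n ≃ᵃⁱ[ℝ] E n}
    (hs : s ∈ reflectionGroup Γ) :
    ∃ t ⊆ completeSurface Γ S₀, IsPreconnected t ∧ S₀ ⊆ t ∧ s '' S₀ ⊆ t := by
  have hS : S₀ ⊆ completeSurface Γ S₀ := fun x hx => mem_biUnion (one_mem _) ⟨x, hx, rfl⟩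
  have himg : ∀ s ∈ reflectionGroup Γ, ∀ t ⊆ completeSurface Γ S₀,
      s '' t ⊆ completeSurface Γ S₀ := fun s hs t ht =>
    (image_mono ht).trans (image_completeSurface hs).subset
  have hne : ∀ {a b : E n}, segment ℝ a b ⊆ Γ → S₀.Nonempty := fun h =>
    ⟨_, hΓ (h (left_mem_segment ℝ _ _))⟩
  rcases S₀.eq_empty_or_nonempty with rfl | ⟨x₀, hx₀⟩
  · exact ⟨∅, empty_subset _, isPreconnected_empty, Subset.rfl, by simp⟩
  refine Subgroup.closure_induction (p := fun (s : E n ≃ᵃⁱ[ℝ] E n) _ =>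
    ∃ t ⊆ completeSurface Γ S₀, IsPreconnected t ∧ S₀ ⊆ t ∧ s '' S₀ ⊆ t) ?_ ?_ ?_ ?_ hs
  · rintro s ⟨a, b, hab, hΓ', rfl⟩
    have ha := hΓ (hΓ' (left_mem_segment ℝ a b))
    refine ⟨S₀ ∪ schwarzReflection a b '' S₀, union_subset hS (himg _
      (Subgroup.subset_closure ⟨a, b, hab, hΓ', rfl⟩) _ hS), ?_, subset_union_left,
      subset_union_right⟩
    exact hc.union a ha ⟨a, ha, schwarzReflection_apply_of_mem (left_mem_segment ℝ a b)⟩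
      (hc.image _ (schwarzReflection a b).continuous.continuousOn)
  · exact ⟨S₀, hS, hc, Subset.rfl, by simp⟩
  · rintro s r hs hr ⟨t, ht, htc, ht1, ht2⟩ ⟨u, hu, huc, hu1, hu2⟩
    refine ⟨t ∪ s '' u, union_subset ht (himg s hs u hu), ?_, ht1.trans subset_union_left, ?_⟩
    · exact htc.union (s x₀) (ht2 (mem_image_of_mem _ hx₀)) (mem_image_of_mem _ (hu1 hx₀))
        (huc.image _ s.continuous.continuousOn)
    · refine Subset.trans ?_ subset_union_right
      rw [AffineIsometryEquiv.coe_mul, image_comp]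
      exact image_mono hu2
  · rintro s hs ⟨t, ht, htc, ht1, ht2⟩
    refine ⟨⇑(s⁻¹) '' t, himg _ (inv_mem hs) t ht, htc.image _ s⁻¹.continuous.continuousOn, ?_,
      image_mono ht1⟩
    intro x hx
    exact ⟨s x, ht2 (mem_image_of_mem _ hx), s.symm_apply_apply x⟩

theorem connectedSpace_completeSurface (hc : IsConnected S₀) (hΓ : Γ ⊆ S₀) :
    ConnectedSpace (completeSurface Γ S₀) := by
  obtain ⟨x₀, hx₀⟩ := hc.nonempty
  refine isConnected_iff_connectedSpace.1
    ⟨⟨x₀, mem_biUnion (one_mem _) ⟨x₀, hx₀, rfl⟩⟩, isPreconnected_of_forall x₀ fun y hy => ?_⟩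
  obtain ⟨s, hs, hy⟩ := mem_iUnion₂.1 hy
  obtain ⟨t, ht, htc, ht1, ht2⟩ := exists_preconnected hc.isPreconnected hΓ hs
  exact ⟨t, ht, ht1 hx₀, ht2 hy, htc⟩

theorem connectedSpace_translationQuotient [ConnectedSpace X] :
    ConnectedSpace (TranslationQuotient X L) :=
  proj_surjective.connectedSpace continuous_proj

end

/-! ### The quotient of the complete surface -/

variable {Γ S₀ : Set (E 4)}

/-- The signs of the reflection group of a Jordan path in dimension four are arbitrary. -/
theorem signs_surjective (h : IsJordanPath Γ) : Function.Surjective (signs Γ) := by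
  obtain ⟨p, γ, hw, rfl⟩ := isJordanPath_iff.1 h
  have h1 : ∀ β : Fin 4, (fun α => if α = β then 1 else -1 : Fin 4 → ℤˣ) ∈
      (signs (wordPath p γ)).range := by
    intro β
    obtain ⟨i, hi, rfl⟩ := List.mem_iff_getElem.1 (hw.mem β)
    let s : reflectionGroup (wordPath p γ) := ⟨edgeReflection (wordVertex p γ i) γ[i],
      edgeReflection_mem_reflectionGroup (hw.vertex_mem i) (hw.segment_subset hi)⟩
    refine ⟨s, funext fun α => ?_⟩
    exact signs_edgeReflection (s := s) (hw.vertex_mem i) rfl α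
  -- The product of the four patterns in `h1` is `-1` in every coordinate, from three factors `-1`
  -- each; a further factor `h1 β` leaves the sign change of `β` alone.
  have h2 : ∀ β : Fin 4, (fun α => if α = β then -1 else 1 : Fin 4 → ℤˣ) ∈
      (signs (wordPath p γ)).range := by
    intro β
    have h3 := mul_mem (h1 β) (Subgroup.prod_mem _ fun δ (_ : δ ∈ Finset.univ) => h1 δ)
    convert h3 using 1
    clear h3 h1
    revert β
    decide
  intro ε
  have h3 : ε ∈ (signs (wordPath p γ)).range := by
    have h4 : ε = ∏ β, if ε β = 1 then 1 else (fun α => if α = β then -1 else 1 : Fin 4 → ℤˣ) := by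
      revert ε; decide
    rw [h4]
    refine Subgroup.prod_mem _ fun β _ => ?_
    split_ifs
    · exact one_mem _
    · exact h2 β
  exact h3

/-- The lattice of even translations. -/
abbrev evenLattice (Γ S₀ : Set (E 4)) : AddSubgroup (E 4) :=
  lattice (completeSurface Γ S₀) ⊓ multiples 4 2

/-- The patches of the quotient. -/
def quotientPatch (S₀ : Set (E 4)) (h : IsJordanPath Γ) (ε : Fin 4 → ℤˣ) (x : S₀) :
    TranslationQuotient (completeSurface Γ S₀) (evenLattice Γ S₀) :=
  proj _ _ (patch Γ S₀ (Function.surjInv (signs_surjective h) ε) x)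

theorem IsInitialSurface.add_mem (h : IsInitialSurface Γ S₀) {v : E 4} (hv : v ∈ evenLattice Γ S₀) {x : E 4}
    (hx : x ∈ completeSurface Γ S₀) : v + x ∈ completeSurface Γ S₀ := by
  obtain ⟨s, -, hs⟩ := h.mem_lattice_iff.1 hv
  rw [← hs x, ← image_completeSurface s.2]
  exact mem_image_of_mem _ hx

theorem t2Space_quotient (Γ S₀ : Set (E 4)) :
    T2Space (TranslationQuotient (completeSurface Γ S₀) (evenLattice Γ S₀)) :=
  t2Space_translationQuotient (isClosed_multiples _ inf_le_right)

theorem IsInitialSurface.secondCountableTopology (h : IsInitialSurface Γ S₀) :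
    SecondCountableTopology (TranslationQuotient (completeSurface Γ S₀) (evenLattice Γ S₀)) :=
  secondCountable_translationQuotient fun _ hv _ hx => h.add_mem hv hx

/-- Even translations in the lattice are the group elements with trivial signs, so the patches of
the quotient are indexed by sign vectors, and the stabilizers are replaced by their images. -/
theorem IsInitialSurface.proj_patch_eq_iff (h : IsInitialSurface Γ S₀) (hv : VertexCondition Γ) {s t : reflectionGroup Γ}
    {x y : S₀} : proj _ (evenLattice Γ S₀) (patch Γ S₀ s x) = proj _ _ (patch Γ S₀ t y) ↔
      x = y ∧ (signs Γ s)⁻¹ * signs Γ t ∈ stabilizerMap (signs Γ) S₀ x := by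
  rw [proj_eq_iff, h.mem_lattice_iff]
  constructor
  · rintro ⟨τ, hτ, hτx⟩
    have h1 : ((τ * s : reflectionGroup Γ) : E 4 ≃ᵃⁱ[ℝ] E 4) x = (t : E 4 ≃ᵃⁱ[ℝ] E 4) y := by
      change (τ : E 4 ≃ᵃⁱ[ℝ] E 4) ((s : E 4 ≃ᵃⁱ[ℝ] E 4) x) = _
      rw [hτx]
      change -((s : E 4 ≃ᵃⁱ[ℝ] E 4) (x : E 4)) + (t : E 4 ≃ᵃⁱ[ℝ] E 4) y +
        (s : E 4 ≃ᵃⁱ[ℝ] E 4) x = _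
      abel
    obtain ⟨hxy, hk⟩ := (h.apply_eq_iff hv).1 h1
    refine ⟨hxy, ?_⟩
    have := Subgroup.mem_map_of_mem (signs Γ) hk
    rwa [map_mul, map_inv, map_mul, hτ, one_mul] at this
  · rintro ⟨rfl, k, hk, hkε⟩
    -- This element maps `s x` to `t x`, because `k` fixes `x`, and its signs are trivial, so it is
    -- a translation.
    refine ⟨t * k⁻¹ * s⁻¹, ?_, fun z => ?_⟩
    · rw [map_mul, map_mul, map_inv, map_inv, hkε]
      group
    · have h1 : signs Γ (t * k⁻¹ * s⁻¹) = 1 := by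
        rw [map_mul, map_mul, map_inv, map_inv, hkε]
        group
      have hc := isCell_cellOf (t * k⁻¹ * s⁻¹)
      have heven : ∀ α, Even (cellOf (t * k⁻¹ * s⁻¹) α) := fun α =>
        (Int.negOnePow_eq_one_iff _).1 (congrFun h1 α)
      have h2 : ((t * k⁻¹ * s⁻¹ : reflectionGroup Γ) : E 4 ≃ᵃⁱ[ℝ] E 4)
          ((s : E 4 ≃ᵃⁱ[ℝ] E 4) x) = (t : E 4 ≃ᵃⁱ[ℝ] E 4) x := by
        have h3 := edgeGroup_fixes (mem_stabilizerAt.1 (inv_mem hk))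
        have h4 : ((t * k⁻¹ * s⁻¹ : reflectionGroup Γ) : E 4 ≃ᵃⁱ[ℝ] E 4)
          ((s : E 4 ≃ᵃⁱ[ℝ] E 4) x) = ((t * k⁻¹ * s⁻¹ * s : reflectionGroup Γ) :
            E 4 ≃ᵃⁱ[ℝ] E 4) x := rfl
        rw [h4, inv_mul_cancel_right]
        exact congrArg (t : E 4 ≃ᵃⁱ[ℝ] E 4) h3
      ext α
      have h5 := hc.apply_even ((s : E 4 ≃ᵃⁱ[ℝ] E 4) x) (heven α)
      rw [h2] at h5
      rw [hc.apply_even z (heven α)]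
      change _ = -((s : E 4 ≃ᵃⁱ[ℝ] E 4) (x : E 4) α) + (t : E 4 ≃ᵃⁱ[ℝ] E 4) x α + z α
      rw [h5]
      ring

theorem IsInitialSurface.exists_quotientPatch (h : IsInitialSurface Γ S₀) (hv : VertexCondition Γ)
    (q : TranslationQuotient (completeSurface Γ S₀) (evenLattice Γ S₀)) :
    ∃ ε x, quotientPatch S₀ h.jordan ε x = q := by
  obtain ⟨z, rfl⟩ := proj_surjective q
  obtain ⟨s, x, rfl⟩ := exists_patch z
  refine ⟨signs Γ s, x, (h.proj_patch_eq_iff hv).2 ⟨rfl, ?_⟩⟩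
  rw [Function.surjInv_eq (signs_surjective h.jordan), inv_mul_cancel]
  exact one_mem _

/-- Finitely many sign vectors index the patches, so unions of closed pieces are closed by
compactness of `S₀`. -/
theorem IsInitialSurface.isPatchSystem_quotient (h : IsInitialSurface Γ S₀) (hv : VertexCondition Γ) :
    IsPatchSystem (stabilizerMap (signs Γ) S₀) (quotientPatch S₀ h.jordan) := by
  have hcont : ∀ ε, Continuous (quotientPatch S₀ h.jordan ε) := fun ε =>
    continuous_proj.comp ((h.isPatchSystem hv).continuous _)
  have := t2Space_quotient Γ S₀
  have := isCompact_iff_compactSpace.1 h.compact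
  refine ⟨hcont, h.exists_quotientPatch hv, ?_, fun F hF => ?_⟩
  · intro ε ε' x y
    unfold quotientPatch
    rw [h.proj_patch_eq_iff hv, Function.surjInv_eq (signs_surjective h.jordan),
      Function.surjInv_eq (signs_surjective h.jordan)]
  · exact isClosed_iUnion_of_finite fun ε => ((hF ε).isCompact.image (hcont ε)).isClosed

theorem IsInitialSurface.compactSpace (h : IsInitialSurface Γ S₀) (hv : VertexCondition Γ) :
    CompactSpace (TranslationQuotient (completeSurface Γ S₀) (evenLattice Γ S₀)) := by
  have hP := h.isPatchSystem_quotient hv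
  have := isCompact_iff_compactSpace.1 h.compact
  refine ⟨?_⟩
  have h1 : (univ : Set (TranslationQuotient (completeSurface Γ S₀) (evenLattice Γ S₀))) =
      ⋃ ε, range (quotientPatch S₀ h.jordan ε) := by
    symm
    rw [eq_univ_iff_forall]
    intro q
    obtain ⟨ε, x, rfl⟩ := hP.surj q
    exact mem_iUnion.2 ⟨ε, x, rfl⟩
  rw [h1]
  exact isCompact_iUnion fun ε => isCompact_range (hP.continuous ε)

theorem IsInitialSurface.isOrientableSurface_completeSurface (h : IsInitialSurface Γ S₀) (hv : VertexCondition Γ)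
    (ho : IsOrientableSurface ↥(S₀ \ Γ)) : IsOrientableSurface (completeSurface Γ S₀) := by
  refine h.isOrientableSurface (G := reflectionGroup Γ) (φ := MonoidHom.id _) (σ := signs Γ) ho
    (fun s => rfl) (P := patch Γ S₀) ?_
  convert h.isPatchSystem hv using 1
  funext x
  exact Subgroup.map_id _

/-- The determinant factors through the signs, so it is still a character on the group that indexes
the patches of the quotient. -/
theorem IsInitialSurface.isOrientableSurface_quotient (h : IsInitialSurface Γ S₀) (hv : VertexCondition Γ)
    (ho : IsOrientableSurface ↥(S₀ \ Γ)) :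
    IsOrientableSurface (TranslationQuotient (completeSurface Γ S₀) (evenLattice Γ S₀)) := by
  have := t2Space_quotient Γ S₀
  have := h.secondCountableTopology
  exact h.isOrientableSurface (φ := signs Γ) (σ := MonoidHom.id _) ho (fun s => rfl)
    (h.isPatchSystem_quotient hv)

end

/-! ### Existence of initial disks -/

section

/-! ### The closed disk is a surface with boundary -/

/-- The closed unit disk. -/
abbrev Disk : Type := Metric.closedBall (0 : ℂ) 1

theorem disk_norm_le (u : Disk) : ‖(u : ℂ)‖ ≤ 1 := mem_closedBall_zero_iff.1 u.2

/-- The radial retraction to the closed unit disk. -/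
def toDisk (w : ℂ) : Disk := ⟨((max 1 ‖w‖)⁻¹ : ℝ) * w, by
  have h1 : (0 : ℝ) < max 1 ‖w‖ := lt_max_of_lt_left one_pos
  rw [mem_closedBall_zero_iff, norm_mul, Complex.norm_real, Real.norm_eq_abs,
    abs_of_pos (inv_pos.2 h1), inv_mul_le_one₀ h1]
  exact le_max_right _ _⟩

theorem continuous_toDisk : Continuous toDisk := by
  refine Continuous.subtype_mk (Continuous.mul (Complex.continuous_ofReal.comp
    (Continuous.inv₀ (continuous_const.max continuous_norm) fun w => ?_)) continuous_id) _
  exact (lt_max_of_lt_left one_pos).ne'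

theorem coe_toDisk {w : ℂ} (hw : ‖w‖ ≤ 1) : (toDisk w : ℂ) = w := by
  change (((max 1 ‖w‖)⁻¹ : ℝ) : ℂ) * w = w
  rw [max_eq_left hw]; simp

theorem toDisk_coe (u : Disk) : toDisk u = u := Subtype.ext (coe_toDisk (disk_norm_le u))

/-- The coordinates of the half plane as a complex number. -/
def ofHalfSpace (q : EuclideanHalfSpace 2) : ℂ := ⟨q.val 0, q.val 1⟩

theorem continuous_ofHalfSpace : Continuous ofHalfSpace :=
  continuous_complex_mk ((EuclideanSpace.proj (𝕜 := ℝ) 0).continuous.comp continuous_subtype_val)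
    ((EuclideanSpace.proj (𝕜 := ℝ) 1).continuous.comp continuous_subtype_val)

theorem ofHalfSpace_toHalfSpace {z : ℂ} (hz : 0 ≤ z.re) : ofHalfSpace (toHalfSpace z) = z :=
  Complex.ext (max_eq_left hz) rfl

theorem toHalfSpace_ofHalfSpace (q : EuclideanHalfSpace 2) : toHalfSpace (ofHalfSpace q) = q := by
  apply Subtype.ext
  ext i
  fin_cases i
  · exact max_eq_left q.2
  · rfl

/-- A chart of the interior of the disk. -/
def diskInnerChart : OpenPartialHomeomorph Disk (EuclideanHalfSpace 2) where
  -- The shift by `2` moves the open disk off the boundary line of the half plane.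
  toFun u := toHalfSpace (u + 2)
  invFun q := toDisk (ofHalfSpace q - 2)
  source := {u | ‖(u : ℂ)‖ < 1}
  target := {q | ‖ofHalfSpace q - 2‖ < 1}
  map_source' u hu := by
    have h1 := (abs_le.1 ((Complex.abs_re_le_norm (u : ℂ)).trans (disk_norm_le u))).1
    rw [mem_ofPred_eq, ofHalfSpace_toHalfSpace (by simp; linarith), add_sub_cancel_right]
    exact hu
  map_target' q hq := by
    rw [mem_ofPred_eq, coe_toDisk (le_of_lt hq)]
    exact hq
  left_inv' u hu := by
    have h1 := (abs_le.1 ((Complex.abs_re_le_norm (u : ℂ)).trans (disk_norm_le u))).1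
    rw [ofHalfSpace_toHalfSpace (by simp; linarith), add_sub_cancel_right, toDisk_coe]
  right_inv' q hq := by
    rw [coe_toDisk (le_of_lt hq), sub_add_cancel, toHalfSpace_ofHalfSpace]
  open_source := isOpen_lt continuous_subtype_val.norm continuous_const
  open_target := isOpen_lt (continuous_ofHalfSpace.sub continuous_const).norm continuous_const
  continuousOn_toFun := (continuous_toHalfSpace.comp
    (continuous_subtype_val.add continuous_const)).continuousOn
  continuousOn_invFun := (continuous_toDisk.comp
    (continuous_ofHalfSpace.sub continuous_const)).continuousOn

/-- The first coordinate of a point of the disk with given second coordinate and distance `r` from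
the circle. -/
def halfDiskPoint (q : ℂ) : ℂ := ⟨√((1 - q.re) ^ 2 - q.im ^ 2), q.im⟩

/-- The chart coordinates are the distance from the circle and the second coordinate; the first
coordinate is recovered by Pythagoras. -/
theorem norm_halfDiskPoint {q : ℂ} (hq : |q.im| < 1 - q.re) : ‖halfDiskPoint q‖ = 1 - q.re := by
  have h0 : 0 ≤ 1 - q.re := (abs_nonneg _).trans hq.le
  have h1 : 0 ≤ (1 - q.re) ^ 2 - q.im ^ 2 := by
    rw [sub_nonneg, sq_le_sq, abs_of_nonneg h0]
    exact hq.le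
  rw [← sq_eq_sq₀ (norm_nonneg _) h0, Complex.sq_norm, Complex.normSq_apply]
  change √((1 - q.re) ^ 2 - q.im ^ 2) * √((1 - q.re) ^ 2 - q.im ^ 2) + q.im * q.im = _
  rw [Real.mul_self_sqrt h1]
  ring

theorem continuous_halfDiskPoint : Continuous halfDiskPoint :=
  continuous_complex_mk (f := fun q : ℂ => √((1 - q.re) ^ 2 - q.im ^ 2)) (g := fun q => q.im)
    (by fun_prop) Complex.continuous_im

theorem continuous_diskBoundary (e : Circle) : Continuous fun u : Disk =>
    (⟨1 - ‖(u : ℂ)‖, ((e⁻¹ : Circle) * (u : ℂ)).im⟩ : ℂ) :=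
  continuous_complex_mk (f := fun u : Disk => 1 - ‖(u : ℂ)‖)
    (g := fun u : Disk => ((e⁻¹ : Circle) * (u : ℂ)).im)
    (continuous_const.sub continuous_subtype_val.norm)
    (Complex.continuous_im.comp (continuous_const.mul continuous_subtype_val))

/-- A chart of the half of the disk about the point `e` of the circle. -/
def diskBoundaryChart (e : Circle) : OpenPartialHomeomorph Disk (EuclideanHalfSpace 2) where
  toFun u := toHalfSpace ⟨1 - ‖(u : ℂ)‖, ((e⁻¹ : Circle) * (u : ℂ)).im⟩
  invFun q := toDisk (e * halfDiskPoint (ofHalfSpace q))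
  source := {u | 0 < ((e⁻¹ : Circle) * (u : ℂ)).re}
  target := {q | |(ofHalfSpace q).im| < 1 - (ofHalfSpace q).re}
  map_source' u hu := by
    rw [mem_ofPred_eq, ofHalfSpace_toHalfSpace (sub_nonneg.2 (disk_norm_le u))]
    have h1 : ‖((e⁻¹ : Circle) * (u : ℂ))‖ = ‖(u : ℂ)‖ := by
      rw [norm_mul, Circle.norm_coe, one_mul]
    rw [sub_sub_cancel, ← h1]
    exact Complex.abs_im_lt_norm.2 (ne_of_gt hu)
  map_target' q hq := by
    have hq' : |(ofHalfSpace q).im| < 1 - (ofHalfSpace q).re := hq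
    have h1 := norm_halfDiskPoint hq'
    have h2 : 0 ≤ (ofHalfSpace q).re := q.2
    rw [mem_ofPred_eq, coe_toDisk (by rw [norm_mul, Circle.norm_coe, one_mul, h1]; linarith),
      ← mul_assoc, ← Circle.coe_mul, inv_mul_cancel, Circle.coe_one, one_mul]
    refine Real.sqrt_pos.2 (sub_pos.2 (sq_lt_sq.2 ?_))
    rwa [abs_of_nonneg ((abs_nonneg _).trans hq'.le)]
  left_inv' u hu := by
    rw [ofHalfSpace_toHalfSpace (sub_nonneg.2 (disk_norm_le u))]
    have h1 : ‖((e⁻¹ : Circle) * (u : ℂ))‖ = ‖(u : ℂ)‖ := by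
      rw [norm_mul, Circle.norm_coe, one_mul]
    have h2 : halfDiskPoint ⟨1 - ‖(u : ℂ)‖, ((e⁻¹ : Circle) * (u : ℂ)).im⟩ =
        (e⁻¹ : Circle) * (u : ℂ) := by
      apply Complex.ext
      · change √((1 - (1 - ‖(u : ℂ)‖)) ^ 2 - ((e⁻¹ : Circle) * (u : ℂ)).im ^ 2) = _
        rw [sub_sub_cancel, ← h1, ← Complex.normSq_eq_norm_sq, Complex.normSq_apply]
        rw [show ∀ a b : ℝ, a * a + b * b - b ^ 2 = a ^ 2 by intros; ring]
        exact Real.sqrt_sq hu.le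
      · rfl
    rw [h2, ← mul_assoc, ← Circle.coe_mul, mul_inv_cancel, Circle.coe_one, one_mul, toDisk_coe]
  right_inv' q hq := by
    have hq' : |(ofHalfSpace q).im| < 1 - (ofHalfSpace q).re := hq
    have h1 := norm_halfDiskPoint hq'
    have h2 : 0 ≤ (ofHalfSpace q).re := q.2
    have h3 : ‖(e : ℂ) * halfDiskPoint (ofHalfSpace q)‖ = 1 - (ofHalfSpace q).re := by
      rw [norm_mul, Circle.norm_coe, one_mul, h1]
    rw [coe_toDisk (by rw [h3]; linarith), h3, ← mul_assoc, ← Circle.coe_mul, inv_mul_cancel,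
      Circle.coe_one, one_mul, sub_sub_cancel]
    exact toHalfSpace_ofHalfSpace q
  open_source := isOpen_lt continuous_const
    (Complex.continuous_re.comp (continuous_const.mul continuous_subtype_val))
  open_target := isOpen_lt (Complex.continuous_im.comp continuous_ofHalfSpace).abs
    (continuous_const.sub (Complex.continuous_re.comp continuous_ofHalfSpace))
  continuousOn_toFun := (continuous_toHalfSpace.comp (continuous_diskBoundary e)).continuousOn
  continuousOn_invFun := (continuous_toDisk.comp (continuous_const.mul
    (continuous_halfDiskPoint.comp continuous_ofHalfSpace))).continuousOn

/-- The half disks about the points of the circle cover everything but the centre, which needs the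
inner chart. -/
theorem isSurfaceWithBoundary_of_disk {n : ℕ} {S₀ Γ : Set (E n)} (h : S₀ ≃ₜ Disk)
    (hb : ∀ x : S₀, (x : E n) ∈ Γ ↔ ‖(h x : ℂ)‖ = 1) : IsSurfaceWithBoundary S₀ Γ := by
  intro x
  by_cases hx : (h x : ℂ) = 0
  · refine ⟨h.toOpenPartialHomeomorph.trans diskInnerChart, ⟨trivial, ?_⟩, fun y hy => ?_⟩
    · change ‖(h x : ℂ)‖ < 1
      rw [hx, norm_zero]; exact one_pos
    · rw [hb]
      have h1 : ‖(h y : ℂ)‖ < 1 := hy.2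
      refine iff_of_false h1.ne ?_
      change max ((h y : ℂ) + 2).re 0 ≠ 0
      have h2 := (abs_le.1 (Complex.abs_re_le_norm (h y : ℂ))).1
      have h3 : 0 < ((h y : ℂ) + 2).re := by
        rw [Complex.add_re, Complex.re_ofNat]; linarith
      rw [max_eq_left h3.le]
      exact h3.ne'
  · let e : Circle := ⟨(h x : ℂ) / ‖(h x : ℂ)‖, by
      rw [Submonoid.unitSphere, Submonoid.mem_mk, Subsemigroup.mem_mk, mem_sphere_zero_iff_norm,
        norm_div, Complex.norm_real, norm_norm, div_self (norm_ne_zero_iff.2 hx)]⟩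
    refine ⟨h.toOpenPartialHomeomorph.trans (diskBoundaryChart e), ⟨trivial, ?_⟩, fun y hy => ?_⟩
    · change 0 < (((e⁻¹ : Circle) : ℂ) * (h x : ℂ)).re
      have h1 : (h x : ℂ) = e * (‖(h x : ℂ)‖ : ℂ) :=
        (div_mul_cancel₀ _ (by simpa using hx)).symm
      rw [h1, ← mul_assoc, ← Circle.coe_mul, inv_mul_cancel, Circle.coe_one, one_mul,
        Complex.ofReal_re]
      simpa using hx
    · rw [hb]
      change _ ↔ max (1 - ‖(h y : ℂ)‖) 0 = 0
      rw [max_eq_left (sub_nonneg.2 (disk_norm_le (h y))), sub_eq_zero, eq_comm]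

/-! ### The cone over a Jordan path -/

/-- The truncation of a number to the unit interval. -/
def clamp (t : ℝ) : ℝ := max 0 (min t 1)

theorem clamp_of_mem {t : ℝ} (h : t ∈ Icc (0 : ℝ) 1) : clamp t = t := by
  rw [clamp, min_eq_left h.2, max_eq_right h.1]

theorem clamp_of_le {t : ℝ} (h : t ≤ 0) : clamp t = 0 :=
  max_eq_left ((min_le_left _ _).trans h)

theorem clamp_of_ge {t : ℝ} (h : 1 ≤ t) : clamp t = 1 := by
  rw [clamp, min_eq_right h, max_eq_right zero_le_one]

variable {n : ℕ}

/-- The piecewise linear path through the points `v 0, …, v L`. -/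
def polygon (v : ℕ → E n) (L : ℕ) (t : ℝ) : E n :=
  v 0 + ∑ i ∈ Finset.range L, clamp (t - i) • (v (i + 1) - v i)

theorem continuous_polygon (v : ℕ → E n) (L : ℕ) : Continuous (polygon v L) := by
  unfold polygon clamp
  fun_prop

/-- On the interval number `i`, the earlier terms are saturated and telescope, and the later ones
vanish. -/
theorem polygon_apply (v : ℕ → E n) {L i : ℕ} (hi : i < L) {t : ℝ} (h1 : (i : ℝ) ≤ t)
    (h2 : t ≤ i + 1) : polygon v L t = v i + (t - i) • (v (i + 1) - v i) := by
  unfold polygon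
  rw [← Finset.sum_range_add_sum_Ico _ (show i ≤ L from hi.le),
    Finset.sum_eq_sum_Ico_succ_bot hi, Finset.sum_congr rfl (g := fun j => v (j + 1) - v j),
    Finset.sum_range_sub, Finset.sum_eq_zero, clamp_of_mem ⟨by linarith, by linarith⟩]
  · abel
  · intro j hj
    have : ((i + 1 : ℕ) : ℝ) ≤ j := Nat.cast_le.2 (Finset.mem_Ico.1 hj).1
    push_cast at this
    rw [clamp_of_le (by linarith), zero_smul]
  · intro j hj
    have : ((j + 1 : ℕ) : ℝ) ≤ i := Nat.cast_le.2 (Finset.mem_range.1 hj)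
    push_cast at this
    rw [clamp_of_ge (by linarith), one_smul]

namespace JordanWord

variable {p : E n} {γ : List (Fin n)}

/-- The parametrization of a Jordan path. -/
def loop (_ : JordanWord p γ) (t : ℝ) : E n := polygon (wordVertex p γ) γ.length t

theorem loop_apply (h : JordanWord p γ) {i : ℕ} (hi : i < γ.length) {t : ℝ} (h1 : (i : ℝ) ≤ t)
    (h2 : t ≤ i + 1) (α : Fin n) : h.loop t α =
      if α = γ[i] then (1 - 2 * (t - i)) * wordVertex p γ i α else wordVertex p γ i α := by
  rw [loop, polygon_apply _ hi h1 h2, wordVertex_succ p γ hi]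
  change wordVertex p γ i α + (t - i) * (flip γ[i] (wordVertex p γ i) α - wordVertex p γ i α) = _
  split_ifs with hα
  · rw [hα, flip_apply_self]; ring
  · rw [flip_apply_of_ne hα]; ring

theorem loop_mem_segment (h : JordanWord p γ) {i : ℕ} (hi : i < γ.length) {t : ℝ}
    (h1 : (i : ℝ) ≤ t) (h2 : t ≤ i + 1) :
    h.loop t ∈ segment ℝ (wordVertex p γ i) (flip γ[i] (wordVertex p γ i)) := by
  rw [mem_segment_flip_iff (h.vertex_mem i)]
  refine ⟨fun α hα => by rw [h.loop_apply hi h1 h2, if_neg hα], ?_⟩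
  rw [h.loop_apply hi h1 h2, if_pos rfl, abs_mul, vertex_sq (h.vertex_mem i)]
  have : |1 - 2 * (t - i)| ≤ 1 := abs_le.2 ⟨by linarith, by linarith⟩
  linarith

theorem exists_floor {L : ℕ} {t : ℝ} (ht : t ∈ Ico (0 : ℝ) L) :
    ∃ i < L, (i : ℝ) ≤ t ∧ t < i + 1 :=
  ⟨⌊t⌋₊, (Nat.floor_lt ht.1).2 ht.2, Nat.floor_le ht.1, Nat.lt_floor_add_one t⟩

theorem loop_natCast (h : JordanWord p γ) {i : ℕ} (hi : i < γ.length) :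
    h.loop i = wordVertex p γ i := by
  ext α
  rw [h.loop_apply hi le_rfl (by linarith)]
  split_ifs <;> simp

theorem loop_vertex (h : JordanWord p γ) {i : ℕ} (hi : i < γ.length) {t : ℝ}
    (h1 : (i : ℝ) ≤ t) (h2 : t < i + 1) (hv : h.loop t ∈ cubeVertices n) : t = i := by
  have h3 := vertex_sq hv γ[i]
  rw [h.loop_apply hi h1 h2.le, if_pos rfl, abs_mul, vertex_sq (h.vertex_mem i)] at h3
  have h4 : |1 - 2 * (t - i)| = 1 := by linarith
  rcases eq_or_eq_neg_of_abs_eq h4 with h5 | h5 <;> linarith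

/-- The vertices of the path are indexed modulo its length. -/
theorem index_succ (h : JordanWord p γ) {i j : ℕ} (hi : i < γ.length) (hj : j < γ.length)
    (hij : wordVertex p γ i = wordVertex p γ (j + 1)) :
    i = j + 1 ∨ i = 0 ∧ j + 1 = γ.length := by
  rcases (Nat.succ_le_of_lt hj).lt_or_eq with h1 | h1
  · exact Or.inl (h.inj hi h1 hij)
  · refine Or.inr ⟨h.inj hi (show 0 < γ.length by omega) ?_, h1⟩
    rw [hij, show j + 1 = γ.length from h1, h.closed, wordVertex_zero]

/-- A point that is not a vertex determines its edge and its position there; a vertex determines its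
index. -/
theorem loop_injOn (h : JordanWord p γ) : InjOn h.loop (Ico 0 γ.length) := by
  intro t ht s hs hts
  obtain ⟨i, hi, hi1, hi2⟩ := exists_floor ht
  obtain ⟨j, hj, hj1, hj2⟩ := exists_floor hs
  by_cases hv : h.loop t ∈ cubeVertices n
  · have h1 := h.loop_vertex hi hi1 hi2 hv
    have h2 := h.loop_vertex hj hj1 hj2 (hts ▸ hv)
    rw [h1, h2, h.loop_natCast hi, h.loop_natCast hj] at hts
    rw [h1, h2, h.inj hi hj hts]
  · have h1 := h.loop_mem_segment hi hi1 hi2.le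
    have h2 := h.loop_mem_segment hj hj1 hj2.le
    rw [← hts] at h2
    obtain ⟨hγ, hij⟩ := edge_eq_of_mem (h.vertex_mem i) (h.vertex_mem j) h1 h2 hv
    rcases hij with hij | hij
    · obtain rfl := h.inj hi hj hij
      have h3 := congrArg (fun x : E n => x γ[i]) hts
      simp only [h.loop_apply hi hi1 hi2.le, h.loop_apply hj hj1 hj2.le, if_true] at h3
      have h4 := mul_right_cancel₀ (vertex_ne_zero (h.vertex_mem i) _) h3
      linarith
    -- If the same edge were run through backwards, `i` and `j` would be each other's successors
    -- modulo the length, which is impossible for length at least three.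
    · have h3 : wordVertex p γ i = wordVertex p γ (j + 1) := by
        rw [hij, wordVertex_succ p γ hj, hγ]
      have h4 : wordVertex p γ j = wordVertex p γ (i + 1) := by
        rw [wordVertex_succ p γ hi, hij, hγ, flip_flip]
      have := h.length
      rcases h.index_succ hi hj h3 with h5 | h5 <;> rcases h.index_succ hj hi h4 with h6 | h6 <;>
        omega

theorem image_loop (h : JordanWord p γ) : h.loop '' Ico 0 γ.length = wordPath p γ := by
  apply Subset.antisymm
  · rintro _ ⟨t, ht, rfl⟩
    obtain ⟨i, hi, hi1, hi2⟩ := exists_floor ht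
    exact h.segment_subset hi (h.loop_mem_segment hi hi1 hi2.le)
  · intro x hx
    obtain ⟨i, hi, hxi⟩ := h.exists_of_mem hx
    obtain ⟨h1, h2⟩ := (mem_segment_flip_iff (h.vertex_mem i) _).1 hxi
    have h0 := vertex_ne_zero (h.vertex_mem i) γ[i]
    set v := wordVertex p γ i with hv
    have h3 : |x γ[i] / v γ[i]| ≤ 1 := by
      rw [abs_div, vertex_sq (h.vertex_mem i), div_le_one (by norm_num)]; exact h2
    obtain ⟨h4, h5⟩ := abs_le.1 h3
    let t : ℝ := i + (1 - x γ[i] / v γ[i]) / 2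
    have ht1 : (i : ℝ) ≤ t := by simp only [t]; linarith
    have ht2 : t ≤ i + 1 := by simp only [t]; linarith
    have hxt : h.loop t = x := by
      ext α
      rw [h.loop_apply hi ht1 ht2]
      split_ifs with hα
      · rw [hα, ← hv]
        simp only [t]
        field_simp
        ring
      · exact (h1 α hα).symm
    have hiL : ((i + 1 : ℕ) : ℝ) ≤ γ.length := Nat.cast_le.2 hi
    push_cast at hiL
    rcases (ht2.trans hiL).lt_or_eq with h6 | h6
    · exact ⟨t, ⟨(Nat.cast_nonneg i).trans ht1, h6⟩, hxt⟩
    · have h7 : ((i + 1 : ℕ) : ℝ) = γ.length := by push_cast; linarith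
      have h7' : i + 1 = γ.length := Nat.cast_injective h7
      have hL := h.length
      refine ⟨((0 : ℕ) : ℝ), ⟨by simp, by simp; omega⟩, ?_⟩
      have h9 : p = flip γ[i] (wordVertex p γ i) := by
        rw [← wordVertex_succ p γ hi, h7', h.closed]
      rw [h.loop_natCast (by omega), ← hxt, wordVertex_zero]
      refine h9.trans ?_
      ext α
      have h8 : t - i = 1 := by
        rw [h6, ← h7]; push_cast; ring
      rw [h.loop_apply hi ht1 ht2, h8]
      split_ifs with hα
      · rw [hα, flip_apply_self]; ring
      · rw [flip_apply_of_ne hα]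

/-- The parametrization is injective on a half open interval and takes equal values at its two ends,
so it descends to the circle. -/
theorem exists_circle (h : JordanWord p γ) : ∃ c : Circle → E n, Continuous c ∧
    Function.Injective c ∧ range c = wordPath p γ := by
  have hL := h.length
  have hpos : (0 : ℝ) < γ.length := Nat.cast_pos.2 (by omega)
  have : Fact ((0 : ℝ) < γ.length) := ⟨hpos⟩
  let f : AddCircle (γ.length : ℝ) → E n := AddCircle.liftIco (γ.length : ℝ) 0 h.loop
  have hf : ∀ t ∈ Ico (0 : ℝ) γ.length, f (t : AddCircle (γ.length : ℝ)) = h.loop t :=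
    fun t ht => AddCircle.liftIco_zero_coe_apply ht
  have hlast : h.loop 0 = h.loop γ.length := by
    have h1 := h.loop_natCast (i := 0) (by omega)
    rw [Nat.cast_zero, wordVertex_zero] at h1
    rw [h1]
    obtain ⟨i, hi⟩ : ∃ i, γ.length = i + 1 := ⟨γ.length - 1, by omega⟩
    have hi' : (γ.length : ℝ) = i + 1 := by rw [hi]; push_cast; ring
    rw [loop, polygon_apply _ (show i < γ.length by omega) (by rw [hi']; linarith)
      (by rw [hi']), ← hi, h.closed, hi', add_sub_cancel_left, one_smul]
    abel
  have hfc : Continuous f := AddCircle.liftIco_zero_continuous hlast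
    (continuous_polygon _ _).continuousOn
  have hrep : ∀ q : AddCircle (γ.length : ℝ), ∃ t ∈ Ico (0 : ℝ) γ.length, (t : AddCircle _) = q := by
    intro q
    obtain ⟨t, ht⟩ := (AddCircle.equivIco (γ.length : ℝ) 0).symm.surjective q
    exact ⟨t, by simpa using t.2, ht⟩
  let g := (AddCircle.homeomorphCircle hpos.ne').symm
  refine ⟨f ∘ g, hfc.comp g.continuous, ?_, ?_⟩
  · refine Function.Injective.comp (fun q q' hq => ?_) g.injective
    obtain ⟨t, ht, rfl⟩ := hrep q
    obtain ⟨s, hs, rfl⟩ := hrep q'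
    rw [hf t ht, hf s hs] at hq
    rw [h.loop_injOn ht hs hq]
  · rw [g.surjective.range_comp, ← h.image_loop]
    ext x
    constructor
    · rintro ⟨q, rfl⟩
      obtain ⟨t, ht, rfl⟩ := hrep q
      exact ⟨t, ht, (hf t ht).symm⟩
    · rintro ⟨t, ht, rfl⟩
      exact ⟨t, hf t ht⟩

end JordanWord

theorem IsJordanPath.subset_cube {Γ : Set (E n)} (h : IsJordanPath Γ) : Γ ⊆ cube n := by
  intro x hx
  obtain ⟨a, ha, β, -, hxa⟩ := h.exists_edge hx
  exact segment_subset_cube ha β hxa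

theorem mem_cube_iff {x : E n} : x ∈ cube n ↔ ∀ α, |x α| ≤ 1 / 2 :=
  forall_congr' fun _ => abs_le.symm

theorem mem_openCube_iff {x : E n} : x ∈ openCube n ↔ ∀ α, |x α| < 1 / 2 :=
  forall_congr' fun _ => abs_lt.symm

theorem IsJordanPath.exists_abs_eq {Γ : Set (E 4)} (h : IsJordanPath Γ) {x : E 4} (hx : x ∈ Γ) :
    ∃ α, |x α| = 1 / 2 := by
  obtain ⟨a, ha, β, -, hxa⟩ := h.exists_edge hx
  obtain ⟨α, hα⟩ := exists_ne β
  exact ⟨α, by rw [((mem_segment_flip_iff ha β).1 hxa).1 α hα, vertex_sq ha]⟩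

/-- All points of `Γ` have maximum norm `1/2`, so a ray from the origin meets `Γ` at most once; this
makes the cone embedded. -/
theorem IsJordanPath.smul_le {Γ : Set (E 4)} (h : IsJordanPath Γ) {x y : E 4} (hx : x ∈ Γ)
    (hy : y ∈ Γ) {s t : ℝ} (hs : 0 ≤ s) (ht : 0 ≤ t) (he : s • x = t • y) : s ≤ t := by
  obtain ⟨α, hα⟩ := h.exists_abs_eq hx
  have h1 := congrArg (fun z : E 4 => |z α|) he
  simp only [PiLp.smul_apply, smul_eq_mul, abs_mul, abs_of_nonneg hs, abs_of_nonneg ht, hα] at h1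
  have h2 := mem_cube_iff.1 (h.subset_cube hy) α
  nlinarith

/-- The cone over a Jordan path is an initial surface which is homeomorphic to the disk. -/
theorem exists_isInitialDisk {Γ : Set (E 4)} (hΓ : IsJordanPath Γ) : ∃ S₀, IsInitialDisk Γ S₀ := by
  obtain ⟨p, γ, hw, hΓw⟩ := isJordanPath_iff.1 hΓ
  obtain ⟨c, hc, hci, hcr⟩ := hw.exists_circle
  rw [← hΓw] at hcr
  have hcΓ : ∀ w, c w ∈ Γ := fun w => hcr ▸ mem_range_self w
  let I := Icc (0 : ℝ) 1
  let F : I × Circle → E 4 := fun q => (q.1 : ℝ) • c q.2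
  have hF : Continuous F := (continuous_subtype_val.comp continuous_fst).smul (hc.comp continuous_snd)
  let P : I × Circle → Disk := fun q => ⟨(q.1 : ℝ) * (q.2 : ℂ), by
    rw [mem_closedBall_zero_iff, norm_mul, Circle.norm_coe, mul_one, Complex.norm_real,
      Real.norm_eq_abs, abs_of_nonneg q.1.2.1]
    exact q.1.2.2⟩
  have hP : Continuous P := ((Complex.continuous_ofReal.comp
    (continuous_subtype_val.comp continuous_fst)).mul
    (continuous_subtype_val.comp continuous_snd)).subtype_mk _
  have hPn : ∀ q, ‖(P q : ℂ)‖ = q.1 := fun q => by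
    change ‖((q.1 : ℝ) : ℂ) * (q.2 : ℂ)‖ = q.1
    rw [norm_mul, Circle.norm_coe, mul_one, Complex.norm_real, Real.norm_eq_abs,
      abs_of_nonneg q.1.2.1]
  -- The cone map and the polar coordinates of the disk make the same identifications, so they
  -- induce a continuous bijection from the compact disk to the cone, which is a homeomorphism.
  have hker : ∀ q q', F q = F q' ↔ P q = P q' := by
    rintro ⟨t, w⟩ ⟨s, u⟩
    constructor
    · intro he
      have hts : t = s := Subtype.ext (le_antisymm
        (hΓ.smul_le (hcΓ w) (hcΓ u) t.2.1 s.2.1 he) (hΓ.smul_le (hcΓ u) (hcΓ w) s.2.1 t.2.1 he.symm))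
      subst hts
      by_cases h0 : (t : ℝ) = 0
      · apply Subtype.ext
        change ((t : ℝ) : ℂ) * (w : ℂ) = ((t : ℝ) : ℂ) * (u : ℂ)
        rw [h0]; simp
      · have h1 : w = u := hci (smul_right_injective _ h0 he)
        rw [h1]
    · intro he
      have hts : t = s := Subtype.ext (by rw [← hPn (t, w), he, hPn])
      subst hts
      by_cases h0 : (t : ℝ) = 0
      · change (t : ℝ) • c w = (t : ℝ) • c u
        rw [h0, zero_smul, zero_smul]
      · have h1 : ((t : ℝ) : ℂ) * (w : ℂ) = ((t : ℝ) : ℂ) * (u : ℂ) := congrArg Subtype.val he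
        have h2 := mul_left_cancel₀ (Complex.ofReal_ne_zero.2 h0) h1
        rw [Circle.ext h2]
  have hPs : Function.Surjective P := by
    intro u
    by_cases hu : (u : ℂ) = 0
    · refine ⟨(⟨0, by simp [I]⟩, 1), Subtype.ext ?_⟩
      change ((0 : ℝ) : ℂ) * _ = (u : ℂ)
      rw [hu]; simp
    · refine ⟨(⟨‖(u : ℂ)‖, norm_nonneg _, disk_norm_le u⟩, ⟨(u : ℂ) / ‖(u : ℂ)‖, ?_⟩), Subtype.ext ?_⟩
      · rw [Submonoid.unitSphere, Submonoid.mem_mk, Subsemigroup.mem_mk, mem_sphere_zero_iff_norm,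
          norm_div, Complex.norm_real, norm_norm, div_self (norm_ne_zero_iff.2 hu)]
      · exact mul_div_cancel₀ _ (by simpa using hu)
  let S₀ := range F
  have hPq : IsQuotientMap P := (hP.isClosedMap).isQuotientMap hP hPs
  let f : Disk → S₀ := fun u => ⟨F (Function.surjInv hPs u), mem_range_self _⟩
  have hfP : ∀ q, f (P q) = ⟨F q, mem_range_self q⟩ := fun q =>
    Subtype.ext ((hker _ _).2 (Function.surjInv_eq hPs (P q)))
  have hfc : Continuous f := by
    rw [hPq.continuous_iff]
    have : f ∘ P = fun q => ⟨F q, mem_range_self q⟩ := funext hfP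
    rw [this]
    exact hF.subtype_mk _
  have hfb : Function.Bijective f := by
    constructor
    · intro u u' h
      obtain ⟨q, rfl⟩ := hPs u
      obtain ⟨q', rfl⟩ := hPs u'
      rw [hfP, hfP] at h
      exact (hker _ _).1 (congrArg Subtype.val h)
    · rintro ⟨_, q, rfl⟩
      exact ⟨P q, hfP q⟩
  let h : S₀ ≃ₜ Disk := (hfc.homeoOfEquivCompactToT2 (f := Equiv.ofBijective f hfb)).symm
  have hh : ∀ q, h ⟨F q, mem_range_self q⟩ = P q := fun q => by
    rw [← hfP]
    exact (Equiv.ofBijective f hfb).symm_apply_apply (P q)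
  have hmem : ∀ q, F q ∈ Γ ↔ (q.1 : ℝ) = 1 := by
    rintro ⟨t, w⟩
    constructor
    · intro hx
      have he : (t : ℝ) • c w = (1 : ℝ) • F (t, w) := by rw [one_smul]
      exact le_antisymm (hΓ.smul_le (hcΓ w) hx t.2.1 zero_le_one he)
        (hΓ.smul_le hx (hcΓ w) zero_le_one t.2.1 he.symm)
    · intro ht
      change (t : ℝ) • c w ∈ Γ
      rw [show (t : ℝ) = 1 from ht, one_smul]
      exact hcΓ w
  have hb : ∀ x : S₀, (x : E 4) ∈ Γ ↔ ‖(h x : ℂ)‖ = 1 := by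
    rintro ⟨_, q, rfl⟩
    rw [hh, hPn]
    exact hmem q
  have habs : ∀ q α, |F q α| ≤ q.1 * (1 / 2) := fun q α => by
    change |(q.1 : ℝ) * c q.2 α| ≤ _
    rw [abs_mul, abs_of_nonneg q.1.2.1]
    exact mul_le_mul_of_nonneg_left (mem_cube_iff.1 (hΓ.subset_cube (hcΓ _)) α) q.1.2.1
  refine ⟨S₀, ⟨hΓ, isCompact_range hF, ?_, ?_, isSurfaceWithBoundary_of_disk h hb, ?_⟩, h, hb⟩
  · rintro _ ⟨q, rfl⟩
    exact mem_cube_iff.2 fun α => (habs q α).trans (by linarith [q.1.2.2])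
  · rw [← hcr]
    rintro _ ⟨w, rfl⟩
    exact ⟨(⟨1, by simp [I]⟩, w), one_smul _ _⟩
  · rintro _ ⟨⟨q, rfl⟩, hq⟩
    have h1 : (q.1 : ℝ) < 1 := lt_of_le_of_ne q.1.2.2 fun h => hq ((hmem q).2 h)
    exact mem_openCube_iff.2 fun α => (habs q α).trans_lt (by linarith)

end

/-! ### Cell decompositions of a patch and of a space assembled from patches -/

section

/-! ### Cell decompositions -/

/-- A finite decomposition of `X` into cells of dimension at most `2`; the open cells of dimension
`k` are contained in the stratum `rank = k`. -/
structure CellData (X : Type) [TopologicalSpace X] where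
  cell : ℕ → Type
  finite : ∀ k, Finite (cell k)
  isEmpty : ∀ k, 2 < k → IsEmpty (cell k)
  map : ∀ k, cell k → (Fin k → ℝ) → X
  continuousOn : ∀ k i, ContinuousOn (map k i) (Metric.closedBall 0 1)
  rank : X → ℕ
  rank_ball : ∀ k i, ∀ x ∈ Metric.ball (0 : Fin k → ℝ) 1, rank (map k i x) = k
  rank_sphere : ∀ k i, ∀ x ∈ Metric.sphere (0 : Fin k → ℝ) 1, rank (map k i x) < k
  inj : ∀ k i j, ∀ x ∈ Metric.ball (0 : Fin k → ℝ) 1, ∀ y ∈ Metric.ball (0 : Fin k → ℝ) 1,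
    map k i x = map k j y → i = j ∧ x = y
  cover : ∀ p, ∃ i, ∃ x ∈ Metric.ball (0 : Fin (rank p) → ℝ) 1, map (rank p) i x = p

theorem mem_ball_or_sphere {k : ℕ} {x : Fin k → ℝ} (hx : x ∈ Metric.closedBall 0 1) :
    x ∈ Metric.ball 0 1 ∨ x ∈ Metric.sphere 0 1 := by
  rw [← Metric.ball_union_sphere] at hx
  exact hx

/-- Closed subsets of the compact set have closed images, and by `hdis` no point of `f '' S'` has a
preimage in `S` outside `S'`. -/
theorem continuousOn_invFunOn {A B : Type*} [TopologicalSpace A] [TopologicalSpace B] [Nonempty A]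
    [T2Space B] {f : A → B} {S S' : Set A} (hS : IsCompact S) (hf : ContinuousOn f S)
    (hS' : S' ⊆ S) (hinj : InjOn f S') (hdis : ∀ x ∈ S', ∀ y ∈ S, f y = f x → y ∈ S') :
    ContinuousOn (Function.invFunOn f S') (f '' S') := by
  rw [continuousOn_iff_isClosed]
  intro t ht
  refine ⟨f '' (S ∩ t), ((hS.inter_right ht).image_of_continuousOn
    (hf.mono inter_subset_left)).isClosed, ?_⟩
  ext z
  constructor
  · rintro ⟨hz, x, hx, rfl⟩
    rw [mem_preimage, hinj.leftInvOn_invFunOn hx] at hz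
    exact ⟨⟨x, ⟨hS' hx, hz⟩, rfl⟩, x, hx, rfl⟩
  · rintro ⟨⟨y, ⟨hy, hyt⟩, hyx⟩, x, hx, rfl⟩
    refine ⟨?_, x, hx, rfl⟩
    rw [mem_preimage, hinj.leftInvOn_invFunOn hx, ← hinj (hdis x hx y hy hyx) hx hyx]
    exact hyt

namespace CellData

variable {X : Type} [TopologicalSpace X] (c : CellData X)

/-- The characteristic map of a cell. -/
def charMap (k : ℕ) (i : c.cell k) : PartialEquiv (Fin k → ℝ) X :=
  InjOn.toPartialEquiv (c.map k i) (Metric.ball 0 1) fun x hx y hy h => (c.inj k i i x hx y hy h).2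

/-- A cell decomposition of a compact Hausdorff space is a CW complex. -/
@[reducible]
def toCWComplex [CompactSpace X] [T2Space X] : Topology.CWComplex (univ : Set X) :=
  Topology.CWComplex.mkFiniteType univ c.cell c.charMap c.finite (fun _ _ => rfl) c.continuousOn
    (fun k i => continuousOn_invFunOn (isCompact_closedBall 0 1) (c.continuousOn k i)
      Metric.ball_subset_closedBall (fun x hx y hy h => (c.inj k i i x hx y hy h).2)
      fun x hx y hy hyx => (mem_ball_or_sphere hy).resolve_right fun hy' => by
        have h1 := c.rank_sphere k i y hy'
        rw [hyx, c.rank_ball k i x hx] at h1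
        exact lt_irrefl _ h1)
    (by
      rintro ⟨k, i⟩ - ⟨l, j⟩ - hne
      refine Set.disjoint_left.2 ?_
      rintro _ ⟨x, hx, rfl⟩ ⟨y, hy, hxy⟩
      have h1 : k = l := by
        rw [← c.rank_ball k i x hx, ← c.rank_ball l j y hy]
        exact congrArg c.rank hxy.symm
      subst h1
      exact hne (by rw [(c.inj k j i y hy x hx hxy).1]))
    (by
      intro k i x hx
      obtain ⟨j, y, hy, hyx⟩ := c.cover (c.map k i x)
      exact mem_iUnion₂.2 ⟨_, c.rank_sphere k i x hx, mem_iUnion.2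
        ⟨j, y, Metric.ball_subset_closedBall hy, hyx⟩⟩)
    (by
      intro A _ hA
      -- Finitely many closed cells cover the space, so a set with closed traces on them is closed.
      have h1 : A = ⋃ k ∈ Iic 2, ⋃ j, A ∩ c.map k j '' Metric.closedBall 0 1 := by
        refine Subset.antisymm (fun x hx => ?_) (iUnion₂_subset fun k _ => iUnion_subset fun j =>
          inter_subset_left)
        obtain ⟨j, y, hy, hyx⟩ := c.cover x
        refine mem_biUnion (x := c.rank x) ?_ (mem_iUnion.2
          ⟨j, hx, y, Metric.ball_subset_closedBall hy, hyx⟩)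
        by_contra hcon
        exact (c.isEmpty _ (not_le.1 hcon)).false j
      rw [h1]
      refine (Set.finite_Iic 2).isClosed_biUnion fun k _ => ?_
      have := c.finite k
      exact isClosed_iUnion_of_finite fun j => hA k j)
    (by
      rw [eq_univ_iff_forall]
      intro x
      obtain ⟨j, y, hy, hyx⟩ := c.cover x
      exact mem_iUnion₂.2 ⟨_, j, y, Metric.ball_subset_closedBall hy, hyx⟩)

/-- The cell decomposition of a space assembled from patches. -/
def ofPatches {Y : Type} [TopologicalSpace Y] (c : CellData Y) {G : Type} [Group G] [Finite G]
    {K : Y → Subgroup G} {P : G → Y → X} (hP : IsPatchSystem K P)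
    (hK : ∀ k i, ∀ x ∈ Metric.ball (0 : Fin k → ℝ) 1, K (c.map k i x) = K (c.map k i 0)) :
    CellData X where
  -- The copies of a cell in two patches coincide when the patches differ by its stabilizer, so one
  -- copy remains for each coset.
  cell k := Σ i : c.cell k, G ⧸ K (c.map k i 0)
  finite k := by
    have := c.finite k
    infer_instance
  isEmpty k hk := by
    have := c.isEmpty k hk
    infer_instance
  map k i x := P i.2.out (c.map k i.1 x)
  continuousOn k i := (hP.continuous _).comp_continuousOn (c.continuousOn k i.1)
  rank p := c.rank (hP.surj p).choose_spec.choose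
  rank_ball k i x hx := by
    have h1 := (hP.surj (P i.2.out (c.map k i.1 x))).choose_spec.choose_spec
    rw [(hP.eq_iff.1 h1).1, c.rank_ball k i.1 x hx]
  rank_sphere k i x hx := by
    have h1 := (hP.surj (P i.2.out (c.map k i.1 x))).choose_spec.choose_spec
    rw [(hP.eq_iff.1 h1).1]
    exact c.rank_sphere k i.1 x hx
  inj := by
    rintro k ⟨i, g⟩ ⟨j, g'⟩ x hx y hy h
    obtain ⟨h1, h2⟩ := hP.eq_iff.1 h
    obtain ⟨rfl, rfl⟩ := c.inj k i j x hx y hy h1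
    rw [hK k i x hx] at h2
    have h3 : g = g' := by
      rw [← g.out_eq, ← g'.out_eq]
      exact QuotientGroup.eq.2 h2
    exact ⟨by rw [h3], rfl⟩
  cover p := by
    have key : ∀ (g : G) (q : Y), P g q = p → ∃ i : Σ i : c.cell (c.rank q),
        G ⧸ K (c.map (c.rank q) i 0), ∃ x ∈ Metric.ball (0 : Fin (c.rank q) → ℝ) 1,
        P i.2.out (c.map (c.rank q) i.1 x) = p := by
      rintro g q rfl
      obtain ⟨i, x, hx, hxq⟩ := c.cover q
      refine ⟨⟨i, QuotientGroup.mk g⟩, x, hx, (hP.eq_iff.2 ⟨hxq.symm, ?_⟩).symm⟩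
      have h1 : K q = K (c.map (c.rank q) i 0) := by rw [← hK _ i x hx, hxq]
      rw [h1]
      exact QuotientGroup.eq.1 (QuotientGroup.out_eq' _).symm
    exact key _ _ (hP.surj p).choose_spec.choose_spec

end CellData

/-! ### The cells of the disk -/

/-- A homeomorphism from the square to the disk. -/
theorem exists_squareToDisk : ∃ d : (Fin 2 → ℝ) → ℂ, Continuous d ∧ Function.Injective d ∧
    d '' Metric.ball 0 1 = Metric.ball 0 1 ∧ d '' Metric.sphere 0 1 = Metric.sphere 0 1 := by
  let L : (Fin 2 → ℝ) ≃L[ℝ] ℂ := Complex.basisOneI.equivFunL.symm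
  let s : Set ℂ := L '' Metric.closedBall 0 1
  have hi : interior s = L '' Metric.ball 0 1 := by
    rw [← interior_closedBall _ one_ne_zero]
    exact (L.toHomeomorph.image_interior _).symm
  have hf : frontier s = L '' Metric.sphere 0 1 := by
    rw [← frontier_closedBall _ one_ne_zero]
    exact (L.toHomeomorph.image_frontier _).symm
  have hconv : Convex ℝ s := (convex_closedBall 0 1).linear_image L.toLinearMap
  have hne : (interior s).Nonempty := by
    rw [hi]
    exact ⟨L 0, 0, by simp, rfl⟩
  have hb : Bornology.IsBounded s :=
    ((isCompact_closedBall 0 1).image L.continuous).isBounded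
  obtain ⟨g, hg1, -, hg2⟩ := exists_homeomorph_image_interior_closure_frontier_eq_unitBall hconv
    hne hb
  refine ⟨g ∘ L, g.continuous.comp L.continuous, g.injective.comp L.injective, ?_, ?_⟩
  · rw [image_comp, ← hi, hg1]
  · rw [image_comp, ← hf, hg2]

theorem mem_ball_one {x : Fin 1 → ℝ} : x ∈ Metric.ball 0 1 ↔ |x 0| < 1 := by
  rw [mem_ball_zero_iff, pi_norm_lt_iff one_pos]
  simp

theorem mem_sphere_one {x : Fin 1 → ℝ} : x ∈ Metric.sphere 0 1 ↔ |x 0| = 1 := by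
  rw [mem_sphere_zero_iff_norm]
  have : ‖x‖ = |x 0| := by
    simp [Pi.norm_def]
  rw [this]

/-- The numbers of cells of a disk whose boundary is divided into `L` edges. -/
def diskCell (L : ℕ) : ℕ → Type
  | 0 => Fin L
  | 1 => Fin L
  | 2 => Unit
  | _ => Empty

variable {n : ℕ} {S₀ : Set (E n)} {p : E n} {γ : List (Fin n)}

/-- The parameter of a point of the edge number `i`. -/
def edgeParam (i : ℕ) (x : Fin 1 → ℝ) : ℝ := i + (1 + x 0) / 2

theorem edgeParam_mem {i : ℕ} {x : Fin 1 → ℝ} (hx : x ∈ Metric.closedBall 0 1) :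
    (i : ℝ) ≤ edgeParam i x ∧ edgeParam i x ≤ i + 1 := by
  have h1 : |x 0| ≤ 1 := by
    rcases mem_ball_or_sphere hx with h | h
    · exact (mem_ball_one.1 h).le
    · exact (mem_sphere_one.1 h).le
  obtain ⟨h2, h3⟩ := abs_le.1 h1
  unfold edgeParam
  constructor <;> linarith

theorem edgeParam_mem_ball {i : ℕ} {x : Fin 1 → ℝ} (hx : x ∈ Metric.ball 0 1) :
    (i : ℝ) < edgeParam i x ∧ edgeParam i x < i + 1 := by
  obtain ⟨h2, h3⟩ := abs_lt.1 (mem_ball_one.1 hx)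
  unfold edgeParam
  constructor <;> linarith

namespace JordanWord

/-- The parametrization of the edges and of the disk. -/
def diskMap (hw : JordanWord p γ) (hΓ : wordPath p γ ⊆ S₀) (D : (Fin 2 → ℝ) → S₀) :
    ∀ k, diskCell γ.length k → (Fin k → ℝ) → S₀
  | 0, i, _ => ⟨wordVertex p γ i.1, hΓ (hw.vertex_mem_path i.2)⟩
  -- Clamping makes the map total with values in the edge; it has no effect on the closed ball.
  | 1, i, x => ⟨hw.loop (max (i.1 : ℝ) (min (edgeParam i.1 x) ((i.1 : ℝ) + 1))), hΓ (hw.segment_subset i.2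
      (hw.loop_mem_segment i.2 (le_max_left _ _) (max_le (by linarith) (min_le_right _ _))))⟩
  | 2, _, x => D x
  | _ + 3, i, _ => i.elim

theorem diskMap_one (hw : JordanWord p γ) (hΓ : wordPath p γ ⊆ S₀) (D : (Fin 2 → ℝ) → S₀)
    (i : diskCell γ.length 1) {x : Fin 1 → ℝ} (hx : x ∈ Metric.closedBall 0 1) :
    (hw.diskMap hΓ D 1 i x : E n) = hw.loop (edgeParam i.1 x) := by
  obtain ⟨h1, h2⟩ := edgeParam_mem (i := i.1) hx
  change hw.loop (max (i.1 : ℝ) (min (edgeParam i.1 x) ((i.1 : ℝ) + 1))) = _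
  rw [min_eq_left h2, max_eq_right h1]

theorem loop_not_vertex (hw : JordanWord p γ) {i : ℕ} (hi : i < γ.length) {x : Fin 1 → ℝ}
    (hx : x ∈ Metric.ball 0 1) : hw.loop (edgeParam i x) ∉ cubeVertices n := by
  obtain ⟨h1, h2⟩ := edgeParam_mem_ball (i := i) hx
  exact fun hv => h1.ne' (hw.loop_vertex hi h1.le h2 hv)

open Classical in
/-- The dimension of the cell which contains a point. -/
def diskRank (_ : JordanWord p γ) (y : S₀) : ℕ :=
  if (y : E n) ∈ wordPath p γ then (if (y : E n) ∈ cubeVertices n then 0 else 1) else 2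

/-- The cells of a disk bounded by a Jordan path. -/
def cellData (hw : JordanWord p γ) (hΓ : wordPath p γ ⊆ S₀) (D : (Fin 2 → ℝ) → S₀)
    (hD : Continuous D) (hDi : InjOn D (Metric.ball 0 1))
    (hDb : ∀ y : S₀, (y : E n) ∉ wordPath p γ ↔ ∃ x ∈ Metric.ball (0 : Fin 2 → ℝ) 1, D x = y)
    (hDs : ∀ x ∈ Metric.sphere (0 : Fin 2 → ℝ) 1, (D x : E n) ∈ wordPath p γ) :
    CellData S₀ where
  cell := diskCell γ.length
  finite
    | 0 => inferInstanceAs (Finite (Fin _))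
    | 1 => inferInstanceAs (Finite (Fin _))
    | 2 => inferInstanceAs (Finite Unit)
    | _ + 3 => inferInstanceAs (Finite Empty)
  isEmpty
    | _ + 3, _ => inferInstanceAs (IsEmpty Empty)
  map := hw.diskMap hΓ D
  continuousOn
    | 0, i => continuousOn_const
    | 1, i => by
      refine Continuous.continuousOn (Continuous.subtype_mk ((continuous_polygon _ _).comp ?_) _)
      unfold edgeParam
      fun_prop
    | 2, i => hD.continuousOn
    | _ + 3, i => i.elim
  rank := hw.diskRank
  rank_ball
    | 0, i, x, hx => by
      have h1 := hw.vertex_mem_path i.2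
      exact (if_pos h1).trans (if_pos (hw.vertex_mem i.1))
    | 1, i, x, hx => by
      have h0 := Metric.ball_subset_closedBall hx
      have h1 : (hw.diskMap hΓ D 1 i x : E n) ∈ wordPath p γ := by
        rw [diskMap_one _ _ _ _ h0]
        exact hw.segment_subset i.2 (hw.loop_mem_segment i.2 (edgeParam_mem h0).1
          (edgeParam_mem h0).2)
      refine (if_pos h1).trans (if_neg ?_)
      rw [diskMap_one _ _ _ _ h0]
      exact hw.loop_not_vertex i.2 hx
    | 2, i, x, hx => if_neg ((hDb _).2 ⟨x, hx, rfl⟩)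
    | _ + 3, i, _, _ => i.elim
  rank_sphere
    | 0, i, x, hx => by
      rw [mem_sphere_zero_iff_norm, Subsingleton.elim x 0, norm_zero] at hx
      exact absurd hx zero_ne_one
    | 1, i, x, hx => by
      have h0 := Metric.sphere_subset_closedBall hx
      obtain ⟨h1, h2⟩ := edgeParam_mem (i := i.1) h0
      have h3 : (hw.diskMap hΓ D 1 i x : E n) ∈ wordPath p γ := by
        rw [diskMap_one _ _ _ _ h0]
        exact hw.segment_subset i.2 (hw.loop_mem_segment i.2 h1 h2)
      have h4 : (hw.diskMap hΓ D 1 i x : E n) ∈ cubeVertices n := by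
        rw [diskMap_one _ _ _ _ h0]
        have h5 : edgeParam i.1 x - i.1 = 0 ∨ edgeParam i.1 x - i.1 = 1 := by
          rcases eq_or_eq_neg_of_abs_eq (mem_sphere_one.1 hx) with h | h
          · right; unfold edgeParam; rw [h]; ring
          · left; unfold edgeParam; rw [h]; ring
        intro α
        have h6 := hw.vertex_mem i.1 α
        rw [hw.loop_apply i.2 h1 h2]
        split_ifs
        · rcases h5 with h5 | h5 <;> rw [h5] <;> rcases h6 with h6 | h6 <;> rw [h6] <;> norm_num
        · exact h6
      have h5 : hw.diskRank (hw.diskMap hΓ D 1 i x) = 0 := (if_pos h3).trans (if_pos h4)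
      rw [h5]
      exact one_pos
    | 2, i, x, hx => by
      by_cases hv : (D x : E n) ∈ cubeVertices n
      · have h1 : hw.diskRank (D x) = 0 := (if_pos (hDs x hx)).trans (if_pos hv)
        exact h1.trans_lt two_pos
      · have h1 : hw.diskRank (D x) = 1 := (if_pos (hDs x hx)).trans (if_neg hv)
        exact h1.trans_lt one_lt_two
    | _ + 3, i, _, _ => i.elim
  inj
    | 0, i, j, x, _, y, _, h =>
      ⟨Fin.ext (hw.inj i.2 j.2 (congrArg Subtype.val h)), Subsingleton.elim _ _⟩
    | 1, i, j, x, hx, y, hy, h => by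
      have h1 := congrArg (Subtype.val : S₀ → E n) h
      rw [diskMap_one _ _ _ _ (Metric.ball_subset_closedBall hx),
        diskMap_one _ _ _ _ (Metric.ball_subset_closedBall hy)] at h1
      obtain ⟨h2, h3⟩ := edgeParam_mem_ball (i := i.1) hx
      obtain ⟨h4, h5⟩ := edgeParam_mem_ball (i := j.1) hy
      have hmem : ∀ (l : ℕ), l < γ.length → ∀ t : ℝ, (l : ℝ) < t → t < l + 1 →
          t ∈ Ico (0 : ℝ) γ.length := fun l hl t ht ht' => by
        have : ((l + 1 : ℕ) : ℝ) ≤ γ.length := Nat.cast_le.2 hl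
        push_cast at this
        exact ⟨(Nat.cast_nonneg l).trans ht.le, ht'.trans_le this⟩
      have h6 := hw.loop_injOn (hmem i.1 i.2 _ h2 h3) (hmem j.1 j.2 _ h4 h5) h1
      have h7 : (i.1 : ℝ) < j.1 + 1 := by linarith
      have h8 : (j.1 : ℝ) < i.1 + 1 := by linarith
      have h7' : i.1 < j.1 + 1 := by exact_mod_cast h7
      have h8' : j.1 < i.1 + 1 := by exact_mod_cast h8
      have hij : i = j := Fin.ext (by omega)
      subst hij
      refine ⟨rfl, funext fun k => ?_⟩
      rw [Subsingleton.elim k 0]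
      unfold edgeParam at h6
      linarith
    | 2, _, _, x, hx, y, hy, h => ⟨rfl, hDi hx hy h⟩
    | _ + 3, i, _, _, _, _, _, _ => i.elim
  cover y := by
    by_cases hy : (y : E n) ∈ wordPath p γ
    · by_cases hyv : (y : E n) ∈ cubeVertices n
      · have h0 : hw.diskRank y = 0 := (if_pos hy).trans (if_pos hyv)
        rw [h0]
        obtain ⟨i, hi, hyi⟩ := hw.exists_idx hy hyv
        exact ⟨(⟨i, hi⟩ : Fin γ.length), 0, by simp, Subtype.ext hyi.symm⟩
      · have h0 : hw.diskRank y = 1 := (if_pos hy).trans (if_neg hyv)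
        rw [h0]
        rw [← hw.image_loop] at hy
        obtain ⟨t, ht, hty⟩ := hy
        obtain ⟨i, hi, h1, h2⟩ := exists_floor ht
        have h3 : (i : ℝ) < t := lt_of_le_of_ne h1 fun h => hyv (by
          rw [← hty, ← h, hw.loop_natCast hi]; exact hw.vertex_mem i)
        have hx : (fun _ => 2 * (t - i) - 1 : Fin 1 → ℝ) ∈ Metric.ball 0 1 :=
          mem_ball_one.2 (abs_lt.2 ⟨by linarith, by linarith⟩)
        refine ⟨(⟨i, hi⟩ : Fin γ.length), fun _ => 2 * (t - i) - 1, hx, Subtype.ext ?_⟩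
        refine (hw.diskMap_one hΓ D _ (Metric.ball_subset_closedBall hx)).trans ?_
        rw [← hty]
        congr 1
        unfold edgeParam
        ring
    · have h0 : hw.diskRank y = 2 := if_neg hy
      rw [h0]
      obtain ⟨x, hx, hxy⟩ := (hDb y).1 hy
      exact ⟨(), x, hx, hxy⟩

end JordanWord

end

/-! ### The genus of the quotient -/

section

/-! ### The interior of a disk -/

theorem isOrientableSurface_of_isOpenEmbedding {X : Type} [TopologicalSpace X] [T2Space X]
    [SecondCountableTopology X] [Nonempty X] {f : X → ℂ} (hf : IsOpenEmbedding f) :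
    IsOrientableSurface X := by
  refine ⟨inferInstance, inferInstance, {hf.toOpenPartialHomeomorph f}, fun x =>
    ⟨_, rfl, trivial⟩, ?_⟩
  rintro _ rfl _ rfl x ⟨hx, -⟩
  exact (preservesOrientationAt_iff_hasSign hx hx).2 (HasSign.refl hx)

theorem isOrientableSurface_interior {n : ℕ} {Γ S₀ : Set (E n)} (hne : (S₀ \ Γ).Nonempty)
    (h : S₀ ≃ₜ Disk) (hb : ∀ x : S₀, (x : E n) ∈ Γ ↔ ‖(h x : ℂ)‖ = 1) :
    IsOrientableSurface ↥(S₀ \ Γ) := by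
  have : Nonempty ↥(S₀ \ Γ) := hne.to_subtype
  refine isOrientableSurface_of_isOpenEmbedding
    (f := fun y : ↥(S₀ \ Γ) => (h (inclusion sdiff_subset y) : ℂ)) ⟨?_, ?_⟩
  · exact IsEmbedding.subtypeVal.comp (h.isEmbedding.comp (IsEmbedding.inclusion sdiff_subset))
  · have h1 : range (fun y : ↥(S₀ \ Γ) => (h (inclusion sdiff_subset y) : ℂ)) =
        Metric.ball 0 1 := by
      ext z
      rw [mem_ball_zero_iff]
      constructor
      · rintro ⟨y, rfl⟩
        exact lt_of_le_of_ne (disk_norm_le _) fun h1 => y.2.2 ((hb _).2 h1)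
      · intro hz
        let u : Disk := ⟨z, mem_closedBall_zero_iff.2 hz.le⟩
        have hu : ((h.symm u : S₀) : E n) ∉ Γ := fun h1 => by
          rw [hb, h.apply_symm_apply] at h1
          exact hz.ne h1
        refine ⟨⟨h.symm u, (h.symm u).2, hu⟩, ?_⟩
        change (h (h.symm u) : ℂ) = z
        rw [h.apply_symm_apply]
    rw [h1]
    exact Metric.isOpen_ball

theorem isConnected_of_disk {n : ℕ} {S₀ : Set (E n)} (h : S₀ ≃ₜ Disk) : IsConnected S₀ := by
  have h1 : ConnectedSpace Disk := isConnected_iff_connectedSpace.1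
    ⟨⟨0, by simp⟩, (convex_closedBall (0 : ℂ) 1).isPreconnected⟩
  exact isConnected_iff_connectedSpace.2 (h.symm.surjective.connectedSpace h.symm.continuous)

/-! ### The number of edges -/

theorem JordanWord.ncard_vertices {n : ℕ} {p : E n} {γ : List (Fin n)} (hw : JordanWord p γ) :
    (wordPath p γ ∩ cubeVertices n).ncard = γ.length := by
  have h1 : wordPath p γ ∩ cubeVertices n = wordVertex p γ '' Iio γ.length := by
    ext x
    constructor
    · rintro ⟨hx, hv⟩
      obtain ⟨i, hi, rfl⟩ := hw.exists_idx hx hv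
      exact ⟨i, hi, rfl⟩
    · rintro ⟨i, hi, rfl⟩
      exact ⟨hw.vertex_mem_path hi, hw.vertex_mem i⟩
  rw [h1, hw.inj.ncard_image, ← Finset.coe_Iio, Set.ncard_coe_finset, Nat.card_Iio]

theorem CubeSymmetric.ncard_vertices {n : ℕ} {Γ Γ' : Set (E n)} (h : CubeSymmetric Γ Γ') :
    (Γ ∩ cubeVertices n).ncard = (Γ' ∩ cubeVertices n).ncard := by
  obtain ⟨g, hg, rfl⟩ := cubeSymmetric_iff.1 h
  refine Set.ncard_congr (fun x _ => g x) ?_ (fun x y _ _ hxy => g.injective hxy) ?_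
  · rintro x ⟨h1, h2⟩
    exact ⟨mem_image_of_mem _ h1, hg.mem_vertices h2⟩
  · rintro _ ⟨⟨x, hx, rfl⟩, hv⟩
    have h2 := hg.inv.mem_vertices hv
    rw [PreservesCube.inv_apply] at h2
    exact ⟨x, ⟨hx, h2⟩, rfl⟩

/-! ### The Euler characteristic of the quotient -/

/-- Lagrange's theorem: a stabilizer of order `m` has `k` cosets. -/
theorem card_sigma_quotient {ι A : Type} [Fintype ι] [Group A] [Finite A] (K : ι → Subgroup A)
    {m k : ℕ} (hm : ∀ i, Nat.card (K i) = m) (hA : Nat.card A = k * m) (h0 : 0 < m) :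
    Nat.card (Σ i, A ⧸ K i) = Fintype.card ι * k := by
  rw [Nat.card_sigma, Finset.sum_congr rfl (g := fun _ => k), Finset.sum_const, smul_eq_mul,
    Finset.card_univ]
  intro i _
  have h1 := Subgroup.card_eq_card_quotient_mul_card_subgroup (K i)
  rw [hm i, hA] at h1
  exact (Nat.eq_of_mul_eq_mul_right h0 h1).symm

theorem card_signs : Nat.card (Fin 4 → ℤˣ) = 16 := by
  rw [Nat.card_eq_fintype_card]; decide

variable {S₀ : Set (E 4)} {p : E 4} {γ : List (Fin 4)}

theorem card_stabilizerMap_inner {Γ : Set (E 4)} {x : S₀} {a : E 4} (ha : a ∈ cubeVertices 4)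
    {β : Fin 4} (hΓ : segment ℝ a (flip β a) ⊆ Γ) (hx : (x : E 4) ∈ segment ℝ a (flip β a))
    (hxv : (x : E 4) ∉ cubeVertices 4) : Nat.card (stabilizerMap (signs Γ) S₀ x) = 2 := by
  let s : reflectionGroup Γ := ⟨edgeReflection a β, edgeReflection_mem_reflectionGroup ha hΓ⟩
  have h1 : (stabilizerMap (signs Γ) S₀ x : Set (Fin 4 → ℤˣ)) = {1, signs Γ s} := by
    ext k
    exact mem_stabilizerMap_inner ha rfl hΓ hx hxv
  have h2 : (1 : Fin 4 → ℤˣ) ≠ signs Γ s := fun h => by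
    obtain ⟨α, hα⟩ := exists_ne β
    have h3 := congrFun h α
    rw [signs_edgeReflection ha rfl, if_neg hα] at h3
    rw [Pi.one_apply] at h3
    exact absurd h3 (by decide)
  rw [← SetLike.coe_sort_coe, h1, Nat.card_coe_set_eq, Set.ncard_pair h2]

/-- The sign patterns of the two half-turns at a corner are different and not trivial, so the Klein
four-group maps injectively to the sign vectors. -/
theorem card_stabilizerMap_corner {Γ : Set (E 4)} {x : S₀} {β δ : Fin 4}
    (hc : IsCorner Γ (x : E 4) β δ) : Nat.card (stabilizerMap (signs Γ) S₀ x) = 4 := by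
  let s : reflectionGroup Γ := ⟨edgeReflection (x : E 4) β,
    edgeReflection_mem_reflectionGroup hc.vertex ((hc.iff β).2 (Or.inl rfl))⟩
  let t : reflectionGroup Γ := ⟨edgeReflection (x : E 4) δ,
    edgeReflection_mem_reflectionGroup hc.vertex ((hc.iff δ).2 (Or.inr rfl))⟩
  have h1 : (stabilizerMap (signs Γ) S₀ x : Set (Fin 4 → ℤˣ)) =
      {1, signs Γ s, signs Γ t, signs Γ s * signs Γ t} := by
    ext k
    exact mem_stabilizerMap_corner hc rfl rfl
  have hs : signs Γ s = fun α => if α = β then 1 else -1 :=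
    funext (signs_edgeReflection hc.vertex rfl)
  have ht : signs Γ t = fun α => if α = δ then 1 else -1 :=
    funext (signs_edgeReflection hc.vertex rfl)
  rw [← SetLike.coe_sort_coe, h1, Nat.card_coe_set_eq, hs, ht]
  have key : ∀ β δ : Fin 4, β ≠ δ → (({1, fun α => if α = β then 1 else -1,
      fun α => if α = δ then 1 else -1, (fun α => if α = β then 1 else -1) *
      fun α => if α = δ then 1 else -1} : Finset (Fin 4 → ℤˣ))).card = 4 := by decide
  refine Eq.trans ?_ (key β δ hc.ne)
  rw [← Set.ncard_coe_finset]
  simp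

theorem stabilizerMap_edge (hw : JordanWord p γ) {i : ℕ} (hi : i < γ.length) {x y : Fin 1 → ℝ}
    (hx : x ∈ Metric.ball 0 1) (hy : y ∈ Metric.ball 0 1) {u v : S₀}
    (hu : (u : E 4) = hw.loop (edgeParam i x)) (hv : (v : E 4) = hw.loop (edgeParam i y)) :
    stabilizerMap (signs (wordPath p γ)) S₀ u = stabilizerMap (signs (wordPath p γ)) S₀ v := by
  let s : reflectionGroup (wordPath p γ) := ⟨edgeReflection (wordVertex p γ i) γ[i],
    edgeReflection_mem_reflectionGroup (hw.vertex_mem i) (hw.segment_subset hi)⟩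
  have key : ∀ {x : Fin 1 → ℝ} {u : S₀}, x ∈ Metric.ball 0 1 →
      (u : E 4) = hw.loop (edgeParam i x) → ∀ k,
      k ∈ stabilizerMap (signs (wordPath p γ)) S₀ u ↔ k = 1 ∨ k = signs _ s := by
    intro x u hx hu k
    obtain ⟨h1, h2⟩ := edgeParam_mem (i := i) (Metric.ball_subset_closedBall hx)
    refine mem_stabilizerMap_inner (hw.vertex_mem i) rfl (hw.segment_subset hi) ?_ ?_
    · rw [hu]; exact hw.loop_mem_segment hi h1 h2
    · rw [hu]; exact hw.loop_not_vertex hi hx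
  ext k
  rw [key hx hu, key hy hv]

theorem zero_mem_ball (k : ℕ) : (0 : Fin k → ℝ) ∈ Metric.ball 0 1 := by simp

/-- Among the sixteen patches, four share each vertex and two share each edge. With `L` the length
of the word there are `4 L` vertices, `8 L` edges and `16` faces, and `16 - 4 L = 2 - 2 g` gives `g
= 2 L - 7`. -/
theorem isClosedSurfaceOfGenus_quotient (hw : JordanWord p γ) (h : IsInitialDisk (wordPath p γ) S₀)
    (hv : VertexCondition (wordPath p γ)) {g : ℕ} (hg : 2 * γ.length = g + 7) :
    IsClosedSurfaceOfGenus (TranslationQuotient (completeSurface (wordPath p γ) S₀)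
      (evenLattice (wordPath p γ) S₀)) g := by
  obtain ⟨hS, f, hb⟩ := h
  have hΓ := hS.boundary_subset
  have hP := hS.isPatchSystem_quotient hv
  have := t2Space_quotient (wordPath p γ) S₀
  have := hS.compactSpace hv
  have := connectedSpace_completeSurface (isConnected_of_disk f) hΓ
  obtain ⟨d, hd, hdi, hdb, hds⟩ := exists_squareToDisk
  let D : (Fin 2 → ℝ) → S₀ := fun x => f.symm (toDisk (d x))
  have hfD : ∀ x, ‖d x‖ ≤ 1 → (f (D x) : ℂ) = d x := fun x hx => by
    rw [f.apply_symm_apply, coe_toDisk hx]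
  have hball : ∀ x ∈ Metric.ball (0 : Fin 2 → ℝ) 1, ‖d x‖ < 1 := fun x hx =>
    mem_ball_zero_iff.1 (hdb.subset (mem_image_of_mem d hx))
  have hDb : ∀ y : S₀, (y : E 4) ∉ wordPath p γ ↔
      ∃ x ∈ Metric.ball (0 : Fin 2 → ℝ) 1, D x = y := by
    intro y
    rw [hb]
    constructor
    · intro hy
      obtain ⟨x, hx, hxy⟩ := hdb.symm.subset
        (mem_ball_zero_iff.2 (lt_of_le_of_ne (disk_norm_le (f y)) hy))
      refine ⟨x, hx, f.injective (Subtype.ext ?_)⟩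
      rw [hfD x (hball x hx).le, hxy]
    · rintro ⟨x, hx, rfl⟩
      rw [hfD x (hball x hx).le]
      exact (hball x hx).ne
  have hDs : ∀ x ∈ Metric.sphere (0 : Fin 2 → ℝ) 1, (D x : E 4) ∈ wordPath p γ := by
    intro x hx
    have h1 := mem_sphere_zero_iff_norm.1 (hds.subset (mem_image_of_mem d hx))
    rw [hb, hfD x h1.le, h1]
  let c := hw.cellData hΓ D (f.symm.continuous.comp (continuous_toDisk.comp hd))
    (fun x hx y hy hxy => hdi (by rw [← hfD x (hball x hx).le, hxy, hfD y (hball y hy).le])) hDb hDs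
  have hK : ∀ k (i : c.cell k), ∀ x ∈ Metric.ball (0 : Fin k → ℝ) 1,
      stabilizerMap (signs (wordPath p γ)) S₀ (c.map k i x) =
        stabilizerMap (signs (wordPath p γ)) S₀ (c.map k i 0)
    | 0, i, x, _ => by rw [Subsingleton.elim x 0]
    | 1, i, x, hx => stabilizerMap_edge hw i.2 hx (zero_mem_ball 1)
        (hw.diskMap_one hΓ D i (Metric.ball_subset_closedBall hx))
        (hw.diskMap_one hΓ D i (Metric.ball_subset_closedBall (zero_mem_ball 1)))
    | 2, i, x, hx => (stabilizerMap_eq_bot ((hDb _).2 ⟨x, hx, rfl⟩)).trans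
        (stabilizerMap_eq_bot ((hDb _).2 ⟨0, zero_mem_ball 2, rfl⟩)).symm
    | _ + 3, i, _, _ => i.elim
  let C := c.ofPatches hP hK
  refine ⟨hS.isOrientableSurface_quotient hv (isOrientableSurface_interior hS.nonempty_interior f hb),
    inferInstance, connectedSpace_translationQuotient, C.toCWComplex, C.finite, C.isEmpty, ?_⟩
  have h0 : Nat.card (C.cell 0) = γ.length * 4 := by
    have h1 := card_sigma_quotient (ι := Fin γ.length) (m := 4) (k := 4)
      (fun i => stabilizerMap (signs (wordPath p γ)) S₀ (c.map 0 i 0))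
      (fun i => card_stabilizerMap_corner (hw.isCorner i.2)) card_signs (by norm_num)
    rwa [Fintype.card_fin] at h1
  have h1 : Nat.card (C.cell 1) = γ.length * 8 := by
    have h1 := card_sigma_quotient (ι := Fin γ.length) (m := 2) (k := 8)
      (fun i => stabilizerMap (signs (wordPath p γ)) S₀ (c.map 1 i 0))
      (fun i => by
        have h2 := Metric.ball_subset_closedBall (zero_mem_ball 1)
        have h3 := hw.diskMap_one hΓ D i h2
        refine card_stabilizerMap_inner (hw.vertex_mem i) (hw.segment_subset i.2) ?_ ?_
        · exact h3 ▸ hw.loop_mem_segment i.2 (edgeParam_mem h2).1 (edgeParam_mem h2).2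
        · exact h3 ▸ hw.loop_not_vertex i.2 (zero_mem_ball 1)) card_signs (by norm_num)
    rwa [Fintype.card_fin] at h1
  have h2 : Nat.card (C.cell 2) = 16 := by
    have h1 := card_sigma_quotient (ι := Unit) (m := 1) (k := 16)
      (fun i => stabilizerMap (signs (wordPath p γ)) S₀ (c.map 2 i 0))
      (fun i => by
        have h2 : stabilizerMap (signs (wordPath p γ)) S₀ (c.map 2 i 0) = ⊥ :=
          stabilizerMap_eq_bot ((hDb _).2 ⟨0, zero_mem_ball 2, rfl⟩)
        rw [h2]; exact Subgroup.card_bot) card_signs (by norm_num)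
    rwa [Fintype.card_unit, one_mul] at h1
  change (Nat.card (C.cell 0) : ℤ) - Nat.card (C.cell 1) + Nat.card (C.cell 2) = 2 - 2 * g
  rw [h0, h1, h2]
  push_cast
  have hg' : (2 * γ.length : ℤ) = g + 7 := by exact_mod_cast hg
  linarith

/-- The length of the word is the number of vertices on the path, which is a symmetry invariant; so
it is `8`, `10` or `12` as for the five paths. -/
theorem IsInitialDisk.isClosedSurfaceOfGenus {Γ S₀ : Set (E 4)} (h : IsInitialDisk Γ S₀) {k : Fin 5}
    (hk : CubeSymmetric Γ (fivePaths k)) :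
    IsClosedSurfaceOfGenus (TranslationQuotient (completeSurface Γ S₀) (evenLattice Γ S₀))
      (![9, 9, 9, 13, 17] k) := by
  have hv := (vertexCondition_iff h.1.jordan).2 ⟨k, hk⟩
  obtain ⟨p, γ, hw, rfl⟩ := isJordanPath_iff.1 h.1.jordan
  refine isClosedSurfaceOfGenus_quotient hw h hv ?_
  have h1 := hk.ncard_vertices
  rw [hw.ncard_vertices, fivePaths_eq, (jordanWord_fiveWords k).ncard_vertices] at h1
  rw [h1]
  clear h1 hk
  revert k
  decide

end

end CubeSurface

end

open CubeSurface in
/-- Classification of the embedded periodic surfaces in `ℝ⁴` generated by Jordan paths. -/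
theorem theorem7p3 :
    -- five Jordan paths with 8, 8, 8, 10, 12 edges, pairwise different up to symmetry
    (∀ k, IsJordanPath (fivePaths k) ∧ (fiveWords k).length = ![8, 8, 8, 10, 12] k) ∧
    (∀ j k, CubeSymmetric (fivePaths j) (fivePaths k) → j = k) ∧
    -- each Jordan path bounds an initial surface, even a disk
    (∀ Γ : Set (E 4), IsJordanPath Γ → ∃ S₀, IsInitialDisk Γ S₀) ∧
    -- the complete surface is embedded exactly for these five paths
    (∀ Γ S₀ : Set (E 4), IsInitialSurface Γ S₀ →
      (GeneratesEmbedded Γ S₀ ↔ ∃ k, CubeSymmetric Γ (fivePaths k))) ∧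
    -- the embedded surfaces and their quotients are orientable
    (∀ Γ S₀ : Set (E 4), IsInitialSurface Γ S₀ → IsOrientableSurface ↥(S₀ \ Γ) →
      GeneratesEmbedded Γ S₀ →
        IsOrientableSurface (completeSurface Γ S₀) ∧
        IsOrientableSurface (TranslationQuotient (completeSurface Γ S₀)
          (lattice (completeSurface Γ S₀) ⊓ multiples 4 2))) ∧
    -- the genus of the quotients
    (∀ (k : Fin 5) (Γ S₀ : Set (E 4)), IsInitialDisk Γ S₀ → CubeSymmetric Γ (fivePaths k) →
      IsClosedSurfaceOfGenus (TranslationQuotient (completeSurface Γ S₀)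
        (lattice (completeSurface Γ S₀) ⊓ multiples 4 2)) (![9, 9, 9, 13, 17] k)) := by
  refine ⟨fun k => ⟨isJordanPath_fivePaths k, by fin_cases k <;> rfl⟩,
    fun j k => fivePaths_injective, fun Γ hΓ => exists_isInitialDisk hΓ,
    fun Γ S₀ h => h.generatesEmbedded_iff.trans (vertexCondition_iff h.jordan), ?_, ?_⟩
  · intro Γ S₀ h ho he
    have hv := h.generatesEmbedded_iff.1 he
    exact ⟨h.isOrientableSurface_completeSurface hv ho, h.isOrientableSurface_quotient hv ho⟩
  · intro k Γ S₀ h hk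
    exact h.isClosedSurfaceOfGenus hk
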